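/- **Data words.** A data $\omega$-word $\sigma$ over a finite alphabet $\Sigma$ is an $\omega$-word $\mathrm{str}(\sigma)=\sigma(0)\sigma(1)\cdots$ over $\Sigma$ together with an equivalence relation $\sim$ on $\mathbb N$; $[i]_\sim$ is the class of $i$. **Safety 1ARA$_1$.** A safety one-way alternating automaton with one register is $\mathcal A=\langle\Sigma,Q,q_I,\delta\rangle$ with $\Sigma,Q$ finite, $q_I\in Q$, and $\delta:Q\times\Sigma\times\{\uparrow,\not\uparrow\}\to\mathcal B^+_\downarrow(Q)$, where $\mathcal B^+_\downarrow(Q)$ is the set of positive Boolean formulae $\varphi::=q\mid{\downarrow}q\mid\top\mid\bot\mid\varphi\wedge\varphi\mid\varphi\vee\varphi$ ($q\in Q$). A pair $P,P_\downarrow\subseteq Q$ satisfies $q$ iff $q\in P$, satisfies ${\downarrow}q$ iff $q\in P_\downarrow$, and the other cases are standard. Configurations for $\sigma$ are elements of $Q\times(\mathbb N/{\sim})$. For finite sets $F,F'$ of configurations, $F\xrightarrow{\sigma,i}F'$ iff for each $\langle q,D\rangle\in F$ there are $P^{q,D},P^{q,D}_\downarrow\subseteq Q$ satisfying $\delta(q,\sigma(i),\uparrow)$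 if $D=[i]_\sim$ and $\delta(q,\sigma(i),\not\uparrow)$ if $D\ne[i]_\sim$, such that $$F'=\{\langle q',D\rangle:\langle q,D\rangle\in F,\ q'\in P^{q,D}\}\cup\{\langle q',[i]_\sim\rangle:\langle q,D\rangle\in F,\ q'\in P^{q,D}_\downarrow\}.$$ $\mathrm L(\mathcal A)$ is the set of all data $\omega$-words $\sigma$ for which there is an infinite sequence $F_0\xrightarrow{\sigma,0}F_1\xrightarrow{\sigma,1}\cdots$ with $F_0=\{\langle q_I,[0]_\sim\rangle\}$. **Safety IPCANT.** A safety powerset counter automaton with nondeterministic transfers and incrementing errors is $\mathcal C=\langle\Sigma,Q,q_I,X,C,\delta\rangle$ with $\Sigma,Q,X$ finite, $q_I\in Q$, a set $C\subseteq\mathcal P(X)\setminus\{\emptyset\}$ of counters over the basis $X$, and $\delta\subseteq Q\times(\Sigma\uplus\{\varepsilon\})\times L(C)\times Q$ containing no cycle of $\varepsilon$ transitions. Here $L(C)$ consists of the instructions $\langle\mathtt{inc},c\rangle$ and $\langle\mathtt{dec},c\rangle$ for $c\in C$, and $\langle\mathtt{transf},f\rangle$ for $f:C\to\mathcal P(C)$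 that are distributive: whenever $c\in C$, $c\subseteq\bigcup_{i=1}^kc_i$ and $c_i'\in f(c_i)$ for all $i$, there is $c'\in f(c)$ with $c'\subseteq\bigcup_{i=1}^kc_i'$. Configurations are pairs $\langle q,v\rangle$ with $q\in Q$ and $v:C\to\mathbb N$. Instructions $\mathtt{inc}$, $\mathtt{dec}$ have the standard meaning ($\mathtt{dec}$ requires $v(c)>0$), and $\langle\mathtt{transf},f\rangle$ leads from $v$ to $v'$ iff there are $K^c_{c'}\in\mathbb N$ ($c\in C$, $c'\in f(c)$) with $v(c)=\sum_{c'\in f(c)}K^c_{c'}$ for all $c$ and $v'(c')=\sum_{c:\,f(c)\ni c'}K^c_{c'}$ for all $c'$. There is a transition $\langle q,v\rangle\xrightarrow{w,l}\langle q',v'\rangle$ iff $\langle q,w,l,q'\rangle\in\delta$ and, for some $u\ge v$ and $u'\le v'$ (pointwise), $l$ leads from $u$ to $u'$. $\mathrm L(\mathcal C)$ is the set of all $\omega$-words $w=w_0w_1\cdots$ over $\Sigma$ for which there is an infinite run $\langle q_0,v_0\rangle\xrightarrow{w_0,l_0}\langle q_1,v_1\rangle\xrightarrow{w_1,l_1}\cdots$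 with $\langle q_0,v_0\rangle=\langle q_I,\mathbf 0\rangle$. **Theorem.** There are a deterministic Turing machine $T$ with a write-only output (whose length does not count towards the space used), a polynomial $p$ and a constant $k$ such that, for every safety 1ARA$_1$ $\mathcal A=\langle\Sigma,Q,q_I,\delta\rangle$, given as a string of length $m$ that lists its transition table, $T$ halts using space at most $p(m)$, and outputs an explicit description (lists of the states, counters and transitions) of a safety IPCANT $\mathcal C_{\mathcal A}$ such that: 1. $\mathcal C_{\mathcal A}$ has the same alphabet $\Sigma$ as $\mathcal A$; 2. the basis of $\mathcal C_{\mathcal A}$ has at most $k\cdot|Q|$ elements; 3. $\mathrm L(\mathcal C_{\mathcal A})=\{\mathrm{str}(\sigma):\sigma\in\mathrm L(\mathcal A)\}$. In particular, $\mathrm L(\mathcal C_{\mathcal A})\ne\emptyset$ if and only if $\mathrm L(\mathcal A)\ne\emptyset$. -/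

import Mathlib

/-! ### Data words -/

/-- A data `ω`-word over `S`: an `ω`-word together with an equivalence relation on positions. -/
structure DataWord (S : Type) where
  str : ℕ → S
  rel : Setoid ℕ

namespace DataWord

/-- The classes of positions of a data word (its "data"). -/
abbrev Datum {S : Type} (σ : DataWord S) : Type := Quotient σ.rel

/-- The class `[i]` of position `i`. -/
abbrev cls {S : Type} (σ : DataWord S) (i : ℕ) : σ.Datum := Quotient.mk σ.rel i

end DataWord

/-! ### Safety one-way alternating automata with one register -/

/-- Positive Boolean formulae over `Q ∪ ↓Q`. -/
inductive PosBool (Q : Type) : Type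
  | state (q : Q)
  | down (q : Q)
  | top
  | bot
  | and (φ ψ : PosBool Q)
  | or (φ ψ : PosBool Q)

namespace PosBool

/-- `φ.Sat P P'` is satisfaction of `φ` by the pair `P, P'`, where `P'` interprets `↓Q`. -/
def Sat {Q : Type} (P P' : Set Q) : PosBool Q → Prop
  | state q => q ∈ P
  | down q => q ∈ P'
  | top => True
  | bot => False
  | and φ ψ => Sat P P' φ ∧ Sat P P' ψ
  | or φ ψ => Sat P P' φ ∨ Sat P P' ψ

end PosBool

/-- A safety 1ARA₁ over the alphabet `S`.  The last argument of `δ` is `true` if the register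
value is the class of the current position, and `false` otherwise. -/
structure SafetyARA (S : Type) where
  Q : Type
  [fintypeQ : Fintype Q]
  init : Q
  δ : Q → S → Bool → PosBool Q

attribute [instance] SafetyARA.fintypeQ

namespace SafetyARA

variable {S : Type}

/-- Configurations: a state and a register value. -/
abbrev Config (A : SafetyARA S) (σ : DataWord S) : Type := A.Q × σ.Datum

/-- The transition relation between finite sets of configurations at position `i` of `σ`. -/
def Step (A : SafetyARA S) (σ : DataWord S) (i : ℕ) (F F' : Finset (A.Config σ)) : Prop :=
  ∃ P P' : A.Config σ → Set A.Q,
    (∀ q D, (q, D) ∈ F →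
      (D = σ.cls i → (A.δ q (σ.str i) true).Sat (P (q, D)) (P' (q, D))) ∧
      (D ≠ σ.cls i → (A.δ q (σ.str i) false).Sat (P (q, D)) (P' (q, D)))) ∧
    (F' : Set (A.Config σ)) =
      {x | ∃ q D, (q, D) ∈ F ∧ ∃ q' ∈ P (q, D), x = (q', D)} ∪
      {x | ∃ q D, (q, D) ∈ F ∧ ∃ q' ∈ P' (q, D), x = (q', σ.cls i)}

/-- `A` accepts `σ` iff it has an infinite run on `σ` from the initial configuration. -/
def Accepts (A : SafetyARA S) (σ : DataWord S) : Prop :=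
  ∃ F : ℕ → Finset (A.Config σ),
    F 0 = {(A.init, σ.cls 0)} ∧ ∀ i, A.Step σ i (F i) (F (i + 1))

/-- The language of `A`. -/
def language (A : SafetyARA S) : Set (DataWord S) := {σ | A.Accepts σ}

end SafetyARA

/-! ### Safety powerset counter automata with nondeterministic transfers and incrementing errors -/

/-- Counter instructions over a type `C` of counters. -/
inductive CounterInstr (C : Type) : Type
  | inc (c : C)
  | dec (c : C)
  | transf (f : C → Finset C)

namespace CounterInstr

/-- `l.Performs v v'`: the valuation `v'` can be obtained from `v` by `l`, without errors. -/
def Performs {C : Type} [Fintype C] [DecidableEq C] :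
    CounterInstr C → (C → ℕ) → (C → ℕ) → Prop
  | inc c, v, v' => v' = Function.update v c (v c + 1)
  | dec c, v, v' => 0 < v c ∧ v' = Function.update v c (v c - 1)
  | transf f, v, v' => ∃ K : C → C → ℕ,
      (∀ c, v c = ∑ c' ∈ f c, K c c') ∧
      (∀ c', v' c' = ∑ c with c' ∈ f c, K c c')

end CounterInstr

/-- Distributivity of a mapping from counters to sets of counters, where the counters are the
members of a family `C` of subsets of `X`. -/
def IsDistributive {X : Type} {C : Finset (Finset X)} (f : C → Finset C) : Prop :=
  ∀ (c : C) (k : ℕ) (d d' : Fin k → C),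
    (∀ x ∈ c.1, ∃ i, x ∈ (d i).1) → (∀ i, d' i ∈ f (d i)) →
    ∃ c' ∈ f c, ∀ x ∈ c'.1, ∃ i, x ∈ (d' i).1

/-- A safety IPCANT over the alphabet `S`.  In transitions, the label `none` is `ε`. -/
structure SafetyIPCANT (S : Type) where
  Q : Type
  [fintypeQ : Fintype Q]
  init : Q
  /-- the basis -/
  X : Type
  [fintypeX : Fintype X]
  [decEqX : DecidableEq X]
  /-- the set of counters -/
  C : Finset (Finset X)
  nonempty_of_mem : ∀ c ∈ C, c.Nonempty
  δ : Set (Q × Option S × CounterInstr C × Q)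
  distributive : ∀ q w f q', (q, w, CounterInstr.transf f, q') ∈ δ → IsDistributive f
  /-- there is no cycle of `ε` transitions -/
  acyclic : ∀ q, ¬ Relation.TransGen (fun p p' => ∃ l, (p, none, l, p') ∈ δ) q q

attribute [instance] SafetyIPCANT.fintypeQ SafetyIPCANT.fintypeX SafetyIPCANT.decEqX

namespace SafetyIPCANT

variable {S : Type}

/-- Counter valuations. -/
abbrev Val (A : SafetyIPCANT S) : Type := A.C → ℕ

/-- Error-free transitions between configurations. -/
def StepExact (A : SafetyIPCANT S) (w : Option S) (l : CounterInstr A.C)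
    (x x' : A.Q × A.Val) : Prop :=
  (x.1, w, l, x'.1) ∈ A.δ ∧ l.Performs x.2 x'.2

/-- Transitions, which may contain incrementing errors. -/
def Step (A : SafetyIPCANT S) (w : Option S) (l : CounterInstr A.C)
    (x x' : A.Q × A.Val) : Prop :=
  ∃ u u' : A.Val, x.2 ≤ u ∧ A.StepExact w l (x.1, u) (x'.1, u') ∧ u' ≤ x'.2

/-- `SpellsWord lab w`: the concatenation of the labels `lab 0, lab 1, …`, in which `none` is the
empty word, is the `ω`-word `w`; `φ` enumerates the positions of the labels that are letters. -/
def SpellsWord (lab : ℕ → Option S) (w : ℕ → S) : Prop :=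
  ∃ φ : ℕ → ℕ, StrictMono φ ∧ (∀ n, lab (φ n) = some (w n)) ∧
    ∀ j, j ∉ Set.range φ → lab j = none

/-- `A` accepts `w` iff it has an infinite run over `w`, possibly with incrementing errors, from
the initial state with all counters zero. -/
def Accepts (A : SafetyIPCANT S) (w : ℕ → S) : Prop :=
  ∃ (x : ℕ → A.Q × A.Val) (lab : ℕ → Option S) (l : ℕ → CounterInstr A.C),
    x 0 = (A.init, 0) ∧ (∀ i, A.Step (lab i) (l i) (x i) (x (i + 1))) ∧ SpellsWord lab w

/-- The language of `A`. -/
def language (A : SafetyIPCANT S) : Set (ℕ → S) := {w | A.Accepts w}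

end SafetyIPCANT

/-! ### Representing automata by strings

Letters are numbered.  States of a register automaton are numbered as well, and numbers are
written in tally notation; since the transition function is written out as a table, that makes at
most a polynomial difference to the size.  States of a counter automaton, of which there may be
exponentially many, are named by arbitrary distinct bit strings. -/

/-- The symbols used in representations. -/
inductive Token : Type
  | zero | one | sep | lpar | rpar
  | st | down | top | bot | and | or
  | eps | letter | inc | dec | transf
  deriving DecidableEq

namespace Token

/-- Tally notation. -/
def tally (n : ℕ) : List Token := List.replicate n one ++ [sep]

/-- Bit strings. -/
def bits (l : List Bool) : List Token := l.map (fun b => if b then one else zero) ++ [sep]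

end Token

namespace PosBool

/-- Formulae in prefix notation. -/
def encode {Q : Type} (num : Q → ℕ) : PosBool Q → List Token
  | state q => Token.st :: Token.tally (num q)
  | down q => Token.down :: Token.tally (num q)
  | top => [Token.top]
  | bot => [Token.bot]
  | and φ ψ => Token.and :: (encode num φ ++ encode num ψ)
  | or φ ψ => Token.or :: (encode num φ ++ encode num ψ)

end PosBool

/-- The string representing `A` with respect to numberings of letters and states: the numbers of
letters and of states, the initial state, and the table of the transition function. -/
def SafetyARA.encode {S : Type} [Fintype S] (A : SafetyARA S)
    (eS : S ≃ Fin (Fintype.card S)) (eQ : A.Q ≃ Fin (Fintype.card A.Q)) : List Token :=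
  Token.tally (Fintype.card S) ++ Token.tally (Fintype.card A.Q) ++ Token.tally (eQ A.init) ++
    (List.finRange (Fintype.card A.Q)).flatMap fun q =>
      (List.finRange (Fintype.card S)).flatMap fun a =>
        [true, false].flatMap fun b =>
          (A.δ (eQ.symm q) (eS.symm a) b).encode fun p => (eQ p : ℕ)

/-- `IsListing s R w`: the string `w` is a parenthesized enumeration of all members of the set `s`
(in any order, repetitions allowed), each member `a` being represented by a string `u` with
`R a u`. -/
def IsListing {α : Type} (s : Set α) (R : α → List Token → Prop) (w : List Token) : Prop :=
  ∃ L : List (α × List Token),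
    (∀ a, a ∈ s ↔ ∃ p ∈ L, p.1 = a) ∧ (∀ p ∈ L, R p.1 p.2) ∧
    w = Token.lpar :: ((L.map Prod.snd).flatten ++ [Token.rpar])

namespace SafetyIPCANT

variable {S : Type}

/-- A subset of the basis as a bit vector, with respect to a numbering of the basis. -/
def encodeSubset (A : SafetyIPCANT S) (eX : A.X ≃ Fin (Fintype.card A.X)) (c : Finset A.X) :
    List Token :=
  Token.bits ((List.finRange (Fintype.card A.X)).map fun i => decide (eX.symm i ∈ c))

/-- The string `w` represents the instruction `l`.  The mapping of a transfer is represented by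
an enumeration of the pairs `(c, c')` with `c' ∈ f c`. -/
def InstrDescribedBy (A : SafetyIPCANT S) (eX : A.X ≃ Fin (Fintype.card A.X)) :
    CounterInstr A.C → List Token → Prop
  | .inc c, w => w = Token.inc :: A.encodeSubset eX c.1
  | .dec c, w => w = Token.dec :: A.encodeSubset eX c.1
  | .transf f, w => ∃ u, w = Token.transf :: u ∧
      IsListing {p : A.C × A.C | p.2 ∈ f p.1}
        (fun p z => z = A.encodeSubset eX p.1.1 ++ A.encodeSubset eX p.2.1) u

/-- Transition labels. -/
def encodeLabel [Fintype S] (eS : S ≃ Fin (Fintype.card S)) : Option S → List Token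
  | none => [Token.eps]
  | some a => Token.letter :: Token.tally (eS a)

/-- The string `w` represents the transition `t`. -/
def TransDescribedBy [Fintype S] (A : SafetyIPCANT S) (eS : S ≃ Fin (Fintype.card S))
    (eX : A.X ≃ Fin (Fintype.card A.X)) (name : A.Q → List Bool)
    (t : A.Q × Option S × CounterInstr A.C × A.Q) (w : List Token) : Prop :=
  ∃ u, A.InstrDescribedBy eX t.2.2.1 u ∧
    w = Token.bits (name t.1) ++ encodeLabel eS t.2.1 ++ u ++ Token.bits (name t.2.2.2)

/-- The string `w` represents `A` with respect to the numbering `eS` of letters: for some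
numbering of the basis and some naming of the states by distinct bit strings, `w` consists of the
number of letters, the set of states, the initial state, the size of the basis, the set of
counters, and the transition relation. -/
def DescribedBy [Fintype S] (A : SafetyIPCANT S) (eS : S ≃ Fin (Fintype.card S))
    (w : List Token) : Prop :=
  ∃ (eX : A.X ≃ Fin (Fintype.card A.X)) (name : A.Q → List Bool) (wQ wC wδ : List Token),
    Function.Injective name ∧
    IsListing Set.univ (fun q u => u = Token.bits (name q)) wQ ∧
    IsListing (A.C : Set (Finset A.X)) (fun c u => u = A.encodeSubset eX c) wC ∧
    IsListing A.δ (A.TransDescribedBy eS eX name) wδ ∧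
    w = Token.tally (Fintype.card S) ++ wQ ++ Token.bits (name A.init) ++
      Token.tally (Fintype.card A.X) ++ wC ++ wδ

end SafetyIPCANT

/-! ### Space-bounded computation with a write-only output -/

/-- The statement never inspects nor removes the contents of stack `k`. -/
def NeverReads {K : Type} {Γ : K → Type} {Λ σ : Type} (k : K) : Turing.TM2.Stmt Γ Λ σ → Prop
  | .push _ _ q => NeverReads k q
  | .peek j _ q => j ≠ k ∧ NeverReads k q
  | .pop j _ q => j ≠ k ∧ NeverReads k q
  | .load _ q => NeverReads k q
  | .branch _ q₁ q₂ => NeverReads k q₁ ∧ NeverReads k q₂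
  | .goto _ => True
  | .halt => True

/-- A deterministic Turing machine with finitely many stacks over finite alphabets, whose output
stack is write-only. -/
structure Transducer (I O : Type) extends Turing.TM2ComputableAux I O where
  finite_alphabet : ∀ k, Finite (tm.Γ k)
  input_ne_output : tm.k₀ ≠ tm.k₁
  write_only : ∀ l, NeverReads tm.k₁ (tm.m l)

namespace Transducer

variable {I O : Type}

/-- The configurations that occur in the computation on input `x`. -/
def Visits (T : Transducer I O) (x : List I)
    (c : Turing.TM2.Cfg T.tm.Γ T.tm.Λ T.tm.σ) : Prop :=
  Turing.TM2.Reaches T.tm.m (Turing.initList T.tm (x.map T.inputAlphabet.symm)) c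

/-- The space used by a configuration: the number of symbols on all the stacks except the
output. -/
def space (T : Transducer I O) (c : Turing.TM2.Cfg T.tm.Γ T.tm.Λ T.tm.σ) : ℕ :=
  letI := T.tm.kFin
  ∑ k with k ≠ T.tm.k₁, (c.stk k).length

/-- On input `x`, the machine halts having written `y` (in this order) to the output, and uses
space at most `b` throughout. -/
def OutputsInSpace (T : Transducer I O) (x : List I) (y : List O) (b : ℕ) : Prop :=
  (∃ c, T.Visits x c ∧ c.l = none ∧ ((c.stk T.tm.k₁).map T.outputAlphabet).reverse = y) ∧
  ∀ c, T.Visits x c → T.space c ≤ b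

end Transducer

/-! Equal data with equal sets of states are interchangeable: at any position, what matters about a
class other than the current one is only the set of states paired with it. The counter automaton
therefore keeps the set of the current class in its control state and, for every set `d` of states,
counts the other classes that carry `d`. A position takes three transitions. Reading the letter
guesses the new set `e` of the current class and transfers every other class from its set `d` to
some `d'` such that the formulae of `d` hold with `d'` for stored states and `e` for `↓`-states.
Then `inc` puts the current class back under `e`, and `dec` takes out the class of the next
position. The empty set of states is also counted; a dummy basis element, present in all counters,
keeps counters nonempty. This gives a basis of `|Q| + 1 ≤ 2|Q|` elements. Transfers are distributive
because positive formulae are monotone.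

A run of the register automaton gives a run of the counter automaton (`toIPCANT_accepts`); an
incrementing error occurs exactly where a new class enters. Conversely
(`accepts_of_toIPCANT_accepts`), a data word is built by tracking data whose labelled numbers are
bounded above by the counters. Surplus counter values are ignored. A `dec` that no tracked datum can
account for introduces a fresh datum, whose label may be larger than its actual (empty) set of
states. This is harmless: the conditions on labels quantify over all their states, so they restrict
to any subset, and a safety run only has to exist forever. Transfers and relabellings of finite sets
of data are matched by `performs_transf_of_labelling` and `exists_labelling_of_performs_transf`.

For the space bound, the automaton is written by a structured program over stacks. It enumerates
sets of states by binary counting on one cell per state, and evaluates all formulae of the table by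
a value stack before each conditional output. Space is bounded by a potential argument checked
statically (`Prog.credit`, `Exec.lightPath`): an input symbol weighs 2, an output symbol 0, any
other symbol 1, and every push is paid for by an earlier pop. Hence the total weight never exceeds
its initial value, and the space used is at most twice the input length. Program correctness is
proved with weakest preconditions (`wp`, `Emits`), ending in `exec_program`, and
`toIPCANT_describedBy` recognizes the output as a description of the automaton. -/

/-! ### Labellings and transfers -/

section Labelling

variable {C ι : Type}

open scoped Classical in
/-- The number of members of `B` with label `c`. -/
noncomputable def labelCount (B : Finset ι) (lab : ι → C) (c : C) : ℕ :=
  (B.filter fun D => lab D = c).card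

theorem labelCount_mono {B B' : Finset ι} (h : B ⊆ B') (lab : ι → C) :
    labelCount B lab ≤ labelCount B' lab := by
  classical
  intro c
  exact Finset.card_le_card (Finset.filter_subset_filter _ h)

theorem labelCount_insert_self [DecidableEq ι] {B : Finset ι} {D : ι} (hD : D ∉ B)
    (lab : ι → C) : labelCount (insert D B) lab (lab D) = labelCount B lab (lab D) + 1 := by
  unfold labelCount
  rw [Finset.filter_insert, if_pos rfl, Finset.card_insert_of_notMem (by simp [hD])]

theorem labelCount_insert_of_ne [DecidableEq ι] {B : Finset ι} {D : ι} (lab : ι → C) {c : C}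
    (hc : c ≠ lab D) : labelCount (insert D B) lab c = labelCount B lab c := by
  unfold labelCount
  rw [Finset.filter_insert, if_neg hc.symm]

theorem labelCount_congr {B : Finset ι} {lab lab' : ι → C} (h : ∀ D ∈ B, lab D = lab' D) :
    labelCount B lab = labelCount B lab' := by
  classical
  funext c
  unfold labelCount
  congr 1
  exact Finset.filter_congr fun D hD => by rw [h D hD]

theorem labelCount_eq_zero {B : Finset ι} {lab : ι → C} {c : C} (h : ∀ D ∈ B, lab D ≠ c) :
    labelCount B lab c = 0 := by
  unfold labelCount
  classical
  rw [Finset.card_eq_zero, Finset.filter_eq_empty_iff]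
  exact fun D hD => h D hD

variable {fintypeC : Fintype C} {decEqC : DecidableEq C}

theorem CounterInstr.performs_inc_iff {c : C} {v v' : C → ℕ} :
    (CounterInstr.inc c).Performs v v' ↔ v' c = v c + 1 ∧ ∀ x, x ≠ c → v' x = v x := by
  simp only [CounterInstr.Performs, Function.eq_update_iff]

theorem CounterInstr.performs_dec_iff {c : C} {v v' : C → ℕ} :
    (CounterInstr.dec c).Performs v v' ↔ v c = v' c + 1 ∧ ∀ x, x ≠ c → v' x = v x := by
  simp only [CounterInstr.Performs, Function.eq_update_iff]
  constructor
  · rintro ⟨h, h', h''⟩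
    exact ⟨by omega, h''⟩
  · rintro ⟨h, h'⟩
    exact ⟨by omega, by omega, h'⟩

/-- Take for `K c c'` the number of data relabelled from `c` to `c'`. Its row sums count by the old
label and its column sums by the new one. -/
theorem CounterInstr.performs_transf_of_labelling {f : C → Finset C} {B : Finset ι}
    {lab lab' : ι → C} (h : ∀ D ∈ B, lab' D ∈ f (lab D)) :
    (CounterInstr.transf f).Performs (labelCount B lab) (labelCount B lab') := by
  classical
  refine ⟨fun c c' => ((B.filter fun D => lab D = c).filter fun D => lab' D = c').card, ?_, ?_⟩
  · intro c
    unfold labelCount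
    refine (Finset.card_eq_sum_card_fiberwise (f := lab') (t := f c) ?_).trans
      (Finset.sum_congr rfl fun c _ => by congr!)
    intro D hD
    simp only [Finset.coe_filter, Set.mem_ofPred_eq] at hD
    rw [← hD.2]
    exact h D hD.1
  · intro c'
    unfold labelCount
    refine (Finset.card_eq_sum_card_fiberwise (f := lab)
      (t := Finset.univ.filter fun c => c' ∈ f c) ?_).trans
      (Finset.sum_congr rfl fun c _ => by rw [Finset.filter_comm]; congr!)
    intro D hD
    simp only [Finset.coe_filter, Set.mem_ofPred_eq, Finset.mem_univ, true_and] at hD ⊢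
    rw [← hD.2]
    exact h D hD.1

/-- The converse, for data that are merely covered by the counters: the matrix `K` offers `K c c'`
slots for moving from `c` to `c'`, and the data labelled `c`, being at most `u c` in number, can be
given distinct slots. The slot determines the new label. -/
theorem CounterInstr.exists_labelling_of_performs_transf {f : C → Finset C} {u u' : C → ℕ}
    (hp : (CounterInstr.transf f).Performs u u') {B : Finset ι} {lab : ι → C}
    (hle : labelCount B lab ≤ u) :
    ∃ lab' : ι → C, (∀ D ∈ B, lab' D ∈ f (lab D)) ∧ labelCount B lab' ≤ u' := by
  classical
  obtain ⟨K, hK, hK'⟩ := hp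
  -- For each old label `c`, `g` assigns to a datum its slot: the target and an index below `K c
  -- (target)`, injectively among the data labelled `c`.
  have key : ∀ c, ∃ g : ι → C × ℕ,
      (∀ D ∈ B, lab D = c → (g D).1 ∈ f c ∧ (g D).2 < K c (g D).1) ∧
      Set.InjOn g (B.filter fun D => lab D = c) := by
    intro c
    have hcard : Fintype.card (B.filter fun D => lab D = c) ≤
        Fintype.card ((f c).sigma fun c' => Finset.range (K c c')) := by
      simp only [Fintype.card_coe, Finset.card_sigma, Finset.card_range]
      refine le_trans (le_of_eq ?_) ((hle c).trans_eq (hK c))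
      unfold labelCount
      congr!
    obtain ⟨g⟩ := Function.Embedding.nonempty_of_card_le hcard
    refine ⟨fun D => if hD : D ∈ B.filter fun D => lab D = c then
      ((g ⟨D, hD⟩).1.1, (g ⟨D, hD⟩).1.2) else (c, 0), ?_, ?_⟩
    · intro D hD hc
      have hm : D ∈ B.filter fun D => lab D = c := by simp [hD, hc]
      have := (g ⟨D, hm⟩).2
      simp only [Finset.mem_sigma, Finset.mem_range] at this
      simp only [dif_pos hm]
      exact this
    · intro D hD E hE hDE
      simp only [Finset.mem_coe] at hD hE
      simp only [dif_pos hD, dif_pos hE, Prod.mk.injEq] at hDE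
      have : g ⟨D, hD⟩ = g ⟨E, hE⟩ := Subtype.ext (Sigma.ext hDE.1 (heq_of_eq hDE.2))
      simpa using g.injective this
  choose g hg hinj using key
  refine ⟨fun D => (g (lab D) D).1, fun D hD => (hg _ D hD rfl).1, fun c' => ?_⟩
  rw [hK' c']
  unfold labelCount
  have hmaps : Set.MapsTo lab (B.filter fun D => (g (lab D) D).1 = c' : Finset ι)
      (Finset.univ.filter fun c => c' ∈ f c : Finset C) := by
    intro D hD
    simp only [Finset.coe_filter, Set.mem_ofPred_eq, Finset.mem_univ, true_and] at hD ⊢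
    rw [← hD.2]
    exact (hg _ D hD.1 rfl).1
  -- The data arriving at `c'` are counted according to their old label `c`; within such a fibre the
  -- indices of the slots are distinct numbers below `K c c'`.
  refine (Eq.trans (by congr!) (Finset.card_eq_sum_card_fiberwise hmaps)).trans_le ?_
  refine Finset.sum_le_sum fun c _ => ?_
  rw [← Finset.card_range (K c c')]
  refine Finset.card_le_card_of_injOn (fun D => (g c D).2) ?_ ?_
  · intro D hD
    simp only [Finset.coe_filter, Finset.mem_filter, Set.mem_ofPred_eq] at hD
    obtain ⟨⟨hB, hc'⟩, rfl⟩ := hD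
    have := (hg _ D hB rfl).2
    rw [hc'] at this
    simpa using this
  · intro D hD E hE hDE
    simp only [Finset.coe_filter, Finset.mem_filter, Set.mem_ofPred_eq] at hD hE
    obtain ⟨⟨hB, hc'⟩, hl⟩ := hD
    obtain ⟨⟨hB2, hc2⟩, hl2⟩ := hE
    refine hinj c (by simp [hB, hl]) (by simp [hB2, hl2]) (Prod.ext ?_ hDE)
    rw [hl] at hc'
    rw [hl2] at hc2
    rw [hc', hc2]

end Labelling

/-- There is no negation. This monotonicity yields the distributivity of transfers, and lets the
successor states chosen for one configuration be enlarged to the whole set of states of a datum. -/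
theorem PosBool.Sat.mono {Q : Type} {P₁ P₁' P₂ P₂' : Set Q} (h : P₁ ⊆ P₂) (h' : P₁' ⊆ P₂')
    {φ : PosBool Q} (hφ : φ.Sat P₁ P₁') : φ.Sat P₂ P₂' := by
  induction φ with
  | state q => exact h hφ
  | down q => exact h' hφ
  | top => trivial
  | bot => exact hφ
  | and φ ψ ihφ ihψ => exact ⟨ihφ hφ.1, ihψ hφ.2⟩
  | or φ ψ ihφ ihψ => exact hφ.imp ihφ ihψ

/-- A dependent choice of states satisfying an invariant. -/
theorem exists_seq_of_forall_exists {α : Type*} (I : ℕ → α → Prop) (R : ℕ → α → α → Prop) {a : α}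
    (ha : I 0 a) (h : ∀ n x, I n x → ∃ y, I (n + 1) y ∧ R n x y) :
    ∃ x : ℕ → α, x 0 = a ∧ ∀ n, I n (x n) ∧ R n (x n) (x (n + 1)) := by
  choose! g hg using h
  let x : ℕ → α := fun n => Nat.rec a (fun n y => g n y) n
  have hx : ∀ n, I n (x n) := by
    intro n
    induction n with
    | zero => exact ha
    | succ n ih => exact (hg n _ ih).1
  exact ⟨x, rfl, fun n => ⟨hx n, (hg n _ (hx n)).2⟩⟩

/-! ### The counter automaton of a register automaton -/

/-- The states of the counter automaton: `before c` and `after e` record the sets of states that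
are paired with the datum of the current position, before and after reading its letter. -/
inductive CounterState (Q : Type) : Type
  | base
  | before (c : Finset Q)
  | after (e : Finset Q)

noncomputable instance {Q : Type} [Fintype Q] : Fintype (CounterState Q) :=
  letI : DecidableEq Q := Classical.decEq Q
  Fintype.ofEquiv (Option (Finset Q ⊕ Finset Q))
    { toFun := fun x => match x with
        | none => .base
        | some (.inl c) => .before c
        | some (.inr e) => .after e
      invFun := fun x => match x with
        | .base => none
        | .before c => some (.inl c)
        | .after e => some (.inr e)
      left_inv := by rintro (_ | _ | _) <;> rfl
      right_inv := by rintro (_ | _ | _) <;> rfl }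

namespace SafetyARA

variable {S : Type} (A : SafetyARA S)

open scoped Classical in
/-- The counters: the sets of states, to each of which a dummy element is added. -/
noncomputable def counters : Finset (Finset (Option A.Q)) :=
  Finset.univ.filter fun c => none ∈ c

/-- Counters correspond to sets of states. -/
noncomputable def counterEquiv : Finset A.Q ≃ A.counters where
  toFun c := ⟨Finset.insertNone c, by simp [counters]⟩
  invFun c := Finset.eraseNone c.1
  left_inv c := by simp
  right_inv c := by
    classical
    obtain ⟨c, hc⟩ := c
    simp only [counters, Finset.mem_filter] at hc
    ext x
    cases x <;> simp [hc.2]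

/-- The sets of states that `d` can turn into at a position with letter `a` and a different
datum, when `e` is available as the set of states for the datum of the position. -/
def Moves (a : S) (e d d' : Finset A.Q) : Prop :=
  ∀ q ∈ d, (A.δ q a false).Sat (d' : Set A.Q) (e : Set A.Q)

/-- The condition for the set of states of the datum of the current position, which has the letter
`a`, to turn from `c` into `e`. -/
def Reads (a : S) (c e : Finset A.Q) : Prop :=
  ∀ q ∈ c, (A.δ q a true).Sat (e : Set A.Q) (e : Set A.Q)

open scoped Classical in
/-- The transfer for the letter `a` and the set `e` of states. -/
noncomputable def transfer (a : S) (e : Finset A.Q) (d : A.counters) : Finset A.counters :=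
  Finset.univ.filter fun d' => A.Moves a e (A.counterEquiv.symm d) (A.counterEquiv.symm d')

theorem mem_transfer {a : S} {e : Finset A.Q} {d d' : A.counters} :
    d' ∈ A.transfer a e d ↔
      A.Moves a e (A.counterEquiv.symm d) (A.counterEquiv.symm d') := by
  simp [transfer]

theorem mem_counterEquiv_symm {c : A.counters} {q : A.Q} :
    q ∈ A.counterEquiv.symm c ↔ some q ∈ c.1 := by
  simp [counterEquiv]

theorem none_mem_counter (c : A.counters) : none ∈ c.1 := by
  have := c.2
  simp only [counters, Finset.mem_filter] at this
  exact this.2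

/-- The union of the given images is a suitable image: each state of `c` lies in some `d i`, where
its formula is satisfied by `d' i`, hence also by the union. -/
theorem isDistributive_transfer (a : S) (e : Finset A.Q) : IsDistributive (A.transfer a e) := by
  classical
  intro c k d d' hcov hd'
  -- The dummy element makes every cover of a counter nonempty, so that the dummy element of the
  -- image is covered as well.
  obtain ⟨i₀, -⟩ := hcov none (A.none_mem_counter c)
  refine ⟨A.counterEquiv (Finset.univ.biUnion fun i => A.counterEquiv.symm (d' i)), ?_, ?_⟩
  · rw [mem_transfer, Equiv.symm_apply_apply]
    intro q hq
    obtain ⟨i, hi⟩ := hcov _ (A.mem_counterEquiv_symm.1 hq)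
    refine (A.mem_transfer.1 (hd' i) q (A.mem_counterEquiv_symm.2 hi)).mono ?_ subset_rfl
    exact Finset.coe_subset.2 (Finset.subset_biUnion_of_mem
      (fun i => A.counterEquiv.symm (d' i)) (Finset.mem_univ i))
  · rintro (_ | q) hx
    · exact ⟨i₀, A.none_mem_counter _⟩
    · rw [← mem_counterEquiv_symm, Equiv.symm_apply_apply] at hx
      simp only [Finset.mem_biUnion, Finset.mem_univ, true_and] at hx
      obtain ⟨i, hi⟩ := hx
      exact ⟨i, A.mem_counterEquiv_symm.1 hi⟩

/-- The transitions of the counter automaton. -/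
inductive CounterTrans :
    CounterState A.Q × Option S × CounterInstr A.counters × CounterState A.Q → Prop
  | inc (e : Finset A.Q) : CounterTrans (.after e, none, .inc (A.counterEquiv e), .base)
  | dec (c : Finset A.Q) : CounterTrans (.base, none, .dec (A.counterEquiv c), .before c)
  | read (a : S) (c e : Finset A.Q) (h : A.Reads a c e) :
      CounterTrans (.before c, some a, .transf (A.transfer a e), .after e)

/-- The counter automaton, whose counter values are the numbers of data other than that of the
current position for each set of states. -/
noncomputable abbrev toIPCANT : SafetyIPCANT S where
  Q := CounterState A.Q
  init := .before {A.init}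
  X := Option A.Q
  decEqX := Classical.decEq _
  C := A.counters
  nonempty_of_mem := fun c hc => ⟨none, A.none_mem_counter ⟨c, hc⟩⟩
  δ := {t | A.CounterTrans t}
  distributive := by
    intro q w f q' h
    cases h
    exact A.isDistributive_transfer _ _
  acyclic := by
    -- The `ε` transitions only go from `after` to `base` and from `base` to `before`.
    let rank : CounterState A.Q → ℕ := fun q => match q with
      | .after _ => 0
      | .base => 1
      | .before _ => 2
    have hr : ∀ p p' : CounterState A.Q,
        (∃ l, A.CounterTrans (p, none, l, p')) → rank p < rank p' := by
      rintro p p' ⟨l, h⟩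
      cases h <;> simp [rank]
    intro q h
    have : ∀ q', Relation.TransGen (fun p p' => ∃ l, A.CounterTrans (p, none, l, p')) q q' →
        rank q < rank q' := by
      intro q' h
      induction h with
      | single h => exact hr _ _ h
      | tail _ h ih => exact ih.trans (hr _ _ h)
    exact lt_irrefl _ (this q h)

end SafetyARA

/-! ### From runs of the register automaton to runs of the counter automaton -/

namespace SafetyARA

variable {S : Type} (A : SafetyARA S)

open scoped Classical in
/-- The set of states that are paired with the datum `D` in `F`. -/
noncomputable def statesAt {σ : DataWord S} (F : Finset (A.Config σ)) (D : σ.Datum) :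
    Finset A.Q :=
  Finset.univ.filter fun q => (q, D) ∈ F

/-- The counter values for the data in `B`, when `lab` assigns sets of states to data. -/
noncomputable def countVal {ι : Type} (B : Finset ι) (lab : ι → Finset A.Q) : A.counters → ℕ :=
  labelCount B fun D => A.counterEquiv (lab D)

/-- For the class of the current position, storing the current class changes nothing: both kinds of
successors end up at `σ.cls i`, so one set interprets both kinds of atoms. -/
theorem statesAt_reads {σ : DataWord S} {i : ℕ} {F F' : Finset (A.Config σ)}
    (h : A.Step σ i F F') :
    A.Reads (σ.str i) (A.statesAt F (σ.cls i)) (A.statesAt F' (σ.cls i)) := by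
  obtain ⟨P, P', hsat, hF'⟩ := h
  intro q hq
  simp only [statesAt, Finset.mem_filter, Finset.mem_univ, true_and] at hq
  refine ((hsat q _ hq).1 rfl).mono ?_ ?_
  · intro q' hq'
    simp only [statesAt, Finset.coe_filter, Finset.mem_univ, true_and, Set.mem_ofPred_eq]
    rw [← Finset.mem_coe, hF']
    exact Or.inl ⟨q, _, hq, q', hq', rfl⟩
  · intro q' hq'
    simp only [statesAt, Finset.coe_filter, Finset.mem_univ, true_and, Set.mem_ofPred_eq]
    rw [← Finset.mem_coe, hF']
    exact Or.inr ⟨q, _, hq, q', hq', rfl⟩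

/-- At a different class, ordinary successors stay at `D`, whereas `↓`-successors move to the
current class. -/
theorem statesAt_moves {σ : DataWord S} {i : ℕ} {F F' : Finset (A.Config σ)}
    (h : A.Step σ i F F') {D : σ.Datum} (hD : D ≠ σ.cls i) :
    A.Moves (σ.str i) (A.statesAt F' (σ.cls i)) (A.statesAt F D) (A.statesAt F' D) := by
  obtain ⟨P, P', hsat, hF'⟩ := h
  intro q hq
  simp only [statesAt, Finset.mem_filter, Finset.mem_univ, true_and] at hq
  refine ((hsat q _ hq).2 hD).mono ?_ ?_
  · intro q' hq'
    simp only [statesAt, Finset.coe_filter, Finset.mem_univ, true_and, Set.mem_ofPred_eq]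
    rw [← Finset.mem_coe, hF']
    exact Or.inl ⟨q, _, hq, q', hq', rfl⟩
  · intro q' hq'
    simp only [statesAt, Finset.coe_filter, Finset.mem_univ, true_and, Set.mem_ofPred_eq]
    rw [← Finset.mem_coe, hF']
    exact Or.inr ⟨q, _, hq, q', hq', rfl⟩

/-- Errors can only raise values, so an erroneous step amounts to lower bounds on the new valuation.
-/
theorem step_inc_iff {e : Finset A.Q} {v v' : A.counters → ℕ} :
    A.toIPCANT.Step none (.inc (A.counterEquiv e)) (.after e, v) (.base, v') ↔
      v (A.counterEquiv e) + 1 ≤ v' (A.counterEquiv e) ∧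
        ∀ c, c ≠ A.counterEquiv e → v c ≤ v' c := by
  constructor
  · rintro ⟨u, u', hu, ⟨-, hp⟩, hu'⟩
    rw [CounterInstr.performs_inc_iff] at hp
    refine ⟨?_, fun c hc => (hu c).trans ((hp.2 c hc).symm.le.trans (hu' c))⟩
    exact (Nat.succ_le_succ (hu _)).trans (hp.1.symm.le.trans (hu' _))
  · classical
    intro h
    refine ⟨v, Function.update v (A.counterEquiv e) (v (A.counterEquiv e) + 1), le_rfl,
      ⟨.inc e, ?_⟩, fun c => ?_⟩
    · rw [CounterInstr.performs_inc_iff]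
      exact ⟨Function.update_self .., fun c hc => Function.update_of_ne hc ..⟩
    · by_cases hc : c = A.counterEquiv e
      · subst hc
        exact (Function.update_self ..).le.trans h.1
      · exact (Function.update_of_ne hc ..).le.trans (h.2 c hc)

/-- The positivity test disappears, since an error before the decrement can supply the missing unit.
In particular `dec` is possible at value 0. -/
theorem step_dec_iff {d : Finset A.Q} {v v' : A.counters → ℕ} :
    A.toIPCANT.Step none (.dec (A.counterEquiv d)) (.base, v) (.before d, v') ↔
      v (A.counterEquiv d) ≤ v' (A.counterEquiv d) + 1 ∧
        ∀ c, c ≠ A.counterEquiv d → v c ≤ v' c := by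
  constructor
  · rintro ⟨u, u', hu, ⟨-, hp⟩, hu'⟩
    rw [CounterInstr.performs_dec_iff] at hp
    refine ⟨?_, fun c hc => (hu c).trans ((hp.2 c hc).symm.le.trans (hu' c))⟩
    exact (hu _).trans (hp.1.le.trans (Nat.succ_le_succ (hu' _)))
  · classical
    intro h
    -- All errors are made before the decrement: the intermediate valuation is the one from which
    -- the decrement leads exactly to `v'`.
    refine ⟨Function.update v' (A.counterEquiv d) (v' (A.counterEquiv d) + 1), v', fun c => ?_,
      ⟨.dec d, ?_⟩, le_rfl⟩
    · by_cases hc : c = A.counterEquiv d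
      · subst hc
        simpa only [Function.update_self] using h.1
      · simpa only [Function.update_of_ne hc] using h.2 c hc
    · rw [CounterInstr.performs_dec_iff]
      exact ⟨Function.update_self .., fun c hc => (Function.update_of_ne hc ..).symm⟩

theorem step_read_of_moves {ι : Type} {a : S} {c e : Finset A.Q} {B : Finset ι}
    {lab lab' : ι → Finset A.Q} (h : A.Reads a c e)
    (h' : ∀ D ∈ B, A.Moves a e (lab D) (lab' D)) :
    A.toIPCANT.Step (some a) (.transf (A.transfer a e)) (.before c, A.countVal B lab)
      (.after e, A.countVal B lab') := by
  refine ⟨_, _, le_rfl, ⟨.read a c e h, ?_⟩, le_rfl⟩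
  refine CounterInstr.performs_transf_of_labelling fun D hD => ?_
  rw [mem_transfer, Equiv.symm_apply_apply, Equiv.symm_apply_apply]
  exact h' D hD

theorem exists_moves_of_step_read {ι : Type} {a : S} {c e : Finset A.Q} {v v' : A.counters → ℕ}
    (hs : A.toIPCANT.Step (some a) (.transf (A.transfer a e)) (.before c, v) (.after e, v'))
    {B : Finset ι} {lab : ι → Finset A.Q} (hle : A.countVal B lab ≤ v) :
    ∃ lab' : ι → Finset A.Q, (∀ D ∈ B, A.Moves a e (lab D) (lab' D)) ∧
      A.countVal B lab' ≤ v' := by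
  obtain ⟨u, u', hu, ⟨-, hp⟩, hu'⟩ := hs
  obtain ⟨lab', h, h'⟩ := CounterInstr.exists_labelling_of_performs_transf hp
    (B := B) (lab := fun D => A.counterEquiv (lab D)) (hle.trans hu)
  refine ⟨fun D => A.counterEquiv.symm (lab' D), fun D hD => ?_, ?_⟩
  · have := (A.mem_transfer).1 (h D hD)
    rwa [Equiv.symm_apply_apply] at this
  · refine le_trans (le_of_eq (labelCount_congr fun D _ => ?_)) (h'.trans hu')
    exact A.counterEquiv.apply_symm_apply (lab' D)

/-- The counters record the classes met so far, except the current one, by their sets of states in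
the given run. Transfers and decrements are then exact, and only increments need errors. -/
theorem toIPCANT_accepts {σ : DataWord S} (h : A.Accepts σ) : A.toIPCANT.Accepts σ.str := by
  classical
  obtain ⟨F, hF0, hF⟩ := h
  -- The classes of the positions up to `i` inclusive.
  let B : ℕ → Finset σ.Datum := fun i => (Finset.range (i + 1)).image σ.cls
  have hB : ∀ i, σ.cls i ∈ B i := fun i => Finset.mem_image_of_mem _ (by simp)
  have hBB : ∀ i, B i ⊆ B (i + 1) := fun i =>
    Finset.image_subset_image (by intro x; simp; omega)
  let lab : (i : ℕ) → σ.Datum → Finset A.Q := fun i => A.statesAt (F i)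
  -- Position `i` occupies the steps `3 * i`, `3 * i + 1` and `3 * i + 2`. At the `base` state the
  -- count already extends over `B (i + 1)`, so that the class of the next position can be taken out
  -- even if it is new.
  let x : ℕ → CounterState A.Q × (A.counters → ℕ) := fun j =>
    let i := j / 3
    if j % 3 = 0 then (.before (lab i (σ.cls i)), A.countVal ((B i).erase (σ.cls i)) (lab i))
    else if j % 3 = 1 then
      (.after (lab (i + 1) (σ.cls i)), A.countVal ((B i).erase (σ.cls i)) (lab (i + 1)))
    else (.base, A.countVal (B (i + 1)) (lab (i + 1)))
  have x0 : ∀ i, x (3 * i) =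
      (.before (lab i (σ.cls i)), A.countVal ((B i).erase (σ.cls i)) (lab i)) := by
    intro i
    have h1 : (3 * i) / 3 = i := by omega
    have h2 : (3 * i) % 3 = 0 := by omega
    simp only [x, h1, h2, if_true]
  have x1 : ∀ i, x (3 * i + 1) =
      (.after (lab (i + 1) (σ.cls i)),
        A.countVal ((B i).erase (σ.cls i)) (lab (i + 1))) := by
    intro i
    have h1 : (3 * i + 1) / 3 = i := by omega
    have h2 : (3 * i + 1) % 3 = 1 := by omega
    simp only [x, h1, h2, if_true, one_ne_zero, if_false]
  have x2 : ∀ i, x (3 * i + 2) = (.base, A.countVal (B (i + 1)) (lab (i + 1))) := by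
    intro i
    have h1 : (3 * i + 2) / 3 = i := by omega
    have h2 : (3 * i + 2) % 3 = 2 := by omega
    simp only [x, h1, h2]
    simp
  let L : ℕ → Option S := fun j => if j % 3 = 0 then some (σ.str (j / 3)) else none
  let I : ℕ → CounterInstr A.counters := fun j =>
    let i := j / 3
    if j % 3 = 0 then .transf (A.transfer (σ.str i) (lab (i + 1) (σ.cls i)))
    else if j % 3 = 1 then .inc (A.counterEquiv (lab (i + 1) (σ.cls i)))
    else .dec (A.counterEquiv (lab (i + 1) (σ.cls (i + 1))))
  refine ⟨x, L, I, ?_, ?_, fun n => 3 * n, ?_, ?_, ?_⟩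
  · rw [show (0 : ℕ) = 3 * 0 from rfl, x0]
    have h1 : lab 0 (σ.cls 0) = {A.init} := by
      ext q
      simp [lab, statesAt, hF0]
    have h2 : (B 0).erase (σ.cls 0) = ∅ := by
      ext D
      simp +contextual [B]
    rw [h1, h2]
    refine Prod.ext rfl ?_
    funext c
    simp [countVal, labelCount]
  · intro j
    obtain ⟨i, hi⟩ : ∃ i, i = j / 3 := ⟨_, rfl⟩
    have hj : j = 3 * i ∨ j = 3 * i + 1 ∨ j = 3 * i + 2 := by omega
    rcases hj with rfl | rfl | rfl
    · have hL : L (3 * i) = some (σ.str i) := by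
        simp [L]
      have hI : I (3 * i) = .transf (A.transfer (σ.str i) (lab (i + 1) (σ.cls i))) := by
        simp [I]
      rw [hL, hI, x0, x1]
      exact A.step_read_of_moves (A.statesAt_reads (hF i)) fun D hD =>
        A.statesAt_moves (hF i) (Finset.mem_erase.1 hD).1
    · have h1 : (3 * i + 1) / 3 = i := by omega
      have h2 : (3 * i + 1) % 3 = 1 := by omega
      have hL : L (3 * i + 1) = none := by simp [L, h2]
      have hI : I (3 * i + 1) = .inc (A.counterEquiv (lab (i + 1) (σ.cls i))) := by
        simp [I, h2, h1]
      rw [hL, hI, x1, x2]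
      have hD : σ.cls i ∉ (B i).erase (σ.cls i) := by simp
      refine A.step_inc_iff.2 ⟨?_, fun c hc => ?_⟩
      -- Putting back the current class completes `B i`; the inclusion `B i ⊆ B (i + 1)` is where
      -- the error comes in.
      · refine le_trans (le_of_eq ?_) (labelCount_mono (hBB i) _ _)
        conv_rhs => rw [← Finset.insert_erase (hB i)]
        exact (labelCount_insert_self hD _).symm
      · refine le_trans (le_of_eq ?_) (labelCount_mono (hBB i) _ _)
        conv_rhs => rw [← Finset.insert_erase (hB i)]
        exact (labelCount_insert_of_ne (fun D => A.counterEquiv (lab (i + 1) D)) hc).symm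
    · have h1 : (3 * i + 2) / 3 = i := by omega
      have h2 : (3 * i + 2) % 3 = 2 := by omega
      have hL : L (3 * i + 2) = none := by simp [L, h2]
      have hI : I (3 * i + 2) = .dec (A.counterEquiv (lab (i + 1) (σ.cls (i + 1)))) := by
        simp [I, h2, h1]
      rw [hL, hI, x2, show 3 * i + 2 + 1 = 3 * (i + 1) by ring, x0]
      have hD : σ.cls (i + 1) ∉ (B (i + 1)).erase (σ.cls (i + 1)) := by simp
      refine A.step_dec_iff.2 ⟨le_of_eq ?_, fun c hc => le_of_eq ?_⟩
      · conv_lhs => rw [← Finset.insert_erase (hB (i + 1))]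
        exact labelCount_insert_self hD _
      · conv_lhs => rw [← Finset.insert_erase (hB (i + 1))]
        exact labelCount_insert_of_ne (fun D => A.counterEquiv (lab (i + 1) D)) hc
  · exact fun m n h => by simpa using h
  · intro n
    simp [L]
  · intro j hj
    simp only [L]
    rw [if_neg]
    intro h
    exact hj ⟨j / 3, by simp only; omega⟩

end SafetyARA

/-! ### From runs of the counter automaton to runs of the register automaton -/

namespace SafetyARA

variable {S : Type} (A : SafetyARA S)

theorem step_before_inv {c : Finset A.Q} {v : A.counters → ℕ} {w : Option S}
    {l : CounterInstr A.counters} {y : CounterState A.Q × (A.counters → ℕ)}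
    (h : A.toIPCANT.Step w l (.before c, v) y) :
    ∃ a e v', w = some a ∧ y = (.after e, v') ∧ A.Reads a c e ∧
      A.toIPCANT.Step (some a) (.transf (A.transfer a e)) (.before c, v) (.after e, v') := by
  obtain ⟨y, v'⟩ := y
  have hδ : A.CounterTrans _ := h.choose_spec.choose_spec.2.1.1
  cases hδ with
  | read a _ e hr => exact ⟨a, e, v', rfl, rfl, hr, h⟩

theorem step_after_inv {e : Finset A.Q} {v : A.counters → ℕ} {w : Option S}
    {l : CounterInstr A.counters} {y : CounterState A.Q × (A.counters → ℕ)}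
    (h : A.toIPCANT.Step w l (.after e, v) y) :
    ∃ v', w = none ∧ y = (.base, v') ∧
      A.toIPCANT.Step none (.inc (A.counterEquiv e)) (.after e, v) (.base, v') := by
  obtain ⟨y, v'⟩ := y
  have hδ : A.CounterTrans _ := h.choose_spec.choose_spec.2.1.1
  cases hδ with
  | inc _ => exact ⟨v', rfl, rfl, h⟩

theorem step_base_inv {v : A.counters → ℕ} {w : Option S}
    {l : CounterInstr A.counters} {y : CounterState A.Q × (A.counters → ℕ)}
    (h : A.toIPCANT.Step w l (.base, v) y) :
    ∃ c v', w = none ∧ y = (.before c, v') ∧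
      A.toIPCANT.Step none (.dec (A.counterEquiv c)) (.base, v) (.before c, v') := by
  obtain ⟨y, v'⟩ := y
  have hδ : A.CounterTrans _ := h.choose_spec.choose_spec.2.1.1
  cases hδ with
  | dec c => exact ⟨c, v', rfl, rfl, h⟩

/-- Bookkeeping for the data of a data word under construction: the current datum, the other data
in use, and the sets of states of data. -/
structure Tracking where
  data : Finset ℕ
  lab : ℕ → Finset A.Q
  cur : ℕ

/-- The effect of a position with letter `a`, whose datum gets the set `e` of states. -/
structure Tracking.Next (a : S) (e : Finset A.Q) (s s' : A.Tracking) : Prop where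
  moves : ∀ D ∈ s.data, A.Moves a e (s.lab D) (s'.lab D)
  lab_cur : s'.lab s.cur = e
  subset : insert s.cur s.data ⊆ insert s'.cur s'.data

/-- The tracked data are covered by counter values. -/
structure Tracking.Covered (c : Finset A.Q) (v : A.counters → ℕ) (s : A.Tracking) : Prop where
  count_le : A.countVal s.data s.lab ≤ v
  cur_notMem : s.cur ∉ s.data
  lab_cur : s.lab s.cur = c

/-- One round keeps the tracked data covered. The transfer relabels the other data, the increment
makes room for the current datum with label `e`, and the decrement either removes a tracked datum
with label `c'` or, if there is none, is matched by inventing one. -/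
theorem Tracking.Covered.exists_next {c c' e : Finset A.Q} {v v₁ v₂ v' : A.counters → ℕ} {a : S}
    {s : A.Tracking} (hs : s.Covered A c v)
    (h₁ : A.toIPCANT.Step (some a) (.transf (A.transfer a e)) (.before c, v) (.after e, v₁))
    (h₂ : A.toIPCANT.Step none (.inc (A.counterEquiv e)) (.after e, v₁) (.base, v₂))
    (h₃ : A.toIPCANT.Step none (.dec (A.counterEquiv c')) (.base, v₂) (.before c', v')) :
    ∃ s' : A.Tracking, s'.Covered A c' v' ∧ Tracking.Next A a e s s' := by
  classical
  obtain ⟨B, lab, cur⟩ := s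
  obtain ⟨hB, hcur, hlab⟩ := hs
  dsimp only at hB hcur hlab
  obtain ⟨lab₁, hmv, hle₁⟩ := A.exists_moves_of_step_read h₁ hB
  rw [step_inc_iff] at h₂
  rw [step_dec_iff] at h₃
  let lab₂ := Function.update lab₁ cur e
  have hcur₂ : lab₂ cur = e := Function.update_self ..
  have heq : ∀ D ∈ B, lab₂ D = lab₁ D := fun D hD =>
    Function.update_of_ne (by rintro rfl; exact hcur hD) ..
  have hcount : A.countVal B lab₂ = A.countVal B lab₁ :=
    labelCount_congr fun D hD => by rw [heq D hD]
  have hle₂ : A.countVal (insert cur B) lab₂ ≤ v₂ := by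
    intro x
    by_cases hx : x = A.counterEquiv e
    · subst hx
      refine le_trans ?_ h₂.1
      have := labelCount_insert_self hcur fun D => A.counterEquiv (lab₂ D)
      simp only [hcur₂] at this
      refine this.le.trans (Nat.succ_le_succ ?_)
      exact (congrFun hcount _).le.trans (hle₁ _)
    · refine le_trans ?_ (h₂.2 x hx)
      refine (labelCount_insert_of_ne (fun D => A.counterEquiv (lab₂ D)) ?_).le.trans ?_
      · simpa only [hcur₂] using hx
      · exact (congrFun hcount _).le.trans (hle₁ _)
  -- If a tracked datum has label `c'`, it becomes current, and its removal compensates the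
  -- decrement. The datum just put back is among the candidates.
  by_cases hD : ∃ D ∈ insert cur B, lab₂ D = c'
  · obtain ⟨D, hD, hDc⟩ := hD
    refine ⟨⟨(insert cur B).erase D, lab₂, D⟩, ⟨?_, by simp, hDc⟩, ⟨?_, hcur₂, ?_⟩⟩
    · intro x
      by_cases hx : x = A.counterEquiv c'
      · subst hx
        have := labelCount_insert_self (Finset.notMem_erase D (insert cur B))
          fun D => A.counterEquiv (lab₂ D)
        rw [Finset.insert_erase hD, hDc] at this
        have h4 := (hle₂ (A.counterEquiv c')).trans h₃.1
        exact Nat.le_of_succ_le_succ (this.symm.le.trans h4)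
      · refine le_trans ?_ ((hle₂ x).trans (h₃.2 x hx))
        exact labelCount_mono (Finset.erase_subset _ _) _ x
    · intro E hE
      dsimp only
      rw [heq E hE]
      exact hmv E hE
    · simp only [Finset.insert_erase hD]
      exact subset_rfl
  · push Not at hD
    -- Otherwise a fresh number becomes the current datum. No tracked datum has label `c'`, so the
    -- decremented counter has nothing to cover.
    obtain ⟨D, hfresh⟩ := Infinite.exists_notMem_finset (insert cur B)
    have hne : ∀ E ∈ insert cur B, Function.update lab₂ D c' E = lab₂ E := fun E hE =>
      Function.update_of_ne (by rintro rfl; exact hfresh hE) ..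
    refine ⟨⟨insert cur B, Function.update lab₂ D c', D⟩,
      ⟨?_, hfresh, Function.update_self ..⟩, ⟨?_, ?_, Finset.subset_insert _ _⟩⟩
    · intro x
      have h5 : A.countVal (insert cur B) (Function.update lab₂ D c') =
          A.countVal (insert cur B) lab₂ := labelCount_congr fun E hE => by rw [hne E hE]
      refine (congrFun h5 x).le.trans ?_
      by_cases hx : x = A.counterEquiv c'
      · subst hx
        have : A.countVal (insert cur B) lab₂ (A.counterEquiv c') = 0 :=
          labelCount_eq_zero fun E hE h => hD E hE (A.counterEquiv.injective h)
        simp only [this, zero_le]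
      · exact (hle₂ x).trans (h₃.2 x hx)
    · intro E hE
      dsimp only
      rw [hne E (Finset.mem_insert_of_mem hE), heq E hE]
      exact hmv E hE
    · exact (hne cur (Finset.mem_insert_self _ _)).trans hcur₂

/-- A sequence of trackings yields a run on a data word. -/
theorem accepts_of_tracking {w : ℕ → S} {c e : ℕ → Finset A.Q} {s : ℕ → A.Tracking}
    (hinit : c 0 = {A.init}) (hr : ∀ i, A.Reads (w i) (c i) (e i))
    (hcur : ∀ i, (s i).lab (s i).cur = c i)
    (hn : ∀ i, Tracking.Next A (w i) (e i) (s i) (s (i + 1))) :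
    ∃ σ : DataWord S, A.Accepts σ ∧ σ.str = w := by
  classical
  -- Two positions are equivalent iff the same tracked datum is current at both.
  let σ : DataWord S := ⟨w, Setoid.ker fun i => (s i).cur⟩
  let name : σ.Datum → ℕ := Quotient.lift (fun i => (s i).cur) fun _ _ h => h
  have hname : ∀ i, name (σ.cls i) = (s i).cur := fun i => rfl
  have hinj : ∀ D i, name D = (s i).cur → D = σ.cls i := by
    intro D i
    induction D using Quotient.ind with
    | _ j => exact fun h => Quotient.sound h
  -- Every configuration takes the whole new label of its datum as stored successors and all of `e
  -- i` as `↓`-successors, regardless of its state.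
  let next : ℕ → Finset (A.Config σ) → Finset (A.Config σ) := fun i F =>
    F.biUnion fun x => ((s (i + 1)).lab (name x.2)).image (fun q => (q, x.2)) ∪
      (e i).image (fun q => (q, σ.cls i))
  let F : ℕ → Finset (A.Config σ) := fun i => Nat.rec {(A.init, σ.cls 0)} next i
  have hF : ∀ i, F (i + 1) = next i (F i) := fun i => rfl
  -- Labels are only upper bounds for the sets of states of the run: a datum introduced later than
  -- position 0 has no states at first, whatever its label.
  have inv : ∀ i q D, (q, D) ∈ F i →
      name D ∈ insert (s i).cur (s i).data ∧ q ∈ (s i).lab (name D) := by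
    intro i
    induction i with
    | zero =>
      intro q D h
      have h' := Prod.mk.inj (Finset.mem_singleton.1 h)
      obtain ⟨rfl, rfl⟩ := h'
      rw [hname, hcur, hinit]
      simp
    | succ i ih =>
      intro q D h
      simp only [hF, next, Finset.mem_biUnion, Finset.mem_union, Finset.mem_image,
        Prod.mk.injEq] at h
      obtain ⟨⟨q₀, D₀⟩, h₀, ⟨q', hq', rfl, rfl⟩ | ⟨q', hq', rfl, rfl⟩⟩ := h
      · exact ⟨(hn i).subset (ih _ _ h₀).1, hq'⟩
      · rw [hname]
        refine ⟨(hn i).subset (Finset.mem_insert_self _ _), ?_⟩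
        rw [(hn i).lab_cur]
        exact hq'
  refine ⟨σ, ⟨F, rfl, fun i => ⟨fun x => (s (i + 1)).lab (name x.2), fun _ => e i, ?_, ?_⟩⟩, rfl⟩
  · intro q D h
    obtain ⟨h1, h2⟩ := inv i q D h
    constructor
    · rintro rfl
      rw [hname, hcur] at h2
      simp only [hname, (hn i).lab_cur]
      exact hr i q h2
    · intro hD
      rw [Finset.mem_insert] at h1
      exact (hn i).moves _ (h1.resolve_left fun h => hD (hinj D i h)) q h2
  · ext ⟨q, D⟩
    simp only [hF, next, Finset.coe_biUnion, Set.mem_iUnion, Finset.mem_coe, Finset.mem_union,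
      Finset.mem_image, Set.mem_union, Set.mem_ofPred_eq, Prod.exists, exists_prop]
    constructor
    · rintro ⟨q₀, D₀, h, ⟨q', hq', hx⟩ | ⟨q', hq', hx⟩⟩
      · exact Or.inl ⟨q₀, D₀, h, q', hq', hx.symm⟩
      · exact Or.inr ⟨q₀, D₀, h, q', hq', hx.symm⟩
    · rintro (⟨q₀, D₀, h, q', hq', hx⟩ | ⟨q₀, D₀, h, q', hq', hx⟩)
      · exact ⟨q₀, D₀, h, Or.inl ⟨q', hq', hx.symm⟩⟩
      · exact ⟨q₀, D₀, h, Or.inr ⟨q', hq', hx.symm⟩⟩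

/-- The control states force every run into rounds of three steps; the trackings along these rounds
are then obtained by dependent choice. -/
theorem accepts_of_toIPCANT_accepts {w : ℕ → S} (h : A.toIPCANT.Accepts w) :
    ∃ σ : DataWord S, A.Accepts σ ∧ σ.str = w := by
  obtain ⟨x, lab, l, h0, hs, φ, hφ, hlab, hlab'⟩ := h
  have hround : ∀ i c v, x (3 * i) = (.before c, v) → ∃ a e v₁ v₂ c' v',
      lab (3 * i) = some a ∧ lab (3 * i + 1) = none ∧ lab (3 * i + 2) = none ∧
      A.Reads a c e ∧
      A.toIPCANT.Step (some a) (.transf (A.transfer a e)) (.before c, v) (.after e, v₁) ∧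
      A.toIPCANT.Step none (.inc (A.counterEquiv e)) (.after e, v₁) (.base, v₂) ∧
      A.toIPCANT.Step none (.dec (A.counterEquiv c')) (.base, v₂) (.before c', v') ∧
      x (3 * (i + 1)) = (.before c', v') := by
    intro i c v hx
    have s0 := hs (3 * i)
    rw [hx] at s0
    obtain ⟨a, e, v₁, hl0, hx1, hr, s0'⟩ := A.step_before_inv s0
    have s1 := hs (3 * i + 1)
    rw [hx1] at s1
    obtain ⟨v₂, hl1, hx2, s1'⟩ := A.step_after_inv s1
    have s2 := hs (3 * i + 2)
    rw [hx2] at s2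
    obtain ⟨c', v', hl2, hx3, s2'⟩ := A.step_base_inv s2
    exact ⟨a, e, v₁, v₂, c', v', hl0, hl1, hl2, hr, s0', s1', s2', hx3⟩
  have hbefore : ∀ i, ∃ c v, x (3 * i) = (.before c, v) := by
    intro i
    induction i with
    | zero => exact ⟨_, _, h0⟩
    | succ i ih =>
      obtain ⟨c, v, hx⟩ := ih
      obtain ⟨_, _, _, _, c', v', _, _, _, _, _, _, _, hx'⟩ := hround i c v hx
      exact ⟨c', v', hx'⟩
  choose c v hx using hbefore
  choose a e v₁ v₂ c' v' hl0 hl1 hl2 hr s0 s1 s2 hx' using fun i => hround i (c i) (v i) (hx i)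
  -- The letters sit exactly at the multiples of 3, and a strictly increasing sequence is determined
  -- by its range.
  have hφ3 : φ = fun n => 3 * n := by
    rw [← hφ.range_inj (fun m n h => by simpa using h)]
    ext j
    constructor
    · rintro ⟨n, rfl⟩
      have hj := hlab n
      obtain ⟨i, hi⟩ : ∃ i, i = φ n / 3 := ⟨_, rfl⟩
      have : φ n = 3 * i ∨ φ n = 3 * i + 1 ∨ φ n = 3 * i + 2 := by omega
      rcases this with h | h | h
      · exact ⟨i, h.symm⟩
      · rw [h, hl1] at hj
        cases hj
      · rw [h, hl2] at hj
        cases hj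
    · rintro ⟨i, rfl⟩
      by_contra hj
      have := hlab' _ hj
      simp only [hl0] at this
      cases this
  have ha : a = w := by
    funext i
    have := hlab i
    rw [hφ3, hl0] at this
    exact Option.some.inj this
  have hc' : ∀ i, c' i = c (i + 1) ∧ v' i = v (i + 1) := by
    intro i
    have := (hx' i).symm.trans (hx (i + 1))
    simp only [Prod.mk.injEq, CounterState.before.injEq] at this
    exact this
  have hc0 : c 0 = {A.init} := by
    have := (hx 0).symm.trans h0
    simp only [Prod.mk.injEq, CounterState.before.injEq] at this
    exact this.1
  obtain ⟨s, -, hI⟩ := exists_seq_of_forall_exists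
    (fun i (s : A.Tracking) => s.Covered A (c i) (v i))
    -- Initially the datum 0 is current and no other is tracked; the labels of untracked numbers are
    -- irrelevant.
    (fun i s s' => Tracking.Next A (a i) (e i) s s') (a := ⟨∅, fun _ => {A.init}, 0⟩)
    ⟨fun x => by simp [countVal, labelCount], by simp, hc0.symm⟩
    (fun i s hs => by
      obtain ⟨s', h1, h2⟩ := hs.exists_next A (s0 i) (s1 i) (s2 i)
      rw [(hc' i).1, (hc' i).2] at h1
      exact ⟨s', h1, h2⟩)
  subst ha
  exact A.accepts_of_tracking hc0 hr (fun i => (hI i).1.lab_cur) fun i => (hI i).2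

theorem toIPCANT_language : A.toIPCANT.language = DataWord.str '' A.language := by
  ext w
  constructor
  · intro h
    obtain ⟨σ, hσ, rfl⟩ := A.accepts_of_toIPCANT_accepts h
    exact ⟨σ, hσ, rfl⟩
  · rintro ⟨σ, hσ, rfl⟩
    exact A.toIPCANT_accepts hσ

end SafetyARA

/-! ### Structured programs for machines with stacks -/

/-- Structured programs over stacks `Γ` and an internal state in `σ`. -/
inductive Prog {K : Type} (Γ : K → Type) (σ : Type) : Type
  | load (f : σ → σ)
  | push (k : K) (f : σ → Γ k)
  /-- Pop from stack `k`, and run `p` if that succeeds and `q` if the stack is empty. -/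
  | pop (k : K) (f : σ → Γ k → σ) (p q : Prog Γ σ)
  /-- Pop from stack `k` and run `p`, as long as the stack is not empty. -/
  | drain (k : K) (f : σ → Γ k → σ) (p : Prog Γ σ)
  | loop (c : σ → Bool) (p : Prog Γ σ)
  | branch (c : σ → Bool) (p q : Prog Γ σ)
  | seq (p q : Prog Γ σ)

namespace Prog

variable {K : Type} {Γ : K → Type} {σ : Type}

/-- Big-step semantics. -/
inductive Exec [DecidableEq K] :
    Prog Γ σ → σ → (∀ k, List (Γ k)) → σ → (∀ k, List (Γ k)) → Prop
  | load (f v S) : Exec (.load f) v S (f v) S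
  | push (k f v S) : Exec (.push k f) v S v (Function.update S k (f v :: S k))
  | pop_cons {k f p q v S x l v' S'} : S k = x :: l →
      Exec p (f v x) (Function.update S k l) v' S' → Exec (.pop k f p q) v S v' S'
  | pop_nil {k f p q v S v' S'} : S k = [] →
      Exec q v S v' S' → Exec (.pop k f p q) v S v' S'
  | drain_cons {k f p v S x l v₁ S₁ v' S'} : S k = x :: l →
      Exec p (f v x) (Function.update S k l) v₁ S₁ → Exec (.drain k f p) v₁ S₁ v' S' →
      Exec (.drain k f p) v S v' S'
  | drain_nil {k f p v S} : S k = [] → Exec (.drain k f p) v S v S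
  | loop_true {c p v S v₁ S₁ v' S'} : c v = true → Exec p v S v₁ S₁ →
      Exec (.loop c p) v₁ S₁ v' S' → Exec (.loop c p) v S v' S'
  | loop_false {c p v S} : c v = false → Exec (.loop c p) v S v S
  | branch_true {c p q v S v' S'} : c v = true → Exec p v S v' S' →
      Exec (.branch c p q) v S v' S'
  | branch_false {c p q v S v' S'} : c v = false → Exec q v S v' S' →
      Exec (.branch c p q) v S v' S'
  | seq {p q v S v₁ S₁ v₂ S₂} : Exec p v S v₁ S₁ → Exec q v₁ S₁ v₂ S₂ →
      Exec (.seq p q) v S v₂ S₂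

/-- The labels of the compiled program. -/
def Lab : Prog Γ σ → Type
  | load _ => Unit
  | push _ _ => Unit
  | pop _ _ p q => Option (Lab p ⊕ Lab q)
  | drain _ _ p => Option (Lab p)
  | loop _ p => Option (Lab p)
  | branch _ p q => Option (Lab p ⊕ Lab q)
  | seq p q => Lab p ⊕ Lab q

instance finite_lab : ∀ p : Prog Γ σ, Finite p.Lab
  | load _ => inferInstanceAs (Finite Unit)
  | push _ _ => inferInstanceAs (Finite Unit)
  | pop _ _ p q =>
    haveI := finite_lab p
    haveI := finite_lab q
    inferInstanceAs (Finite (Option (Lab p ⊕ Lab q)))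
  | drain _ _ p =>
    haveI := finite_lab p
    inferInstanceAs (Finite (Option (Lab p)))
  | loop _ p =>
    haveI := finite_lab p
    inferInstanceAs (Finite (Option (Lab p)))
  | branch _ p q =>
    haveI := finite_lab p
    haveI := finite_lab q
    inferInstanceAs (Finite (Option (Lab p ⊕ Lab q)))
  | seq p q =>
    haveI := finite_lab p
    haveI := finite_lab q
    inferInstanceAs (Finite (Lab p ⊕ Lab q))

/-- The label at which the compiled program starts. -/
def entry : (p : Prog Γ σ) → p.Lab
  | load _ => ()
  | push _ _ => ()
  | pop _ _ _ _ => none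
  | drain _ _ _ => none
  | loop _ _ => none
  | branch _ _ _ => none
  | seq p _ => Sum.inl p.entry

/-- Statements of machines for programs; the machines record whether the last pop succeeded. -/
abbrev Code (Γ : K → Type) (σ Λ : Type) : Type := Turing.TM2.Stmt Γ Λ (Bool × σ)

/-- The update of the machine state by a pop. -/
def onPop {α : Type} (f : σ → α → σ) (v : Bool × σ) : Option α → Bool × σ
  | none => (false, v.2)
  | some x => (true, f v.2 x)

/-- The compiled program, when labels are embedded by `emb` and `ex` is performed at the end. -/
def code {Λ : Type} : (p : Prog Γ σ) → (p.Lab → Λ) → Code Γ σ Λ → p.Lab → Code Γ σ Λ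
  | load f, _, ex, _ => .load (fun v => (v.1, f v.2)) ex
  | push k f, _, ex, _ => .push k (fun v => f v.2) ex
  | pop _ _ p _, emb, ex, some (.inl l) => p.code (fun l => emb (some (.inl l))) ex l
  | pop _ _ _ q, emb, ex, some (.inr l) => q.code (fun l => emb (some (.inr l))) ex l
  | pop k f p q, emb, _, none => .pop k (onPop f) <| .branch (fun v => v.1)
      (.goto fun _ => emb (some (.inl p.entry))) (.goto fun _ => emb (some (.inr q.entry)))
  | drain _ _ p, emb, _, some l =>
      p.code (fun l => emb (some l)) (.goto fun _ => emb none) l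
  | drain k f p, emb, ex, none => .pop k (onPop f) <| .branch (fun v => v.1)
      (.goto fun _ => emb (some p.entry)) ex
  | loop _ p, emb, _, some l =>
      p.code (fun l => emb (some l)) (.goto fun _ => emb none) l
  | loop c p, emb, ex, none => .branch (fun v => c v.2) (.goto fun _ => emb (some p.entry)) ex
  | branch _ p _, emb, ex, some (.inl l) => p.code (fun l => emb (some (.inl l))) ex l
  | branch _ _ q, emb, ex, some (.inr l) => q.code (fun l => emb (some (.inr l))) ex l
  | branch c p q, emb, _, none => .branch (fun v => c v.2)
      (.goto fun _ => emb (some (.inl p.entry))) (.goto fun _ => emb (some (.inr q.entry)))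
  | seq p q, emb, _, .inl l =>
      p.code (fun l => emb (.inl l)) (.goto fun _ => emb (.inr q.entry)) l
  | seq _ q, emb, ex, .inr l => q.code (fun l => emb (.inr l)) ex l

/-- Static check of space: every symbol on stack `k` weighs `w k`, pushing has to be paid for by
previous pops, and `out` is not popped.  The result is the credit that remains. -/
def credit [DecidableEq K] (w : K → ℕ) (out : K) : Prog Γ σ → ℕ → Option ℕ
  | load _, a => some a
  | push k _, a => if w k ≤ a then some (a - w k) else none
  | pop k _ p q, a => if k = out then none else
      (p.credit w out (a + w k)).bind fun b => (q.credit w out a).bind fun b' => some (min b b')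
  | drain k _ p, a => if k = out then none else
      (p.credit w out (a + w k)).bind fun b => if a ≤ b then some a else none
  | loop _ p, a => (p.credit w out a).bind fun b => if a ≤ b then some a else none
  | branch _ p q, a =>
      (p.credit w out a).bind fun b => (q.credit w out a).bind fun b' => some (min b b')
  | seq p q, a => (p.credit w out a).bind fun b => q.credit w out b

/-- The compiled code contains pops but no peeks, and `credit` fails on any program that pops from
`out`, so its success certifies that the output is write-only. -/
theorem neverReads_code [DecidableEq K] {w : K → ℕ} {out : K} {Λ : Type} (p : Prog Γ σ) :
    ∀ {a b : ℕ} {emb : p.Lab → Λ} {ex : Code Γ σ Λ}, p.credit w out a = some b →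
      NeverReads out ex → ∀ l, NeverReads out (p.code emb ex l) := by
  induction p with
  | load f => exact fun _ h l => h
  | push k f => exact fun _ h l => h
  | pop k f p q ihp ihq =>
    intro a b emb ex hc hex l
    simp only [credit] at hc
    split_ifs at hc with hk
    simp only [Option.bind_eq_some_iff] at hc
    obtain ⟨b₁, h₁, b₂, h₂, -⟩ := hc
    match l with
    | none => exact ⟨hk, trivial, trivial⟩
    | some (.inl l) => exact ihp h₁ hex l
    | some (.inr l) => exact ihq h₂ hex l
  | drain k f p ih =>
    intro a b emb ex hc hex l
    simp only [credit] at hc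
    split_ifs at hc with hk
    simp only [Option.bind_eq_some_iff] at hc
    obtain ⟨b₁, h₁, -⟩ := hc
    match l with
    | none => exact ⟨hk, trivial, hex⟩
    | some l => exact ih h₁ (by trivial) l
  | loop c p ih =>
    intro a b emb ex hc hex l
    simp only [credit, Option.bind_eq_some_iff] at hc
    obtain ⟨b₁, h₁, -⟩ := hc
    match l with
    | none => exact ⟨trivial, hex⟩
    | some l => exact ih h₁ (by trivial) l
  | branch c p q ihp ihq =>
    intro a b emb ex hc hex l
    simp only [credit, Option.bind_eq_some_iff] at hc
    obtain ⟨b₁, h₁, b₂, h₂, -⟩ := hc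
    match l with
    | none => exact ⟨trivial, trivial⟩
    | some (.inl l) => exact ihp h₁ hex l
    | some (.inr l) => exact ihq h₂ hex l
  | seq p q ihp ihq =>
    intro a b emb ex hc hex l
    simp only [credit, Option.bind_eq_some_iff] at hc
    obtain ⟨b₁, h₁, h₂⟩ := hc
    match l with
    | .inl l => exact ihp h₁ (by trivial) l
    | .inr l => exact ihq h₂ hex l

/-! ### Compiled programs follow the big-step semantics within bounded weight -/

section Simulation

variable [DecidableEq K] [Fintype K] {Λ : Type}

/-- The weight of the contents of the stacks. -/
def weight (w : K → ℕ) (S : ∀ k, List (Γ k)) : ℕ := ∑ k, w k * (S k).length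

theorem weight_update (w : K → ℕ) (S : ∀ k, List (Γ k)) (k : K) (l : List (Γ k)) :
    weight w (Function.update S k l) + w k * (S k).length = weight w S + w k * l.length := by
  unfold weight
  rw [← Finset.add_sum_erase _ _ (Finset.mem_univ k),
    ← Finset.add_sum_erase _ (fun k => w k * (S k).length) (Finset.mem_univ k)]
  have : ∑ x ∈ Finset.univ.erase k, w x * (Function.update S k l x).length =
      ∑ x ∈ Finset.univ.erase k, w x * (S x).length :=
    Finset.sum_congr rfl fun x hx => by rw [Function.update_of_ne (Finset.ne_of_mem_erase hx)]
  rw [this, Function.update_self]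
  ring

theorem weight_push (w : K → ℕ) (S : ∀ k, List (Γ k)) (k : K) (x : Γ k) :
    weight w (Function.update S k (x :: S k)) = weight w S + w k := by
  have := weight_update w S k (x :: S k)
  simp only [List.length_cons, Nat.mul_add, mul_one] at this
  omega

theorem weight_pop (w : K → ℕ) (S : ∀ k, List (Γ k)) {k : K} {x : Γ k} {l : List (Γ k)}
    (h : S k = x :: l) : weight w (Function.update S k l) + w k = weight w S := by
  have := weight_update w S k l
  simp only [h, List.length_cons, Nat.mul_add, mul_one] at this
  omega

/-- A finite computation in which all the configurations except possibly the last have weight at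
most `N`. -/
inductive LightPath (w : K → ℕ) (N : ℕ) (M : Λ → Code Γ σ Λ) :
    Turing.TM2.Cfg Γ Λ (Bool × σ) → Turing.TM2.Cfg Γ Λ (Bool × σ) → Prop
  | refl (c) : LightPath w N M c c
  | step {l v S c} : weight w S ≤ N → LightPath w N M (Turing.TM2.stepAux (M l) v S) c →
      LightPath w N M ⟨some l, v, S⟩ c

theorem LightPath.trans {w : K → ℕ} {N : ℕ} {M : Λ → Code Γ σ Λ}
    {c₁ c₂ c₃ : Turing.TM2.Cfg Γ Λ (Bool × σ)} (h : LightPath w N M c₁ c₂)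
    (h' : LightPath w N M c₂ c₃) : LightPath w N M c₁ c₃ := by
  induction h with
  | refl c => exact h'
  | step hw _ ih => exact .step hw (ih h')

theorem LightPath.reaches {w : K → ℕ} {N : ℕ} {M : Λ → Code Γ σ Λ}
    {c c' : Turing.TM2.Cfg Γ Λ (Bool × σ)} (h : LightPath w N M c c') :
    Turing.TM2.Reaches M c c' := by
  induction h with
  | refl c => exact .refl
  | step hw _ ih => exact .head (by simp) ih

/-- The machine is deterministic, so a path to a halting configuration contains everything that is
reachable from its start. -/
theorem LightPath.weight_le {w : K → ℕ} {N : ℕ} {M : Λ → Code Γ σ Λ}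
    {c c' d : Turing.TM2.Cfg Γ Λ (Bool × σ)} (h : LightPath w N M c c') (hl : c'.l = none)
    (hw : weight w c'.stk ≤ N) (hd : Turing.TM2.Reaches M c d) : weight w d.stk ≤ N := by
  induction h with
  | refl c =>
    rcases hd.cases_head with rfl | ⟨x, hx, -⟩
    · exact hw
    · obtain ⟨l, v, S⟩ := c
      cases hl
      simp at hx
  | step hs _ ih =>
    rcases hd.cases_head with rfl | ⟨x, hx, hd⟩
    · exact hs
    · simp only [Turing.TM2.step, Option.mem_def, Option.some.injEq] at hx
      subst hx
      exact ih hl hw hd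

/-- Weight plus credit acts as a potential bounded by `N`. A pop turns weight into credit and a push
turns credit into weight. A loop body must return at least the credit it started with, so the bound
survives any number of iterations. The bit `β` holds the outcome of the last pop, which is arbitrary
on entry and of no interest on exit. -/
theorem Exec.lightPath {w : K → ℕ} {out : K} {N : ℕ} {M : Λ → Code Γ σ Λ} {p : Prog Γ σ}
    {v v' : σ} {S S' : ∀ k, List (Γ k)} (h : Exec p v S v' S') :
    ∀ {a b : ℕ} {emb : p.Lab → Λ} {ex : Code Γ σ Λ},
      (∀ l, M (emb l) = p.code emb ex l) → p.credit w out a = some b → weight w S + a ≤ N →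
      weight w S' + b ≤ N ∧ ∀ β, ∃ β',
        LightPath w N M ⟨some (emb p.entry), (β, v), S⟩ (Turing.TM2.stepAux ex (β', v') S') := by
  induction h with
  | load f v S =>
    intro a b emb ex hM hc hw
    simp only [credit, Option.some.injEq] at hc
    subst hc
    refine ⟨hw, fun β => ⟨β, .step (by omega) ?_⟩⟩
    rw [hM]
    exact .refl _
  | push k f v S =>
    intro a b emb ex hM hc hw
    simp only [credit] at hc
    split_ifs at hc with hk
    simp only [Option.some.injEq] at hc
    subst hc
    refine ⟨by rw [weight_push]; omega, fun β => ⟨β, .step (by omega) ?_⟩⟩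
    rw [hM]
    exact .refl _
  | @pop_cons k f p q v S x l v' S' hS _ ih =>
    intro a b emb ex hM hc hw
    simp only [credit] at hc
    split_ifs at hc with hk
    simp only [Option.bind_eq_some_iff, Option.some.injEq] at hc
    obtain ⟨b₁, h₁, b₂, h₂, rfl⟩ := hc
    have hpop := weight_pop w S hS
    obtain ⟨hb, hpath⟩ := ih (emb := fun l => emb (some (.inl l))) (ex := ex)
      (fun l => hM (some (.inl l))) h₁ (by omega)
    refine ⟨by omega, fun β => ?_⟩
    obtain ⟨β', hβ'⟩ := hpath true
    refine ⟨β', .step (by omega) ?_⟩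
    rw [hM]
    simpa [code, entry, hS, onPop] using hβ'
  | @pop_nil k f p q v S v' S' hS _ ih =>
    intro a b emb ex hM hc hw
    simp only [credit] at hc
    split_ifs at hc with hk
    simp only [Option.bind_eq_some_iff, Option.some.injEq] at hc
    obtain ⟨b₁, h₁, b₂, h₂, rfl⟩ := hc
    obtain ⟨hb, hpath⟩ := ih (emb := fun l => emb (some (.inr l))) (ex := ex)
      (fun l => hM (some (.inr l))) h₂ (by omega)
    refine ⟨by omega, fun β => ?_⟩
    obtain ⟨β', hβ'⟩ := hpath false
    refine ⟨β', .step (by omega) ?_⟩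
    rw [hM]
    have hup : Function.update S k [] = S := by rw [← hS, Function.update_eq_self]
    simpa [code, entry, hS, onPop, hup] using hβ'
  | @drain_cons k f p v S x l v₁ S₁ v' S' hS _ _ ih₁ ih₂ =>
    intro a b emb ex hM hc hw
    -- The unreduced check is kept, since the remaining iterations are again an execution of the
    -- whole loop.
    have hc' := hc
    simp only [credit] at hc
    split_ifs at hc with hk
    simp only [Option.bind_eq_some_iff] at hc
    obtain ⟨b₁, h₁, hc⟩ := hc
    split_ifs at hc with hab
    have hpop := weight_pop w S hS
    obtain ⟨hb, hpath⟩ := ih₁ (emb := fun l => emb (some l)) (ex := .goto fun _ => emb none)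
      (fun l => hM (some l)) h₁ (by omega)
    obtain ⟨hb₂, hpath₂⟩ := ih₂ hM hc' (by omega)
    refine ⟨hb₂, fun β => ?_⟩
    obtain ⟨β', hβ'⟩ := hpath true
    obtain ⟨β₂, hβ₂⟩ := hpath₂ β'
    refine ⟨β₂, .step (by omega) ?_⟩
    rw [hM]
    refine .trans ?_ hβ₂
    simpa [code, entry, hS, onPop] using hβ'
  | @drain_nil k f p v S hS =>
    intro a b emb ex hM hc hw
    simp only [credit] at hc
    split_ifs at hc with hk
    simp only [Option.bind_eq_some_iff] at hc
    obtain ⟨b₁, h₁, hc⟩ := hc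
    split_ifs at hc with hab
    simp only [Option.some.injEq] at hc
    subst hc
    refine ⟨hw, fun β => ⟨false, .step (by omega) ?_⟩⟩
    rw [hM]
    have hup : Function.update S k [] = S := by rw [← hS, Function.update_eq_self]
    simpa [code, entry, hS, onPop, hup] using LightPath.refl _
  | @loop_true c p v S v₁ S₁ v' S' hcv _ _ ih₁ ih₂ =>
    intro a b emb ex hM hc hw
    have hc' := hc
    simp only [credit, Option.bind_eq_some_iff] at hc
    obtain ⟨b₁, h₁, hc⟩ := hc
    split_ifs at hc with hab
    obtain ⟨hb, hpath⟩ := ih₁ (emb := fun l => emb (some l)) (ex := .goto fun _ => emb none)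
      (fun l => hM (some l)) h₁ (by omega)
    obtain ⟨hb₂, hpath₂⟩ := ih₂ hM hc' (by omega)
    refine ⟨hb₂, fun β => ?_⟩
    obtain ⟨β', hβ'⟩ := hpath β
    obtain ⟨β₂, hβ₂⟩ := hpath₂ β'
    refine ⟨β₂, .step (by omega) ?_⟩
    rw [hM]
    refine .trans ?_ hβ₂
    simpa [code, entry, hcv] using hβ'
  | @loop_false c p v S hcv =>
    intro a b emb ex hM hc hw
    simp only [credit, Option.bind_eq_some_iff] at hc
    obtain ⟨b₁, h₁, hc⟩ := hc
    split_ifs at hc with hab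
    simp only [Option.some.injEq] at hc
    subst hc
    refine ⟨hw, fun β => ⟨β, .step (by omega) ?_⟩⟩
    rw [hM]
    simpa [code, entry, hcv] using LightPath.refl _
  | @branch_true c p q v S v' S' hcv _ ih =>
    intro a b emb ex hM hc hw
    simp only [credit, Option.bind_eq_some_iff, Option.some.injEq] at hc
    obtain ⟨b₁, h₁, b₂, h₂, rfl⟩ := hc
    obtain ⟨hb, hpath⟩ := ih (emb := fun l => emb (some (.inl l))) (ex := ex)
      (fun l => hM (some (.inl l))) h₁ (by omega)
    refine ⟨by omega, fun β => ?_⟩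
    obtain ⟨β', hβ'⟩ := hpath β
    refine ⟨β', .step (by omega) ?_⟩
    rw [hM]
    simpa [code, entry, hcv] using hβ'
  | @branch_false c p q v S v' S' hcv _ ih =>
    intro a b emb ex hM hc hw
    simp only [credit, Option.bind_eq_some_iff, Option.some.injEq] at hc
    obtain ⟨b₁, h₁, b₂, h₂, rfl⟩ := hc
    obtain ⟨hb, hpath⟩ := ih (emb := fun l => emb (some (.inr l))) (ex := ex)
      (fun l => hM (some (.inr l))) h₂ (by omega)
    refine ⟨by omega, fun β => ?_⟩
    obtain ⟨β', hβ'⟩ := hpath β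
    refine ⟨β', .step (by omega) ?_⟩
    rw [hM]
    simpa [code, entry, hcv] using hβ'
  | @seq p q v S v₁ S₁ v' S' _ _ ih₁ ih₂ =>
    intro a b emb ex hM hc hw
    simp only [credit, Option.bind_eq_some_iff] at hc
    obtain ⟨b₁, h₁, h₂⟩ := hc
    obtain ⟨hb, hpath⟩ := ih₁ (emb := fun l => emb (.inl l))
      (ex := .goto fun _ => emb (.inr q.entry)) (fun l => hM (.inl l)) h₁ (by omega)
    obtain ⟨hb₂, hpath₂⟩ := ih₂ (emb := fun l => emb (.inr l)) (ex := ex)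
      (fun l => hM (.inr l)) h₂ (by omega)
    refine ⟨hb₂, fun β => ?_⟩
    obtain ⟨β', hβ'⟩ := hpath β
    obtain ⟨β₂, hβ₂⟩ := hpath₂ β'
    exact ⟨β₂, hβ'.trans hβ₂⟩

end Simulation

/-! ### Transducers from programs -/

theorem initList_eq_update (tm : Turing.FinTM2) (s : List (tm.Γ tm.k₀)) :
    Turing.initList tm s =
      ⟨some tm.main, tm.initialState, Function.update (fun _ => []) tm.k₀ s⟩ := by
  unfold Turing.initList
  congr 1
  funext k
  by_cases hk : k = tm.k₀
  · subst hk
    rw [Function.update_self]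
    exact dif_pos rfl
  · rw [Function.update_of_ne hk]
    exact dif_neg hk

/-- The transducer that runs a program. -/
noncomputable def transducer [DecidableEq K] [Fintype K] [Fintype σ] [Inhabited σ]
    [∀ k, Finite (Γ k)] {I O : Type} (p : Prog Γ σ) (w : K → ℕ) (inp out : K) (hne : inp ≠ out)
    (eI : Γ inp ≃ I) (eO : Γ out ≃ O) {a b : ℕ} (hp : p.credit w out a = some b) :
    Transducer I O where
  tm :=
    { K := K
      k₀ := inp
      k₁ := out
      Γ := Γ
      Λ := p.Lab
      main := p.entry
      ΛFin := Fintype.ofFinite _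
      σ := Bool × σ
      initialState := (false, default)
      Γk₀Fin := Fintype.ofFinite _
      m := p.code id .halt }
  inputAlphabet := eI
  outputAlphabet := eO
  finite_alphabet := fun k => inferInstanceAs (Finite (Γ k))
  input_ne_output := hne
  write_only := fun l => p.neverReads_code (ex := .halt) hp (by trivial) l

/-- Only the input stack is nonempty at the start, so `N` can be its weight plus the initial credit.
As symbols outside the output weigh at least 1, weight bounds space. -/
theorem transducer_outputsInSpace [DecidableEq K] [Fintype K] [Fintype σ] [Inhabited σ]
    [∀ k, Finite (Γ k)] {I O : Type} {p : Prog Γ σ} {w : K → ℕ} {inp out : K} {hne : inp ≠ out}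
    {eI : Γ inp ≃ I} {eO : Γ out ≃ O} {a b : ℕ} {hp : p.credit w out a = some b}
    (hpos : ∀ k, k ≠ out → 1 ≤ w k) {x : List I} {y : List O} {v' : σ} {S' : ∀ k, List (Γ k)}
    (hex : Exec p default (Function.update (fun _ => []) inp (x.map eI.symm)) v' S')
    (hy : ((S' out).map eO).reverse = y) :
    (p.transducer w inp out hne eI eO hp).OutputsInSpace x y (w inp * x.length + a) := by
  have hw : weight w (Function.update (fun k => ([] : List (Γ k))) inp (x.map eI.symm)) =
      w inp * x.length := by
    have := weight_update w (fun k => ([] : List (Γ k))) inp (x.map eI.symm)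
    simpa [weight] using this
  obtain ⟨hb, hpath⟩ := hex.lightPath (M := p.code id .halt) (emb := id) (ex := .halt)
    (N := w inp * x.length + a) (fun l => rfl) hp (by rw [hw])
  obtain ⟨β, hβ⟩ := hpath false
  constructor
  · refine ⟨⟨none, (β, v'), S'⟩, ?_, ?_, ?_⟩
    · unfold Transducer.Visits
      rw [initList_eq_update]
      exact hβ.reaches
    · rfl
    · exact hy
  · intro c hc
    unfold Transducer.Visits at hc
    rw [initList_eq_update] at hc
    refine le_trans ?_ (hβ.weight_le rfl (by simp; omega) hc)
    change (∑ k : K with k ≠ out, (c.stk k).length) ≤ weight w c.stk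
    refine le_trans (Finset.sum_le_sum (g := fun k => w k * (c.stk k).length) ?_) ?_
    · intro k hk
      exact Nat.le_mul_of_pos_left _ (hpos k (Finset.mem_filter.1 hk).2)
    · exact Finset.sum_le_sum_of_subset (Finset.filter_subset _ _)

end Prog

/-! ### Stacks, registers and rules for verifying programs -/

namespace IPCANTWriter

instance : Fintype Token where
  elems := {.zero, .one, .sep, .lpar, .rpar, .st, .down, .top, .bot, .and, .or, .eps, .letter,
    .inc, .dec, .transf}
  complete := by intro x; cases x <;> simp

/-- The stacks.  There is a cell for each state of the register automaton, and a stack of letters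
is split at the current letter; `cellsR`, `lettersT` and `tableR` are used for traversals. -/
inductive Stack : Type
  | inp | out | cells | cellsR | lettersL | lettersR | lettersT | table | tableR | vals | spare
  deriving DecidableEq

instance : Fintype Stack where
  elems := {.inp, .out, .cells, .cellsR, .lettersL, .lettersR, .lettersT, .table, .tableR, .vals,
    .spare}
  complete := by intro x; cases x <;> simp

/-- A cell stores the membership of a state in five sets. -/
abbrev Cell : Type := Fin 5 → Bool

/-- The stack alphabets. -/
abbrev Sym : Stack → Type
  | .inp | .out | .table | .tableR => Token
  | .cells | .cellsR => Cell
  | .lettersL | .lettersR | .lettersT | .spare => Unit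
  | .vals => Bool

instance : ∀ k, Finite (Sym k)
  | .inp | .out | .table | .tableR => inferInstanceAs (Finite Token)
  | .cells | .cellsR => inferInstanceAs (Finite Cell)
  | .lettersL | .lettersR | .lettersT | .spare => inferInstanceAs (Finite Unit)
  | .vals => inferInstanceAs (Finite Bool)

/-- The internal state. -/
structure Reg : Type where
  tok : Token := .sep
  cell : Cell := fun _ => false
  bit : Bool := false
  flag : Bool := false
  carry : Bool := false

instance : Inhabited Reg := ⟨{}⟩

noncomputable instance : Fintype Reg :=
  Fintype.ofInjective (fun r : Reg => (r.tok, r.cell, r.bit, r.flag, r.carry)) (by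
    rintro ⟨⟩ ⟨⟩ h
    simpa using h)

/-- The contents of the stacks. -/
structure Tapes : Type where
  inp : List Token := []
  out : List Token := []
  cells : List Cell := []
  cellsR : List Cell := []
  lettersL : List Unit := []
  lettersR : List Unit := []
  lettersT : List Unit := []
  table : List Token := []
  tableR : List Token := []
  vals : List Bool := []
  spare : List Unit := []

namespace Tapes

/-- The contents of a stack. -/
def get (t : Tapes) : (k : Stack) → List (Sym k)
  | .inp => t.inp
  | .out => t.out
  | .cells => t.cells
  | .cellsR => t.cellsR
  | .lettersL => t.lettersL
  | .lettersR => t.lettersR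
  | .lettersT => t.lettersT
  | .table => t.table
  | .tableR => t.tableR
  | .vals => t.vals
  | .spare => t.spare

/-- Change the contents of a stack. -/
def put (t : Tapes) : (k : Stack) → List (Sym k) → Tapes
  | .inp, l => { t with inp := l }
  | .out, l => { t with out := l }
  | .cells, l => { t with cells := l }
  | .cellsR, l => { t with cellsR := l }
  | .lettersL, l => { t with lettersL := l }
  | .lettersR, l => { t with lettersR := l }
  | .lettersT, l => { t with lettersT := l }
  | .table, l => { t with table := l }
  | .tableR, l => { t with tableR := l }
  | .vals, l => { t with vals := l }
  | .spare, l => { t with spare := l }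

theorem get_put (t : Tapes) (k : Stack) (l : List (Sym k)) :
    (t.put k l).get = Function.update t.get k l := by
  funext j
  by_cases h : j = k
  · subst h
    rw [Function.update_self]
    cases j <;> rfl
  · rw [Function.update_of_ne h]
    cases k <;> cases j <;> first | rfl | exact absurd rfl h

end Tapes

/-- Programs over these stacks and registers. -/
abbrev P : Type := Prog Sym Reg

/-- The weakest precondition: `p` terminates in a state that satisfies `Q`. -/
def wp (p : P) (Q : Reg → Tapes → Prop) (v : Reg) (t : Tapes) : Prop :=
  ∃ v' t', Prog.Exec p v t.get v' t'.get ∧ Q v' t'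

section Rules

variable {p q : P} {Q : Reg → Tapes → Prop} {v : Reg} {t : Tapes} {k : Stack}

theorem wp_mono {Q' : Reg → Tapes → Prop} (h : wp p Q v t) (hQ : ∀ v t, Q v t → Q' v t) :
    wp p Q' v t := by
  obtain ⟨v', t', he, hq⟩ := h
  exact ⟨v', t', he, hQ _ _ hq⟩

theorem wp_seq (h : wp p (wp q Q) v t) : wp (.seq p q) Q v t := by
  obtain ⟨v₁, t₁, h₁, v', t', h₂, hq⟩ := h
  exact ⟨v', t', .seq h₁ h₂, hq⟩

theorem wp_load {f : Reg → Reg} (h : Q (f v) t) : wp (.load f) Q v t :=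
  ⟨_, _, .load .., h⟩

theorem wp_push {f : Reg → Sym k} (h : Q v (t.put k (f v :: t.get k))) : wp (.push k f) Q v t := by
  refine ⟨_, _, ?_, h⟩
  rw [Tapes.get_put]
  exact .push ..

theorem wp_pop_cons {f : Reg → Sym k → Reg} {x : Sym k} {l : List (Sym k)} (hk : t.get k = x :: l)
    (h : wp p Q (f v x) (t.put k l)) : wp (.pop k f p q) Q v t := by
  obtain ⟨v', t', he, hq⟩ := h
  rw [Tapes.get_put] at he
  exact ⟨v', t', .pop_cons hk he, hq⟩

theorem wp_drain_cons {f : Reg → Sym k → Reg} {x : Sym k} {l : List (Sym k)}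
    (hk : t.get k = x :: l) (h : wp p (wp (.drain k f p) Q) (f v x) (t.put k l)) :
    wp (.drain k f p) Q v t := by
  obtain ⟨v₁, t₁, h₁, v', t', h₂, hq⟩ := h
  rw [Tapes.get_put] at h₁
  exact ⟨v', t', .drain_cons hk h₁ h₂, hq⟩

theorem wp_drain_nil {f : Reg → Sym k → Reg} (hk : t.get k = []) (h : Q v t) :
    wp (.drain k f p) Q v t :=
  ⟨v, t, .drain_nil hk, h⟩

theorem wp_loop_true {c : Reg → Bool} (hc : c v = true) (h : wp p (wp (.loop c p) Q) v t) :
    wp (.loop c p) Q v t := by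
  obtain ⟨v₁, t₁, h₁, v', t', h₂, hq⟩ := h
  exact ⟨v', t', .loop_true hc h₁ h₂, hq⟩

theorem wp_loop_false {c : Reg → Bool} (hc : c v = false) (h : Q v t) : wp (.loop c p) Q v t :=
  ⟨v, t, .loop_false hc, h⟩

theorem wp_branch_true {c : Reg → Bool} (hc : c v = true) (h : wp p Q v t) :
    wp (.branch c p q) Q v t := by
  obtain ⟨v', t', he, hq⟩ := h
  exact ⟨v', t', .branch_true hc he, hq⟩

theorem wp_branch_false {c : Reg → Bool} (hc : c v = false) (h : wp q Q v t) :
    wp (.branch c p q) Q v t := by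
  obtain ⟨v', t', he, hq⟩ := h
  exact ⟨v', t', .branch_false hc he, hq⟩

end Rules

/-- Sequential composition of a list of programs. -/
def block : List P → P
  | [] => .load id
  | p :: ps => .seq p (block ps)

theorem wp_block_cons {p : P} {ps : List P} {Q : Reg → Tapes → Prop} {v : Reg} {t : Tapes}
    (h : wp p (wp (block ps) Q) v t) : wp (block (p :: ps)) Q v t :=
  wp_seq h

theorem wp_block_nil {Q : Reg → Tapes → Prop} {v : Reg} {t : Tapes} (h : Q v t) :
    wp (block []) Q v t :=
  wp_load h

/-! ### Programs that only write -/

/-- `p` writes `w` and changes no other stack of `t`. -/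
def Emits (p : P) (t : Tapes) (w : List Token) : Prop :=
  ∀ o v, wp p (fun _ t' => t' = { t with out := w.reverse ++ o }) v { t with out := o }

theorem Emits.block_nil {t : Tapes} : Emits (block []) t [] :=
  fun _ _ => wp_block_nil rfl

theorem Emits.block_cons {p : P} {ps : List P} {t : Tapes} {w w' : List Token} (h : Emits p t w)
    (h' : Emits (block ps) t w') : Emits (block (p :: ps)) t (w ++ w') := by
  intro o v
  refine wp_block_cons (wp_mono (h o v) ?_)
  rintro v' t' rfl
  refine wp_mono (h' _ v') ?_
  rintro v'' t'' rfl
  simp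

/-- Write a symbol. -/
def emit (x : Token) : P := .push .out fun _ => x

theorem emits_emit (x : Token) (t : Tapes) : Emits (emit x) t [x] :=
  fun _ _ => wp_push rfl

/-! ### Traversals of the cells -/

/-- Put back the cells that have been passed. -/
def restoreCells : P := .drain .cellsR (fun v x => { v with cell := x }) (.push .cells (·.cell))

/-- The register `cell` serves as a buffer, so the postcondition is required for any final value of
it. -/
theorem wp_restoreCells {Q : Reg → Tapes → Prop} {v : Reg} {t : Tapes}
    (h : ∀ x, Q { v with cell := x } { t with cells := t.cellsR.reverse ++ t.cells, cellsR := [] }) :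
    wp restoreCells Q v t := by
  obtain ⟨l, hl⟩ : ∃ l, t.cellsR = l := ⟨_, rfl⟩
  induction l generalizing v t with
  | nil =>
    refine wp_drain_nil hl ?_
    cases t
    dsimp only at hl
    subst hl
    exact h v.cell
  | cons x l ih =>
    refine wp_drain_cons hl (wp_push (ih ?_ rfl))
    intro y
    have := h y
    simp only [hl, List.reverse_cons, List.append_assoc, List.singleton_append] at this
    exact this

/-- The symbol for a bit. -/
def bitTok (b : Bool) : Token := if b then .one else .zero

/-- Write the bits of set number `i`. -/
def emitTrack (i : Fin 5) : P :=
  block [.drain .cells (fun v x => { v with cell := x })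
    (block [.push .out fun v => bitTok (v.cell i), .push .cellsR (·.cell)]), restoreCells]

theorem emits_emitTrack (i : Fin 5) {t : Tapes} (ht : t.cellsR = []) :
    Emits (emitTrack i) t (t.cells.map fun x => bitTok (x i)) := by
  intro o v
  refine wp_block_cons ?_
  -- The loop is treated by induction on the remaining cells, with arbitrary contents of the other
  -- stacks; the same scheme serves for the later loops.
  suffices H : ∀ (l : List Cell) (v : Reg) (t : Tapes) (Q : Reg → Tapes → Prop), t.cells = l →
      (∀ v', Q v' { t with
        cells := []
        cellsR := l.reverse ++ t.cellsR
        out := (l.map fun x => bitTok (x i)).reverse ++ t.out }) →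
      wp (.drain .cells (fun v x => { v with cell := x })
        (block [.push .out fun v => bitTok (v.cell i), .push .cellsR (·.cell)])) Q v t by
    refine H _ v _ _ rfl fun v' => wp_block_cons (wp_restoreCells fun x => wp_block_nil ?_)
    simp [ht]
  intro l
  induction l with
  | nil =>
    intro v t Q hl h
    refine wp_drain_nil hl ?_
    cases t
    dsimp only at hl
    subst hl
    exact h v
  | cons x l ih =>
    intro v t Q hl h
    refine wp_drain_cons hl (wp_block_cons (wp_push (wp_block_cons (wp_push (wp_block_nil
      (ih _ _ _ rfl ?_))))))
    intro v'
    have := h v'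
    simp only [List.reverse_cons, List.map_cons, List.append_assoc, List.singleton_append] at this
    exact this

/-- Write a stroke for each cell. -/
def emitStrokes : P :=
  block [.drain .cells (fun v x => { v with cell := x })
    (block [emit .one, .push .cellsR (·.cell)]), restoreCells]

theorem emits_emitStrokes {t : Tapes} (ht : t.cellsR = []) :
    Emits emitStrokes t (List.replicate t.cells.length .one) := by
  intro o v
  refine wp_block_cons ?_
  suffices H : ∀ (l : List Cell) (v : Reg) (t : Tapes) (Q : Reg → Tapes → Prop), t.cells = l →
      (∀ v', Q v' { t with
        cells := []
        cellsR := l.reverse ++ t.cellsR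
        out := List.replicate l.length .one ++ t.out }) →
      wp (.drain .cells (fun v x => { v with cell := x })
        (block [emit .one, .push .cellsR (·.cell)])) Q v t by
    refine H _ v _ _ rfl fun v' => wp_block_cons (wp_restoreCells fun x => wp_block_nil ?_)
    simp [ht]
  intro l
  induction l with
  | nil =>
    intro v t Q hl h
    refine wp_drain_nil hl ?_
    cases t
    dsimp only at hl
    subst hl
    exact h v
  | cons x l ih =>
    intro v t Q hl h
    refine wp_drain_cons hl (wp_block_cons (wp_push (wp_block_cons (wp_push (wp_block_nil
      (ih _ _ _ rfl ?_))))))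
    intro v'
    have := h v'
    simp only [List.reverse_cons, List.length_cons, List.replicate_succ', List.append_assoc,
      List.singleton_append] at this
    exact this

/-! ### Enumerating bit vectors -/

/-- Addition of a carry to a bit vector, with the least significant bit first. -/
def addBit : Bool → List Bool → List Bool
  | _, [] => []
  | c, b :: l => (c ^^ b) :: addBit (c && b) l

/-- The carry that results from such an addition. -/
def carryBit : Bool → List Bool → Bool
  | c, [] => c
  | c, b :: l => carryBit (c && b) l

theorem addBit_false (l : List Bool) : addBit false l = l := by
  induction l with
  | nil => rfl
  | cons b l ih => simp [addBit, ih]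

theorem carryBit_false (l : List Bool) : carryBit false l = false := by
  induction l with
  | nil => rfl
  | cons b l ih => simpa [carryBit] using ih

theorem length_addBit (c : Bool) (l : List Bool) : (addBit c l).length = l.length := by
  induction l generalizing c with
  | nil => rfl
  | cons b l ih => simp [addBit, ih]

/-- Overflow happens only at the all-ones vector and wraps around to zero. This is why an
enumeration leaves its set empty, as it found it, and can be nested in other loops. -/
theorem addBit_of_carryBit {l : List Bool} (h : carryBit true l = true) :
    addBit true l = List.replicate l.length false := by
  induction l with
  | nil => rfl
  | cons b l ih =>
    cases b with
    | false => simp [carryBit, carryBit_false] at h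
    | true =>
      simp only [carryBit, Bool.and_self] at h
      simp [addBit, ih h, List.replicate_succ]

/-- `Succs l L`: adding one repeatedly to `l` yields the members of `L` until there is a carry. -/
inductive Succs : List Bool → List (List Bool) → Prop
  | last {l} : carryBit true l = true → Succs l [l]
  | cons {l L} : carryBit true l = false → Succs (addBit true l) L → Succs l (l :: L)

/-- All the bit vectors of length `n`. -/
def bitVecs : ℕ → List (List Bool)
  | 0 => [[]]
  | n + 1 => (bitVecs n).flatMap fun l => [false :: l, true :: l]

theorem mem_bitVecs {n : ℕ} {l : List Bool} : l ∈ bitVecs n ↔ l.length = n := by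
  induction n generalizing l with
  | zero => simp [bitVecs]
  | succ n ih =>
    simp only [bitVecs, List.mem_flatMap, List.mem_cons, List.not_mem_nil, or_false, ih]
    constructor
    · rintro ⟨l', h, rfl | rfl⟩ <;> simp [h]
    · intro h
      match l, h with
      | false :: l, h => exact ⟨l, by simpa using h, Or.inl rfl⟩
      | true :: l, h => exact ⟨l, by simpa using h, Or.inr rfl⟩

/-- With the least significant bit first, counting passes from `false :: l` to `true :: l` without a
carry into `l`, and from there to `false` followed by the successor of `l`. -/
theorem Succs.cons_bit {l : List Bool} {L : List (List Bool)} (h : Succs l L) :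
    Succs (false :: l) (L.flatMap fun l => [false :: l, true :: l]) := by
  induction h with
  | @last l h =>
    refine .cons (by simp [carryBit, carryBit_false]) ?_
    simp only [addBit, addBit_false, Bool.true_xor, Bool.not_false, Bool.and_false]
    exact .last (by simpa [carryBit] using h)
  | @cons l L h _ ih =>
    refine .cons (by simp [carryBit, carryBit_false]) ?_
    simp only [addBit, addBit_false, Bool.true_xor, Bool.not_false, Bool.and_false]
    refine .cons (by simpa [carryBit] using h) ?_
    exact ih

theorem succs_bitVecs (n : ℕ) : Succs (List.replicate n false) (bitVecs n) := by
  induction n with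
  | zero => exact .last rfl
  | succ n ih => exact ih.cons_bit

/-- Set number `i` of the cells is changed to `b`. -/
def setTrack (i : Fin 5) (l : List Cell) (b : List Bool) : List Cell :=
  List.zipWith (fun x b => Function.update x i b) l b

/-- Add one to set number `i`, seen as a number. -/
def increment (i : Fin 5) : P :=
  block [.load fun v => { v with carry := true },
    .drain .cells (fun v x => { v with cell := x })
      (block [.push .cellsR fun v => Function.update v.cell i (v.carry ^^ v.cell i),
        .load fun v => { v with carry := v.carry && v.cell i }]),
    restoreCells]

theorem wp_increment (i : Fin 5) {Q : Reg → Tapes → Prop} {v : Reg} {t : Tapes} {l : List Cell}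
    {b : List Bool} (ht : t.cellsR = []) (hb : b.length = l.length)
    (hc : t.cells = setTrack i l b)
    (h : ∀ v', v'.carry = carryBit true b →
      Q v' { t with cells := setTrack i l (addBit true b) }) :
    wp (increment i) Q v t := by
  refine wp_block_cons (wp_load (wp_block_cons ?_))
  suffices H : ∀ (l : List Cell) (b : List Bool) (v : Reg) (t : Tapes)
      (Q : Reg → Tapes → Prop), b.length = l.length → t.cells = setTrack i l b →
      (∀ v', v'.carry = carryBit v.carry b → Q v' { t with
        cells := []
        cellsR := (setTrack i l (addBit v.carry b)).reverse ++ t.cellsR }) →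
      wp (.drain .cells (fun v x => { v with cell := x })
        (block [.push .cellsR fun v => Function.update v.cell i (v.carry ^^ v.cell i),
        .load fun v => { v with carry := v.carry && v.cell i }])) Q v t by
    refine H l b _ _ _ hb hc fun v' hv' =>
      wp_block_cons (wp_restoreCells fun x => wp_block_nil ?_)
    have := h { v' with cell := x } hv'
    simp only [ht, List.append_nil, List.reverse_reverse]
    simpa [ht] using this
  intro l
  induction l with
  | nil =>
    intro b v t Q hb hc h
    obtain rfl : b = [] := List.length_eq_zero_iff.1 hb
    refine wp_drain_nil hc ?_
    have := h v rfl
    simp only [setTrack, addBit, List.zipWith_nil_left, List.reverse_nil, List.nil_append] at this hc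
    simpa [← hc] using this
  | cons x l ih =>
    intro b v t Q hb hc h
    match b, hb with
    | b :: bs, hb =>
      refine wp_drain_cons hc (wp_block_cons (wp_push (wp_block_cons (wp_load (wp_block_nil
        (ih bs _ _ _ (by simpa using hb) rfl ?_))))))
      intro v' hv'
      simp only [Function.update_self] at hv'
      have := h v' hv'
      simp only [setTrack, addBit, List.zipWith_cons_cons, List.reverse_cons, List.append_assoc,
        List.singleton_append] at this
      simpa [Tapes.put, Tapes.get, setTrack] using this

/-- Run a program for all the values of set number `i`. -/
def forSubsets (i : Fin 5) (p : P) : P :=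
  block [.load fun v => { v with carry := false },
    .loop (fun v => !v.carry) (block [p, increment i])]

/-- Set number `i` has to be empty at the start and is empty again after the final overflow, so the
loop as a whole only writes. The body may spoil the registers, because `increment` sets `carry`
afresh before it is tested. -/
theorem emits_forSubsets {i : Fin 5} {p : P} {t : Tapes} {l : List Cell}
    {g : List Bool → List Token} (ht : t.cellsR = [])
    (hc : t.cells = setTrack i l (List.replicate l.length false))
    (h : ∀ b, b.length = l.length → Emits p { t with cells := setTrack i l b } (g b)) :
    Emits (forSubsets i p) t ((bitVecs l.length).flatMap g) := by
  intro o v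
  refine wp_block_cons (wp_load (wp_block_cons ?_))
  suffices H : ∀ b L, Succs b L → b.length = l.length → ∀ o v, v.carry = false →
      wp (.loop (fun v => !v.carry) (block [p, increment i])) (fun _ t' =>
        t' = { t with out := (L.flatMap g).reverse ++ o }) v
        { t with cells := setTrack i l b, out := o } by
    refine wp_mono (Q := fun _ t' =>
      t' = { t with out := ((bitVecs l.length).flatMap g).reverse ++ o }) ?_ ?_
    · have := H _ _ (succs_bitVecs l.length) (by simp) o { v with carry := false } rfl
      rwa [← hc] at this
    · exact fun v t h => wp_block_nil h
  intro b L hL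
  induction hL with
  | @last b hcar =>
    intro hb o v hv
    refine wp_loop_true (by simp [hv]) (wp_block_cons (wp_mono (h b hb o v) ?_))
    rintro v' t' rfl
    refine wp_block_cons (wp_increment i ht hb rfl fun v'' hv'' => wp_block_nil ?_)
    refine wp_loop_false (by simp [hv'', hcar]) ?_
    simp only [addBit_of_carryBit hcar, hb, ← hc, List.flatMap_cons, List.flatMap_nil,
      List.append_nil]
  | @cons b L hcar _ ih =>
    intro hb o v hv
    refine wp_loop_true (by simp [hv]) (wp_block_cons (wp_mono (h b hb o v) ?_))
    rintro v' t' rfl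
    refine wp_block_cons (wp_increment i ht hb rfl fun v'' hv'' => wp_block_nil ?_)
    refine wp_mono (ih ((length_addBit _ _).trans hb) _ v'' (hv''.trans hcar)) ?_
    rintro _ _ rfl
    simp

/-! ### Letters -/

/-- Run a program for all the letters. -/
def forLetters (p : P) : P :=
  block [.drain .lettersR (fun v _ => v) (block [p, .push .lettersL fun _ => ()]),
    .drain .lettersL (fun v _ => v) (.push .lettersR fun _ => ())]

/-- While letter `a` is processed, its own symbol is on neither stack: `a` symbols lie to the left
and `n - 1 - a` to the right. -/
theorem emits_forLetters {p : P} {t : Tapes} {n : ℕ} {g : ℕ → List Token} (hL : t.lettersL = [])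
    (hR : t.lettersR = List.replicate n ())
    (h : ∀ a, a < n → Emits p { t with
      lettersL := List.replicate a ()
      lettersR := List.replicate (n - 1 - a) () } (g a)) :
    Emits (forLetters p) t ((List.range n).flatMap g) := by
  obtain ⟨inp, out, cells, cellsR, L, R, lettersT, table, tableR, vals, spare⟩ := t
  dsimp only at hL hR h
  subst hL hR
  let t : Tapes :=
    ⟨inp, out, cells, cellsR, [], List.replicate n (), lettersT, table, tableR, vals, spare⟩
  intro o v
  refine wp_block_cons ?_
  suffices H : ∀ m a, a + m = n → ∀ o v, wp
      (.drain .lettersR (fun v _ => v) (block [p, .push .lettersL fun _ => ()]))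
      (fun _ t' => t' = { t with
        lettersL := List.replicate n ()
        lettersR := []
        out := ((List.range' a m).flatMap g).reverse ++ o }) v
      { t with lettersL := List.replicate a (), lettersR := List.replicate m (), out := o } by
    refine wp_mono (H n 0 (by omega) o v) ?_
    rintro v' t' rfl
    rw [← List.range_eq_range']
    refine wp_block_cons ?_
    suffices H' : ∀ m a, a + m = n → ∀ v, wp
        (.drain .lettersL (fun v _ => v) (.push .lettersR fun _ => ()))
        (fun _ t' => t' = { t with
          out := ((List.range n).flatMap g).reverse ++ o }) v
        { t with
          lettersL := List.replicate m ()
          lettersR := List.replicate a ()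
          out := ((List.range n).flatMap g).reverse ++ o } by
      exact wp_mono (H' n 0 (by omega) v') fun _ _ h => wp_block_nil h
    intro m
    induction m with
    | zero =>
      intro a ha v
      refine wp_drain_nil rfl ?_
      obtain rfl : a = n := by omega
      rfl
    | succ m ih =>
      intro a ha v
      exact wp_drain_cons rfl (wp_push (ih (a + 1) (by omega) v))
  intro m
  induction m with
  | zero =>
    intro a ha o v
    refine wp_drain_nil rfl ?_
    obtain rfl : a = n := by omega
    simp
  | succ m ih =>
    intro a ha o v
    have hm : m = n - 1 - a := by omega
    have h1 := h a (by omega) o v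
    rw [← hm] at h1
    refine wp_drain_cons rfl (wp_block_cons (wp_mono h1 ?_))
    rintro v' t' rfl
    refine wp_block_cons (wp_push (wp_block_nil (wp_mono (ih (a + 1) (by omega) _ v') ?_)))
    rintro _ _ rfl
    simp [List.range'_succ]

/-- Write a stroke for each letter before the current one. -/
def emitLetter : P :=
  block [.drain .lettersL (fun v _ => v) (block [emit .one, .push .lettersT fun _ => ()]),
    .drain .lettersT (fun v _ => v) (.push .lettersL fun _ => ())]

theorem emits_emitLetter {t : Tapes} {a : ℕ} (hL : t.lettersL = List.replicate a ())
    (hT : t.lettersT = []) : Emits emitLetter t (List.replicate a .one) := by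
  obtain ⟨inp, out, cells, cellsR, L, lettersR, T, table, tableR, vals, spare⟩ := t
  dsimp only at hL hT
  subst hL hT
  let t : Tapes := ⟨inp, out, cells, cellsR, List.replicate a (), lettersR, [], table, tableR,
    vals, spare⟩
  intro o v
  refine wp_block_cons ?_
  suffices H : ∀ m b, b + m = a → ∀ v, wp
      (.drain .lettersL (fun v _ => v) (block [emit .one, .push .lettersT fun _ => ()]))
      (fun _ t' => t' = { t with
        lettersL := []
        lettersT := List.replicate a ()
        out := List.replicate a .one ++ o }) v
      { t with
        lettersL := List.replicate m ()
        lettersT := List.replicate b ()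
        out := List.replicate b .one ++ o } by
    refine wp_mono (H a 0 (by omega) v) ?_
    rintro v' t' rfl
    refine wp_block_cons ?_
    suffices H' : ∀ m b, b + m = a → ∀ v, wp
        (.drain .lettersT (fun v _ => v) (.push .lettersL fun _ => ()))
        (fun _ t' => t' = { t with out := List.replicate a .one ++ o }) v
        { t with
          lettersL := List.replicate b ()
          lettersT := List.replicate m ()
          out := List.replicate a .one ++ o } by
      refine wp_mono (H' a 0 (by omega) v') fun _ _ h => wp_block_nil ?_
      simpa [t] using h
    intro m
    induction m with
    | zero =>
      intro b hb v
      refine wp_drain_nil rfl ?_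
      obtain rfl : b = a := by omega
      rfl
    | succ m ih =>
      intro b hb v
      exact wp_drain_cons rfl (wp_push (ih (b + 1) (by omega) v))
  intro m
  induction m with
  | zero =>
    intro b hb v
    refine wp_drain_nil rfl ?_
    obtain rfl : b = a := by omega
    simp
  | succ m ih =>
    intro b hb v
    exact wp_drain_cons rfl (wp_block_cons (wp_push (wp_block_cons (wp_push (wp_block_nil
      (ih (b + 1) (by omega) v))))))

end IPCANTWriter

/-- The truth value of a formula. -/
def PosBool.eval {Q : Type} (P P' : Q → Bool) : PosBool Q → Bool
  | state q => P q
  | down q => P' q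
  | top => true
  | bot => false
  | and φ ψ => φ.eval P P' && ψ.eval P P'
  | or φ ψ => φ.eval P P' || ψ.eval P P'

theorem PosBool.eval_iff {Q : Type} (P P' : Q → Bool) (φ : PosBool Q) :
    φ.eval P P' = true ↔ φ.Sat {q | P q = true} {q | P' q = true} := by
  induction φ with
  | state q => rfl
  | down q => rfl
  | top => simp [eval, Sat]
  | bot => simp [eval, Sat]
  | and φ ψ ihφ ihψ => simp [eval, Sat, ihφ, ihψ]
  | or φ ψ ihφ ihψ => simp [eval, Sat, ihφ, ihψ]

namespace IPCANTWriter

/-! ### Evaluating the transition table -/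

/-- Do nothing. -/
def skip : P := .load id

theorem wp_skip {Q : Reg → Tapes → Prop} {v : Reg} {t : Tapes} (h : Q v t) : wp skip Q v t :=
  wp_load h

/-- Pass a cell. -/
def advance : P := .pop .cells (fun v x => { v with cell := x }) (.push .cellsR (·.cell)) skip

/-- Write a truth value, computed from the registers, to the stack of values. -/
def pushVal (f : Reg → Bool) : P := .pop .spare (fun v _ => v) (.push .vals f) skip

/-- Look up the current cell in set number `i`, and return to the first cell. -/
def readBit (i : Fin 5) : P :=
  block [.pop .cells (fun v x => { v with cell := x })
    (block [.push .cells (·.cell), pushVal (·.cell i)]) skip, restoreCells]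

/-- Apply a connective to the two topmost values. -/
def connective (f : Bool → Bool → Bool) : P :=
  .pop .vals (fun v x => { v with bit := x })
    (.pop .vals (fun v x => { v with bit := f v.bit x })
      (block [.push .vals (·.bit), .push .spare fun _ => ()]) skip) skip

/-- The effect of a symbol of the table on the stack of values. -/
def evalTok (i j : Fin 5) : P :=
  .branch (fun v => decide (v.tok = .one)) advance <|
  .branch (fun v => decide (v.tok = .st)) (readBit i) <|
  .branch (fun v => decide (v.tok = .down)) (readBit j) <|
  .branch (fun v => decide (v.tok = .top)) (pushVal fun _ => true) <|
  .branch (fun v => decide (v.tok = .bot)) (pushVal fun _ => false) <|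
  .branch (fun v => decide (v.tok = .and)) (connective (· && ·)) <|
  .branch (fun v => decide (v.tok = .or)) (connective (· || ·)) skip

/-- Evaluate all the formulae in the table, where sets number `i` and `j` interpret the states. -/
def evalTable (i j : Fin 5) : P :=
  .drain .table (fun v x => { v with tok := x }) (block [.push .tableR (·.tok), evalTok i j])

section Eval

variable {i j : Fin 5} {Q : Reg → Tapes → Prop}

theorem wp_evalTable_cons {v : Reg} {t : Tapes} {x : Token} {l : List Token}
    (ht : t.table = x :: l)
    (h : wp (evalTok i j) (wp (evalTable i j) Q) { v with tok := x }
      { t with table := l, tableR := x :: t.tableR }) :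
    wp (evalTable i j) Q v t :=
  wp_drain_cons ht (wp_block_cons (wp_push (wp_block_cons (wp_mono h fun _ _ => wp_block_nil))))

theorem wp_evalTable_sep {v : Reg} {t : Tapes} {l : List Token} (ht : t.table = .sep :: l)
    (h : ∀ v', wp (evalTable i j) Q v' { t with table := l, tableR := .sep :: t.tableR }) :
    wp (evalTable i j) Q v t :=
  wp_evalTable_cons ht <| wp_branch_false rfl <| wp_branch_false rfl <| wp_branch_false rfl <|
    wp_branch_false rfl <| wp_branch_false rfl <| wp_branch_false rfl <| wp_branch_false rfl <|
    wp_skip (h _)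

/-- Each stroke of a state number passes one cell, so after the strokes the cell of that state is on
top. -/
theorem wp_evalTable_ones {pre post : List Cell} {v : Reg} {t : Tapes} {l : List Token}
    (ht : t.table = List.replicate pre.length .one ++ l) (hc : t.cells = pre ++ post)
    (h : ∀ v', wp (evalTable i j) Q v' { t with
      table := l
      tableR := List.replicate pre.length .one ++ t.tableR
      cells := post
      cellsR := pre.reverse ++ t.cellsR }) :
    wp (evalTable i j) Q v t := by
  induction pre generalizing v t with
  | nil =>
    cases t
    dsimp only at ht hc
    subst ht hc
    exact h v
  | cons x pre ih =>
    refine wp_evalTable_cons ht <| wp_branch_true rfl <| wp_pop_cons hc <| wp_push <|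
      ih rfl rfl fun v' => ?_
    have := h v'
    simp only [List.length_cons, List.replicate_succ', List.append_assoc, List.reverse_cons,
      List.singleton_append] at this
    exact this

theorem wp_pushVal {f : Reg → Bool} {v : Reg} {t : Tapes} {m : ℕ}
    (ht : t.spare = List.replicate (m + 1) ())
    (h : Q v { t with vals := f v :: t.vals, spare := List.replicate m () }) :
    wp (pushVal f) Q v t :=
  wp_pop_cons ht (wp_push h)

theorem wp_readBit {k : Fin 5} {pre post : List Cell} {x : Cell} {v : Reg} {t : Tapes} {m : ℕ}
    (hs : t.spare = List.replicate (m + 1) ()) (hR : t.cellsR = pre.reverse)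
    (hc : t.cells = x :: post)
    (h : ∀ v', Q v' { t with
      cells := pre ++ x :: post
      cellsR := []
      vals := x k :: t.vals
      spare := List.replicate m () }) :
    wp (readBit k) Q v t := by
  cases t
  dsimp only at hs hR hc
  subst hs hR hc
  refine wp_block_cons <| wp_pop_cons rfl <| wp_block_cons <| wp_push <| wp_block_cons <|
    wp_pushVal rfl <| wp_block_nil <| wp_block_cons <| wp_restoreCells fun y => wp_block_nil ?_
  simpa [Tapes.put, Tapes.get] using h _

/-- The evaluation of an atomic formula, up to the symbol that selects the set. -/
theorem wp_evalTable_tally {n : ℕ} {x : Cell} {v : Reg} {t : Tapes} {l : List Token}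
    (ht : t.table = (Token.tally n).reverse ++ l) (hx : t.cells[n]? = some x)
    (h : ∀ v' pre post, t.cells = pre ++ x :: post → wp (evalTable i j) Q v' { t with
      table := l
      tableR := Token.tally n ++ t.tableR
      cells := x :: post
      cellsR := pre.reverse ++ t.cellsR }) :
    wp (evalTable i j) Q v t := by
  obtain ⟨hn, hx⟩ := List.getElem?_eq_some_iff.1 hx
  have hsplit : t.cells = t.cells.take n ++ x :: t.cells.drop (n + 1) := by
    rw [← hx, ← List.drop_eq_getElem_cons, List.take_append_drop]
  have hlen : (t.cells.take n).length = n := by simp; omega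
  have ht' : t.table = .sep :: (List.replicate (t.cells.take n).length .one ++ l) := by
    rw [ht, hlen]
    simp [Token.tally]
  refine wp_evalTable_sep ht' fun v' => wp_evalTable_ones rfl hsplit fun v'' => ?_
  have := h v'' _ _ hsplit
  rw [hlen]
  simpa [Token.tally] using this

theorem wp_connective {f : Bool → Bool → Bool} {x y : Bool} {l : List Bool} {v : Reg} {t : Tapes}
    {m : ℕ} (hv : t.vals = x :: y :: l) (hs : t.spare = List.replicate m ())
    (h : ∀ v', Q v' { t with vals := f x y :: l, spare := List.replicate (m + 1) () }) :
    wp (connective f) Q v t := by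
  cases t
  dsimp only at hv hs
  subst hv hs
  exact wp_pop_cons rfl <| wp_pop_cons rfl <| wp_block_cons <| wp_push <| wp_block_cons <|
    wp_push <| wp_block_nil <| h _

theorem length_encode_pos {S : Type} (num : S → ℕ) (φ : PosBool S) :
    0 < (φ.encode num).length := by
  cases φ <;> simp [PosBool.encode]

/-- There is one spare symbol for each symbol of the table, so the spare symbols suffice to hold one
value per formula. -/
theorem length_le_length_flatMap_encode {S : Type} (num : S → ℕ) (φs : List (PosBool S)) :
    φs.length ≤ (φs.flatMap (·.encode num)).length := by
  rw [List.length_flatMap]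
  calc φs.length = (φs.map fun _ => 1).sum := by simp
    _ ≤ _ := List.sum_le_sum fun φ _ => length_encode_pos num φ

/-- The table is stored backwards, so prefix notation is read as postfix notation and a stack of
values suffices. Evaluation uses up one spare symbol on balance; the bound on the length guarantees
enough of them for intermediate values. -/
theorem wp_evalTable_formula {S : Type} {num : S → ℕ} {cellOf : S → Cell} {C : List Cell}
    (hC : ∀ q, C[num q]? = some (cellOf q)) (φ : PosBool S) {v : Reg} {t : Tapes} {m : ℕ}
    {l : List Token} (ht : t.table = (φ.encode num).reverse ++ l) (hc : t.cells = C)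
    (hR : t.cellsR = []) (hs : t.spare = List.replicate (m + 1) ())
    (hm : (φ.encode num).length ≤ m + 1)
    (h : ∀ v', wp (evalTable i j) Q v' { t with
      table := l
      tableR := φ.encode num ++ t.tableR
      vals := φ.eval (fun q => cellOf q i) (fun q => cellOf q j) :: t.vals
      spare := List.replicate m () }) :
    wp (evalTable i j) Q v t := by
  induction φ generalizing v t m l with
  | state q =>
    simp only [PosBool.encode, List.reverse_cons, List.append_assoc, List.singleton_append] at ht
    refine wp_evalTable_tally ht (hc ▸ hC q) fun v' pre post hpre => ?_
    refine wp_evalTable_cons rfl <| wp_branch_false rfl <| wp_branch_true rfl <|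
      wp_readBit (pre := pre) hs (by simp [hR]) rfl fun v'' => ?_
    simpa [PosBool.encode, PosBool.eval, ← hpre, ← hR] using h v''
  | down q =>
    simp only [PosBool.encode, List.reverse_cons, List.append_assoc, List.singleton_append] at ht
    refine wp_evalTable_tally ht (hc ▸ hC q) fun v' pre post hpre => ?_
    refine wp_evalTable_cons rfl <| wp_branch_false rfl <| wp_branch_false rfl <|
      wp_branch_true rfl <|
      wp_readBit (pre := pre) hs (by simp [hR]) rfl fun v'' => ?_
    simpa [PosBool.encode, PosBool.eval, ← hpre, ← hR] using h v''
  | top =>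
    exact wp_evalTable_cons ht <| wp_branch_false rfl <| wp_branch_false rfl <|
      wp_branch_false rfl <| wp_branch_true rfl <| wp_pushVal hs <| h _
  | bot =>
    exact wp_evalTable_cons ht <| wp_branch_false rfl <| wp_branch_false rfl <|
      wp_branch_false rfl <| wp_branch_false rfl <| wp_branch_true rfl <| wp_pushVal hs <| h _
  | and φ ψ ihφ ihψ =>
    simp only [PosBool.encode, List.reverse_cons, List.reverse_append, List.append_assoc,
      List.singleton_append] at ht
    simp only [PosBool.encode, List.length_cons, List.length_append] at hm
    have := length_encode_pos num φ
    have := length_encode_pos num ψ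
    -- A conjunction has at least three symbols, so a spare symbol remains for the first operand
    -- after the second, which comes first in the reversed table, has been evaluated. The connective
    -- gives one back.
    obtain ⟨m, rfl⟩ : ∃ m', m = m' + 1 := ⟨m - 1, by omega⟩
    refine ihψ ht hc hR hs (by omega) fun v₁ => ihφ rfl hc hR rfl (by omega) fun v₂ => ?_
    refine wp_evalTable_cons rfl <| wp_branch_false rfl <| wp_branch_false rfl <|
      wp_branch_false rfl <| wp_branch_false rfl <| wp_branch_false rfl <| wp_branch_true rfl <|
      wp_connective rfl rfl fun v₃ => ?_
    simpa [PosBool.encode, PosBool.eval] using h v₃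
  | or φ ψ ihφ ihψ =>
    simp only [PosBool.encode, List.reverse_cons, List.reverse_append, List.append_assoc,
      List.singleton_append] at ht
    simp only [PosBool.encode, List.length_cons, List.length_append] at hm
    have := length_encode_pos num φ
    have := length_encode_pos num ψ
    obtain ⟨m, rfl⟩ : ∃ m', m = m' + 1 := ⟨m - 1, by omega⟩
    refine ihψ ht hc hR hs (by omega) fun v₁ => ihφ rfl hc hR rfl (by omega) fun v₂ => ?_
    refine wp_evalTable_cons rfl <| wp_branch_false rfl <| wp_branch_false rfl <|
      wp_branch_false rfl <| wp_branch_false rfl <| wp_branch_false rfl <| wp_branch_false rfl <|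
      wp_branch_true rfl <| wp_connective rfl rfl fun v₃ => ?_
    simpa [PosBool.encode, PosBool.eval] using h v₃

/-- The last formula is evaluated first, so that the values end up on the stack in the order of the
table. -/
theorem wp_evalTable_formulae {S : Type} {num : S → ℕ} {cellOf : S → Cell} {C : List Cell}
    (hC : ∀ q, C[num q]? = some (cellOf q)) (φs : List (PosBool S)) {v : Reg} {t : Tapes} {m : ℕ}
    {l : List Token} (ht : t.table = (φs.flatMap (·.encode num)).reverse ++ l) (hc : t.cells = C)
    (hR : t.cellsR = []) (hs : t.spare = List.replicate (m + φs.length) ())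
    (hm : (φs.flatMap (·.encode num)).length ≤ m + φs.length)
    (h : ∀ v', wp (evalTable i j) Q v' { t with
      table := l
      tableR := φs.flatMap (·.encode num) ++ t.tableR
      vals := φs.map (·.eval (fun q => cellOf q i) (fun q => cellOf q j)) ++ t.vals
      spare := List.replicate m () }) :
    wp (evalTable i j) Q v t := by
  induction φs generalizing v t m l with
  | nil =>
    cases t
    dsimp only at ht hs
    subst ht hs
    exact h v
  | cons φ φs ih =>
    simp only [List.flatMap_cons, List.reverse_append, List.append_assoc] at ht
    simp only [List.flatMap_cons, List.length_append, List.length_cons] at hm hs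
    have := length_encode_pos num φ
    refine ih (m := m + 1) ht hc hR (by rw [hs]; congr 1; omega) (by omega) fun v₁ => ?_
    refine wp_evalTable_formula hC φ rfl hc hR rfl ?_ fun v₂ => ?_
    · have := length_le_length_flatMap_encode num φs
      omega
    · simpa using h v₂

end Eval

/-- Evaluate all the formulae in the table, and put back the table. -/
def computeVals (i j : Fin 5) : P :=
  block [evalTable i j,
    .drain .tableR (fun v x => { v with tok := x }) (.push .table (·.tok))]

theorem wp_computeVals {i j : Fin 5} {Q : Reg → Tapes → Prop} {S : Type} {num : S → ℕ}
    {cellOf : S → Cell} {C : List Cell} (hC : ∀ q, C[num q]? = some (cellOf q))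
    {φs : List (PosBool S)} {v : Reg} {t : Tapes} {m : ℕ}
    (ht : t.table = (φs.flatMap (·.encode num)).reverse) (htR : t.tableR = []) (hc : t.cells = C)
    (hR : t.cellsR = []) (hs : t.spare = List.replicate (m + φs.length) ())
    (hm : (φs.flatMap (·.encode num)).length ≤ m + φs.length)
    (h : ∀ v', Q v' { t with
      vals := φs.map (·.eval (fun q => cellOf q i) (fun q => cellOf q j)) ++ t.vals
      spare := List.replicate m () }) :
    wp (computeVals i j) Q v t := by
  refine wp_block_cons <| wp_evalTable_formulae hC φs (l := []) (by simpa using ht) hc hR hs hm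
    fun v₁ => wp_drain_nil rfl <| wp_block_cons ?_
  suffices H : ∀ (l : List Token) (v : Reg) (t : Tapes) (Q : Reg → Tapes → Prop), t.tableR = l →
      (∀ v', Q v' { t with table := l.reverse ++ t.table, tableR := [] }) →
      wp (.drain .tableR (fun v x => { v with tok := x }) (.push .table (·.tok))) Q v t by
    refine H _ _ _ _ rfl fun v₂ => wp_block_nil ?_
    have := h v₂
    simpa [htR, ht] using this
  intro l
  induction l with
  | nil =>
    intro v t Q hl h
    cases t
    dsimp only at hl
    subst hl
    exact wp_drain_nil rfl (h v)
  | cons x l ih =>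
    intro v t Q hl h
    refine wp_drain_cons hl (wp_push (ih _ _ _ rfl fun v' => ?_))
    simpa [Tapes.put, Tapes.get] using h _

/-! ### Checking values -/

/-- Discard a value. -/
def dropVal : P := .pop .vals (fun v _ => v) (.push .spare fun _ => ()) skip

/-- Discard two values for each letter before the current one. -/
def dropBefore : P :=
  block [.drain .lettersL (fun v _ => v) (block [dropVal, dropVal, .push .lettersT fun _ => ()]),
    .drain .lettersT (fun v _ => v) (.push .lettersL fun _ => ())]

/-- Discard two values for each letter after the current one. -/
def dropAfter : P :=
  block [.drain .lettersR (fun v _ => v) (block [dropVal, dropVal, .push .lettersT fun _ => ()]),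
    .drain .lettersT (fun v _ => v) (.push .lettersR fun _ => ())]

theorem wp_drain_lettersT_lettersL {Q : Reg → Tapes → Prop} {v : Reg} {t : Tapes} {a b : ℕ}
    (hT : t.lettersT = List.replicate a ()) (hL : t.lettersL = List.replicate b ())
    (h : Q v { t with lettersT := [], lettersL := List.replicate (b + a) () }) :
    wp (.drain .lettersT (fun v _ => v) (.push .lettersL fun _ => ())) Q v t := by
  induction a generalizing b t with
  | zero =>
    cases t
    dsimp only at hT hL
    subst hT hL
    exact wp_drain_nil rfl h
  | succ a ih =>
    refine wp_drain_cons hT (wp_push (ih rfl (b := b + 1) (congrArg (() :: ·) hL) ?_))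
    rw [Nat.add_assoc, Nat.add_comm 1]
    exact h

theorem wp_dropBefore {Q : Reg → Tapes → Prop} {v : Reg} {t : Tapes} {a m : ℕ} {l r : List Bool}
    (hL : t.lettersL = List.replicate a ()) (hT : t.lettersT = []) (hv : t.vals = l ++ r)
    (hl : l.length = 2 * a) (hs : t.spare = List.replicate m ())
    (h : Q v { t with vals := r, spare := List.replicate (m + 2 * a) () }) :
    wp dropBefore Q v t := by
  refine wp_block_cons ?_
  suffices H : ∀ a b m l t (Q : Reg → Tapes → Prop), l.length = 2 * a →
      t.lettersL = List.replicate a () → t.lettersT = List.replicate b () → t.vals = l ++ r →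
      t.spare = List.replicate m () →
      Q v { t with
        lettersL := []
        lettersT := List.replicate (b + a) ()
        vals := r
        spare := List.replicate (m + 2 * a) () } →
      wp (.drain .lettersL (fun v _ => v)
        (block [dropVal, dropVal, .push .lettersT fun _ => ()])) Q v t by
    refine H a 0 m l t _ hl hL hT hv hs (wp_block_cons ?_)
    refine wp_drain_lettersT_lettersL rfl (b := 0) rfl (wp_block_nil ?_)
    simpa [← hL, ← hT] using h
  intro a
  induction a with
  | zero =>
    intro b m l t Q hl hL hT hv hs h
    obtain rfl : l = [] := List.length_eq_zero_iff.1 hl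
    cases t
    dsimp only at hL hT hv hs
    subst hL hT hv hs
    exact wp_drain_nil rfl h
  | succ a ih =>
    intro b m l t Q hl hL hT hv hs h
    match l, hl with
    | x :: y :: l, hl =>
      refine wp_drain_cons hL <| wp_block_cons <| wp_pop_cons hv <| wp_push <| wp_block_cons <|
        wp_pop_cons rfl <| wp_push <| wp_block_cons <| wp_push <| wp_block_nil <|
        ih (b + 1) (m + 2) l _ _ (by simp at hl; omega) rfl (congrArg (() :: ·) hT) rfl
          (congrArg (() :: () :: ·) hs) ?_
      rw [show b + 1 + a = b + (a + 1) by omega, show m + 2 + 2 * a = m + 2 * (a + 1) by omega]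
      exact h

theorem wp_drain_lettersT_lettersR {Q : Reg → Tapes → Prop} {v : Reg} {t : Tapes} {a b : ℕ}
    (hT : t.lettersT = List.replicate a ()) (hL : t.lettersR = List.replicate b ())
    (h : Q v { t with lettersT := [], lettersR := List.replicate (b + a) () }) :
    wp (.drain .lettersT (fun v _ => v) (.push .lettersR fun _ => ())) Q v t := by
  induction a generalizing b t with
  | zero =>
    cases t
    dsimp only at hT hL
    subst hT hL
    exact wp_drain_nil rfl h
  | succ a ih =>
    refine wp_drain_cons hT (wp_push (ih rfl (b := b + 1) (congrArg (() :: ·) hL) ?_))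
    rw [Nat.add_assoc, Nat.add_comm 1]
    exact h

theorem wp_dropAfter {Q : Reg → Tapes → Prop} {v : Reg} {t : Tapes} {a m : ℕ} {l r : List Bool}
    (hL : t.lettersR = List.replicate a ()) (hT : t.lettersT = []) (hv : t.vals = l ++ r)
    (hl : l.length = 2 * a) (hs : t.spare = List.replicate m ())
    (h : Q v { t with vals := r, spare := List.replicate (m + 2 * a) () }) :
    wp dropAfter Q v t := by
  refine wp_block_cons ?_
  suffices H : ∀ a b m l t (Q : Reg → Tapes → Prop), l.length = 2 * a →
      t.lettersR = List.replicate a () → t.lettersT = List.replicate b () → t.vals = l ++ r →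
      t.spare = List.replicate m () →
      Q v { t with
        lettersR := []
        lettersT := List.replicate (b + a) ()
        vals := r
        spare := List.replicate (m + 2 * a) () } →
      wp (.drain .lettersR (fun v _ => v)
        (block [dropVal, dropVal, .push .lettersT fun _ => ()])) Q v t by
    refine H a 0 m l t _ hl hL hT hv hs (wp_block_cons ?_)
    refine wp_drain_lettersT_lettersR rfl (b := 0) rfl (wp_block_nil ?_)
    simpa [← hL, ← hT] using h
  intro a
  induction a with
  | zero =>
    intro b m l t Q hl hL hT hv hs h
    obtain rfl : l = [] := List.length_eq_zero_iff.1 hl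
    cases t
    dsimp only at hL hT hv hs
    subst hL hT hv hs
    exact wp_drain_nil rfl h
  | succ a ih =>
    intro b m l t Q hl hL hT hv hs h
    match l, hl with
    | x :: y :: l, hl =>
      refine wp_drain_cons hL <| wp_block_cons <| wp_pop_cons hv <| wp_push <| wp_block_cons <|
        wp_pop_cons rfl <| wp_push <| wp_block_cons <| wp_push <| wp_block_nil <|
        ih (b + 1) (m + 2) l _ _ (by simp at hl; omega) rfl (congrArg (() :: ·) hT) rfl
          (congrArg (() :: () :: ·) hs) ?_
      rw [show b + 1 + a = b + (a + 1) by omega, show m + 2 + 2 * a = m + 2 * (a + 1) by omega]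
      exact h

/-- Process the values for a state: if the state is in set number `i`, the flag is cleared unless the
value for the current letter is true. -/
def checkRow (i : Fin 5) (b : Bool) : P :=
  block [.push .cellsR (·.cell), dropBefore,
    .pop .vals (fun v x => { v with bit := x }) (.push .spare fun _ => ()) skip,
    .pop .vals (fun v x => { v with bit := if b then v.bit else x })
      (.push .spare fun _ => ()) skip,
    .load fun v => { v with flag := v.flag && (!v.cell i || v.bit) },
    dropAfter]

/-- Check the values for the states in set number `i`, the current letter, and `b`. -/
def checkVals (i : Fin 5) (b : Bool) : P :=
  block [.load fun v => { v with flag := true },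
    .drain .cells (fun v x => { v with cell := x }) (checkRow i b),
    restoreCells]

/-- A cell together with the values for the letters before the current one, for the current one, and
for the letters after it. -/
structure Row : Type where
  cell : Cell
  before : List Bool
  onTrue : Bool
  onFalse : Bool
  after : List Bool

/-- All the values of a row. -/
def Row.vals (r : Row) : List Bool := r.before ++ r.onTrue :: r.onFalse :: r.after

/-- The value of a row that is checked. -/
def Row.ok (r : Row) (i : Fin 5) (b : Bool) : Bool :=
  !r.cell i || if b then r.onTrue else r.onFalse

/-- Each state owns one row of values. The letters on the left and on the right of the current one
tell how many values to skip, and every value consumed becomes a spare symbol again. -/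
theorem wp_checkVals {i : Fin 5} {b : Bool} {Q : Reg → Tapes → Prop} {v : Reg} {t : Tapes}
    {R : List Row} {m a c : ℕ} (hc : t.cells = R.map Row.cell) (hR : t.cellsR = [])
    (hL : t.lettersL = List.replicate a ()) (hLR : t.lettersR = List.replicate c ())
    (hT : t.lettersT = []) (hv : t.vals = R.flatMap Row.vals)
    (hlen : ∀ r ∈ R, r.before.length = 2 * a ∧ r.after.length = 2 * c)
    (hs : t.spare = List.replicate m ())
    (h : ∀ v', v'.flag = R.all (fun r => r.ok i b) → Q v' { t with
      vals := []
      spare := List.replicate (m + (R.flatMap Row.vals).length) () }) :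
    wp (checkVals i b) Q v t := by
  refine wp_block_cons <| wp_load <| wp_block_cons ?_
  suffices H : ∀ (R : List Row) (v : Reg) (t : Tapes) (m : ℕ) (Q : Reg → Tapes → Prop),
      t.cells = R.map Row.cell → t.lettersL = List.replicate a () →
      t.lettersR = List.replicate c () → t.lettersT = [] → t.vals = R.flatMap Row.vals →
      (∀ r ∈ R, r.before.length = 2 * a ∧ r.after.length = 2 * c) →
      t.spare = List.replicate m () →
      (∀ v', v'.flag = (v.flag && R.all (fun r => r.ok i b)) → Q v' { t with
        cells := []
        cellsR := (R.map Row.cell).reverse ++ t.cellsR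
        vals := []
        spare := List.replicate (m + (R.flatMap Row.vals).length) () }) →
      wp (.drain .cells (fun v x => { v with cell := x }) (checkRow i b)) Q v t by
    refine H R _ t m _ hc hL hLR hT hv hlen hs fun v' hv' =>
      wp_block_cons <| wp_restoreCells fun x => wp_block_nil ?_
    have := h { v' with cell := x } (by simpa using hv')
    simpa [hR, ← hc] using this
  intro R
  induction R with
  | nil =>
    intro v t m Q hc hL hLR hT hv _ hs h
    cases t
    dsimp only at hc hL hLR hT hv hs
    subst hc hL hLR hT hv hs
    exact wp_drain_nil rfl (h v (by simp))
  | cons r R ih =>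
    intro v t m Q hc hL hLR hT hv hlen hs h
    have hr := hlen r (by simp)
    have hv' : t.vals = r.before ++ (r.onTrue :: r.onFalse :: (r.after ++ R.flatMap Row.vals)) := by
      simp [hv, Row.vals]
    refine wp_drain_cons hc <| wp_block_cons <| wp_push <| wp_block_cons <|
      wp_dropBefore hL hT hv' hr.1 hs <| wp_block_cons <| wp_pop_cons rfl <| wp_push <|
      wp_block_cons <| wp_pop_cons rfl <| wp_push <| wp_block_cons <| wp_load <| wp_block_cons <|
      wp_dropAfter (m := m + 2 * a + 2) hLR hT rfl hr.2 rfl <| wp_block_nil <|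
      ih _ _ (m + 2 * a + 2 + 2 * c) _ rfl hL hLR hT rfl (fun r' h' => hlen r' (by simp [h'])) rfl
        fun v' hv' => ?_
    have := h v' (by
      rw [hv']
      simp [Row.ok, Bool.and_assoc])
    have hcount : m + 2 * a + 2 + 2 * c + (R.flatMap Row.vals).length =
        m + ((r :: R).flatMap Row.vals).length := by
      simp [Row.vals, hr.1, hr.2]
      omega
    rw [hcount]
    simpa [Tapes.put, Tapes.get] using this

/-- Check that, for the current letter and `b`, the formulae for the states in set number `k` are
satisfied when sets number `i` and `j` interpret the states. -/
def check (i j k : Fin 5) (b : Bool) : P := block [computeVals i j, checkVals k b]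

/-- The formulae in the order of the table. -/
def tableList {S : Type} {n s : ℕ} (F : Fin n → Fin s → Bool → PosBool S) : List (PosBool S) :=
  (List.finRange n).flatMap fun q => (List.finRange s).flatMap fun a => [F q a true, F q a false]

/-- Evaluating the entire table and then consuming all the values restores every stack; only
registers change, and the flag carries the answer. -/
theorem wp_check {i j k : Fin 5} {b : Bool} {Q : Reg → Tapes → Prop} {v : Reg} {t : Tapes}
    {S : Type} {n s : ℕ} {num : S → Fin n} {F : Fin n → Fin s → Bool → PosBool S}
    {x : Fin n → Cell} {a : Fin s} (hc : t.cells = (List.finRange n).map x) (hR : t.cellsR = [])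
    (hL : t.lettersL = List.replicate a ())
    (hLR : t.lettersR = List.replicate (s - 1 - a) ()) (hT : t.lettersT = [])
    (ht : t.table = ((tableList F).flatMap (·.encode fun q => (num q : ℕ))).reverse)
    (htR : t.tableR = []) (hv : t.vals = [])
    (hs : t.spare = List.replicate
      ((tableList F).flatMap (·.encode fun q => (num q : ℕ))).length ())
    (h : ∀ v', v'.flag = (List.finRange n).all (fun q =>
      !x q k || (F q a b).eval (fun p => x (num p) i) (fun p => x (num p) j)) → Q v' t) :
    wp (check i j k b) Q v t := by
  -- `m` is the number of spare symbols left when all the values are on the stack.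
  obtain ⟨m, hm⟩ := Nat.exists_eq_add_of_le'
    (length_le_length_flatMap_encode (fun q => (num q : ℕ)) (tableList F))
  refine wp_block_cons <| wp_computeVals (m := m) (cellOf := fun p => x (num p)) (fun q => ?_) ht
    htR hc hR (by rw [hs, hm]) hm.le fun v₁ => wp_block_cons ?_
  · simp
  set ev : PosBool S → Bool := fun φ => φ.eval (fun p => x (num p) i) (fun p => x (num p) j)
  have hev : (tableList F).map ev = (List.finRange n).flatMap fun q =>
      (List.finRange s).flatMap fun a => [ev (F q a true), ev (F q a false)] := by
    simp [tableList, List.map_flatMap]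
  let g : Fin n → Fin s → List Bool := fun q a => [ev (F q a true), ev (F q a false)]
  let R : List Row := (List.finRange n).map fun q =>
    { cell := x q
      before := ((List.finRange s).take a).flatMap (g q)
      onTrue := ev (F q a true)
      onFalse := ev (F q a false)
      after := ((List.finRange s).drop (a + 1)).flatMap (g q) }
  -- Every row is split at the current letter, with two values, for `true` and `false`, per letter.
  have hsplit : List.finRange s =
      (List.finRange s).take a ++ a :: (List.finRange s).drop (a + 1) := by
    have ha : (a : ℕ) < (List.finRange s).length := by simp
    conv_lhs => rw [← List.take_append_drop a (List.finRange s), List.drop_eq_getElem_cons ha]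
    simp
  have hRv : R.flatMap Row.vals = (tableList F).map ev := by
    rw [hev]
    simp only [R, List.flatMap_map]
    congr 1
    funext q
    conv_rhs => rw [hsplit]
    simp [Row.vals, g]
  have hlen2 : ∀ q (l : List (Fin s)), (l.flatMap (g q)).length = 2 * l.length := by
    intro q l
    simp [g, List.length_flatMap, mul_comm]
  refine wp_checkVals (R := R) (a := a) (c := s - 1 - a) (m := m) ?_ hR hL hLR hT ?_ ?_ rfl
    fun v₂ hv₂ => wp_block_nil ?_
  · rw [hc]
    simp [R]
  · rw [hRv]
    simp [hv, ev]
  · intro r hr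
    simp only [R, List.mem_map] at hr
    obtain ⟨q, -, rfl⟩ := hr
    refine ⟨?_, ?_⟩
    · rw [hlen2]
      simp
    · rw [hlen2]
      simp
      omega
  · rw [hRv, List.length_map, ← hm, ← hs]
    have := h v₂ (by
      rw [hv₂]
      simp only [R, List.all_map]
      congr 1
      funext q
      cases b <;> rfl)
    simpa [← hv] using this

end IPCANTWriter

namespace IPCANTWriter

/-! ### Bit vectors as functions -/

/-- All the functions from `Fin n` to `Bool`. -/
def bitFuns (n : ℕ) : List (Fin n → Bool) := (bitVecs n).map fun l q => l.getD q false

theorem mem_bitFuns {n : ℕ} (b : Fin n → Bool) : b ∈ bitFuns n := by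
  refine List.mem_map.2 ⟨List.ofFn b, mem_bitVecs.2 (by simp), ?_⟩
  funext q
  simp

/-- The cells in which set number `i` is changed to `b`. -/
def withSet {n : ℕ} (x : Fin n → Cell) (i : Fin 5) (b : Fin n → Bool) (q : Fin n) : Cell :=
  Function.update (x q) i (b q)

theorem setTrack_map_finRange {n : ℕ} (x : Fin n → Cell) (i : Fin 5) {l : List Bool}
    (hl : l.length = n) :
    setTrack i ((List.finRange n).map x) l =
      (List.finRange n).map (withSet x i fun q => l.getD q false) := by
  subst hl
  refine List.ext_getElem (by simp [setTrack]) fun k h₁ h₂ => ?_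
  simp [setTrack, withSet]

theorem emits_forSubsets_finRange {i : Fin 5} {p : P} {t : Tapes} {n : ℕ} {x : Fin n → Cell}
    {g : (Fin n → Bool) → List Token} (ht : t.cellsR = [])
    (hc : t.cells = (List.finRange n).map x) (hx : ∀ q, x q i = false)
    (h : ∀ b, Emits p { t with cells := (List.finRange n).map (withSet x i b) } (g b)) :
    Emits (forSubsets i p) t ((bitFuns n).flatMap g) := by
  have hlen : ((List.finRange n).map x).length = n := by simp
  have := emits_forSubsets (i := i) (p := p) (t := t) (l := (List.finRange n).map x)
    (g := fun l => g fun q => l.getD q false) ht ?_ ?_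
  · rw [hlen] at this
    rwa [bitFuns, List.flatMap_map]
  · rw [hc, setTrack_map_finRange _ _ (by simp)]
    refine List.map_congr_left fun q _ => ?_
    funext k
    by_cases hk : k = i
    · subst hk
      simp [withSet, hx]
    · simp [withSet, hk]
  · intro l hl
    rw [hlen] at hl
    rw [setTrack_map_finRange _ _ hl]
    exact h _

/-! ### Writing -/

section Write

variable {S : Type} {n s : ℕ}

/-- A bit vector with a preceding bit. -/
def vec (x : Token) (b : Fin n → Bool) : List Token :=
  x :: ((List.finRange n).map (fun q => bitTok (b q)) ++ [.sep])

/-- Write set number `i` with a preceding bit. -/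
def writeSet (x : Token) (i : Fin 5) : P := block [emit x, emitTrack i, emit .sep]

theorem emits_writeSet (y : Token) (i : Fin 5) {t : Tapes} {x : Fin n → Cell} {b : Fin n → Bool}
    (ht : t.cellsR = []) (hc : t.cells = (List.finRange n).map x) (hb : ∀ q, x q i = b q) :
    Emits (writeSet y i) t (vec y b) := by
  have := (emits_emit y t).block_cons <| (emits_emitTrack i ht).block_cons <|
    (emits_emit .sep t).block_cons .block_nil
  simpa [writeSet, vec, hc, hb, Function.comp_def] using this

theorem emits_branch {p q : P} {t : Tapes} {w : List Token} {β : Bool}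
    (hp : ∀ o v (Q : Reg → Tapes → Prop), (∀ v', v'.flag = β → Q v' { t with out := o }) →
      wp p Q v { t with out := o }) (hq : Emits q t w) :
    Emits (block [p, .branch (·.flag) q skip]) t (if β then w else []) := by
  intro o v
  refine wp_block_cons (hp o v _ fun v' hv' => wp_block_cons ?_)
  cases β with
  | false => exact wp_branch_false hv' (wp_skip (wp_block_nil rfl))
  | true => exact wp_branch_true hv' (wp_mono (hq o v') fun _ _ h => wp_block_nil h)

/-- The condition for the formulae for a letter and the states in `d` to be satisfied. -/
def allSat (num : S → Fin n) (F : Fin n → PosBool S) (c c' d : Fin n → Bool) : Bool :=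
  (List.finRange n).all fun q => !d q || (F q).eval (fun p => c (num p)) (fun p => c' (num p))

/-- The stacks while transitions are written. -/
structure Ready (num : S → Fin n) (F : Fin n → Fin s → Bool → PosBool S) (x : Fin n → Cell)
    (t : Tapes) : Prop where
  cells : t.cells = (List.finRange n).map x
  cellsR : t.cellsR = []
  lettersT : t.lettersT = []
  table : t.table = ((tableList F).flatMap (·.encode fun q => (num q : ℕ))).reverse
  tableR : t.tableR = []
  vals : t.vals = []
  spare : t.spare = List.replicate
    ((tableList F).flatMap (·.encode fun q => (num q : ℕ))).length ()

variable {num : S → Fin n} {F : Fin n → Fin s → Bool → PosBool S} {x : Fin n → Cell} {t : Tapes}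

theorem Ready.withSet (ht : Ready num F x t) (i : Fin 5) (b : Fin n → Bool) :
    Ready num F (withSet x i b)
      { t with cells := (List.finRange n).map (IPCANTWriter.withSet x i b) } :=
  { ht with cells := rfl }

theorem Ready.withLetter (ht : Ready num F x t) (l r : List Unit) :
    Ready num F x { t with lettersL := l, lettersR := r } :=
  { ht with }

theorem Ready.emits_check {q : P} {w : List Token} {i j k : Fin 5} {b : Bool} {a : Fin s}
    {c c' d : Fin n → Bool} (ht : Ready num F x t)
    (hL : t.lettersL = List.replicate a ()) (hR : t.lettersR = List.replicate (s - 1 - a) ())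
    (hc : ∀ q, x q i = c q) (hc' : ∀ q, x q j = c' q) (hd : ∀ q, x q k = d q)
    (hq : Emits q t w) :
    Emits (block [check i j k b, .branch (·.flag) q skip]) t
      (if allSat num (fun q => F q a b) c c' d then w else []) := by
  refine emits_branch (fun o v Q hQ => ?_) hq
  refine wp_check (t := { t with out := o }) ht.cells ht.cellsR hL hR ht.lettersT ht.table
    ht.tableR ht.vals ht.spare fun v' hv' => hQ v' ?_
  rw [hv']
  simp only [allSat, hc, hc', hd]

/-- The transfer for a letter and a set. -/
def transferWord (num : S → Fin n) (F : Fin n → Fin s → Bool → PosBool S) (a : Fin s)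
    (e : Fin n → Bool) : List Token :=
  .transf :: .lpar :: ((bitFuns n).flatMap fun d => (bitFuns n).flatMap fun d' =>
    if allSat num (fun q => F q a false) d' e d then vec .one d ++ vec .one d' else []) ++ [.rpar]

/-- Write the transfer for the current letter and set number 3. -/
def writeTransfer : P :=
  block [emit .transf, emit .lpar,
    forSubsets 1 (forSubsets 2 (block [check 2 3 1 false,
      .branch (·.flag) (block [writeSet .one 1, writeSet .one 2]) skip])),
    emit .rpar]

/-- Sets number 1 and 2 run through sources `d` and targets `d'`, while set number 3 holds `e`. The
check takes the formulae of `d` for a different datum, with `d'` for stored states and `e` for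
`↓`-states, which is `Moves`. -/
theorem Ready.emits_writeTransfer {a : Fin s} {e : Fin n → Bool} (ht : Ready num F x t)
    (hL : t.lettersL = List.replicate a ()) (hR : t.lettersR = List.replicate (s - 1 - a) ())
    (h1 : ∀ q, x q 1 = false) (h2 : ∀ q, x q 2 = false) (h3 : ∀ q, x q 3 = e q) :
    Emits writeTransfer t (transferWord num F a e) := by
  have hloop : Emits (forSubsets 1 (forSubsets 2 (block [check 2 3 1 false,
      .branch (·.flag) (block [writeSet .one 1, writeSet .one 2]) skip]))) t
      ((bitFuns n).flatMap fun d => (bitFuns n).flatMap fun d' =>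
        if allSat num (fun q => F q a false) d' e d then
          vec .one d ++ (vec .one d' ++ []) else []) := by
    refine emits_forSubsets_finRange ht.cellsR ht.cells h1 fun d => ?_
    have ht₁ := ht.withSet 1 d
    refine emits_forSubsets_finRange ht₁.cellsR ht₁.cells
      (by simp [IPCANTWriter.withSet, h2]) fun d' => ?_
    have ht₂ := ht₁.withSet 2 d'
    refine ht₂.emits_check hL hR (by simp [IPCANTWriter.withSet])
      (by simp [IPCANTWriter.withSet, h3]) (by simp [IPCANTWriter.withSet]) ?_
    refine (emits_writeSet _ _ ht₂.cellsR ht₂.cells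
        (by simp [IPCANTWriter.withSet])).block_cons <|
      (emits_writeSet _ _ ht₂.cellsR ht₂.cells
        (by simp [IPCANTWriter.withSet])).block_cons .block_nil
  have := (emits_emit .transf t).block_cons <| (emits_emit .lpar t).block_cons <|
    hloop.block_cons <| (emits_emit .rpar t).block_cons .block_nil
  simpa [writeTransfer, transferWord] using this

/-- The transition that reads a letter. -/
def readWord (num : S → Fin n) (F : Fin n → Fin s → Bool → PosBool S) (a : Fin s)
    (c e : Fin n → Bool) : List Token :=
  vec .zero c ++ .letter :: Token.tally a ++ transferWord num F a e ++ vec .one e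

/-- Write the transitions that read letters. -/
def writeReads : P :=
  forSubsets 3 (forSubsets 0 (forLetters (block [check 3 3 0 true,
    .branch (·.flag) (block [writeSet .zero 0, emit .letter, emitLetter, emit .sep, writeTransfer,
      writeSet .one 3]) skip])))

/-- Sets number 3 and 0 run through `e` and `c`. The check interprets both kinds of atoms by `e`,
which is `Reads`. Sets number 1 and 2 stay empty for the transfer written inside. -/
theorem Ready.emits_writeReads (ht : Ready num F x t) (hL : t.lettersL = [])
    (hR : t.lettersR = List.replicate s ()) (h0 : ∀ q, x q 0 = false) (h1 : ∀ q, x q 1 = false)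
    (h2 : ∀ q, x q 2 = false) (h3 : ∀ q, x q 3 = false) :
    Emits writeReads t ((bitFuns n).flatMap fun e => (bitFuns n).flatMap fun c =>
      (List.finRange s).flatMap fun a =>
        if allSat num (fun q => F q a true) e e c then readWord num F a c e else []) := by
  refine emits_forSubsets_finRange ht.cellsR ht.cells h3 fun e => ?_
  have ht₁ := ht.withSet 3 e
  refine emits_forSubsets_finRange ht₁.cellsR ht₁.cells (by simp [IPCANTWriter.withSet, h0]) fun c => ?_
  have ht₂ := ht₁.withSet 0 c
  have key : ∀ a : Fin s, Emits (block [check 3 3 0 true,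
      .branch (·.flag) (block [writeSet .zero 0, emit .letter, emitLetter, emit .sep, writeTransfer,
        writeSet .one 3]) skip])
      { t with
        cells := (List.finRange n).map (IPCANTWriter.withSet (IPCANTWriter.withSet x 3 e) 0 c)
        lettersL := List.replicate a ()
        lettersR := List.replicate (s - 1 - a) () }
      (if allSat num (fun q => F q a true) e e c then readWord num F a c e else []) := by
    intro a
    have ht₃ := ht₂.withLetter (List.replicate a ()) (List.replicate (s - 1 - a) ())
    refine ht₃.emits_check rfl rfl (by simp [IPCANTWriter.withSet])
      (by simp [IPCANTWriter.withSet]) (by simp [IPCANTWriter.withSet]) ?_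
    have := (emits_writeSet .zero 0 (b := c) ht₃.cellsR ht₃.cells
        (by simp [IPCANTWriter.withSet])).block_cons <|
      (emits_emit .letter _).block_cons <|
      (emits_emitLetter (a := a) rfl ht₃.lettersT).block_cons <|
      (emits_emit .sep _).block_cons <|
      (ht₃.emits_writeTransfer (a := a) (e := e) rfl rfl (by simp [IPCANTWriter.withSet, h1])
        (by simp [IPCANTWriter.withSet, h2]) (by simp [IPCANTWriter.withSet])).block_cons <|
      (emits_writeSet .one 3 (b := e) ht₃.cellsR ht₃.cells
        (by simp [IPCANTWriter.withSet])).block_cons .block_nil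
    simpa [readWord, Token.tally] using this
  -- The loop over letters is indexed by natural numbers; the value outside the range is never used.
  have := emits_forLetters (t := { t with
      cells := (List.finRange n).map (IPCANTWriter.withSet (IPCANTWriter.withSet x 3 e) 0 c) })
    (n := s) (g := fun a => if ha : a < s then
      (if allSat num (fun q => F q ⟨a, ha⟩ true) e e c then readWord num F ⟨a, ha⟩ c e else [])
      else []) hL hR fun a ha => by
    rw [dif_pos ha]
    exact key ⟨a, ha⟩
  have heq : List.range s = (List.finRange s).map Fin.val := by simp
  rw [heq, List.flatMap_map] at this
  simpa using this

/-- The transitions for a set that do not read letters. -/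
def epsWord (c : Fin n → Bool) : List Token :=
  vec .one c ++ .eps :: .inc :: vec .one c ++ [.sep] ++
    (.sep :: .eps :: .dec :: vec .one c ++ vec .zero c)

/-- Write the transitions that do not read letters. -/
def writeEps : P :=
  forSubsets 0 (block [writeSet .one 0, emit .eps, emit .inc, writeSet .one 0, emit .sep, emit .sep,
    emit .eps, emit .dec, writeSet .one 0, writeSet .zero 0])

theorem Ready.emits_writeEps (ht : Ready num F x t) (h0 : ∀ q, x q 0 = false) :
    Emits writeEps t ((bitFuns n).flatMap epsWord) := by
  refine emits_forSubsets_finRange ht.cellsR ht.cells h0 fun c => ?_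
  have ht₁ := ht.withSet 0 c
  have hset := fun y => emits_writeSet y 0 (b := c) ht₁.cellsR ht₁.cells
    (by simp [IPCANTWriter.withSet])
  have := (hset .one).block_cons <| (emits_emit .eps _).block_cons <|
    (emits_emit .inc _).block_cons <| (hset .one).block_cons <| (emits_emit .sep _).block_cons <|
    (emits_emit .sep _).block_cons <| (emits_emit .eps _).block_cons <|
    (emits_emit .dec _).block_cons <| (hset .one).block_cons <| (hset .zero).block_cons .block_nil
  simpa [epsWord] using this

/-- The description of the counter automaton, without the number of letters. -/
def bodyWord (num : S → Fin n) (F : Fin n → Fin s → Bool → PosBool S) (i₀ : Fin n → Bool) :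
    List Token :=
  (.lpar :: ((.sep :: (bitFuns n).flatMap fun c => vec .zero c ++ vec .one c) ++ [.rpar])) ++
    vec .zero i₀ ++ Token.tally (n + 1) ++
    (.lpar :: ((bitFuns n).flatMap (vec .one) ++ [.rpar])) ++
    (.lpar :: (((bitFuns n).flatMap epsWord ++
      (bitFuns n).flatMap fun e => (bitFuns n).flatMap fun c =>
        (List.finRange s).flatMap fun a =>
          if allSat num (fun q => F q a true) e e c then readWord num F a c e else []) ++ [.rpar]))

/-- Write the counter automaton, after the number of letters. -/
def writeBody : P :=
  block [emit .lpar, emit .sep, forSubsets 0 (block [writeSet .zero 0, writeSet .one 0]),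
    emit .rpar, writeSet .zero 4, emit .one, emitStrokes, emit .sep,
    emit .lpar, forSubsets 0 (writeSet .one 0), emit .rpar,
    emit .lpar, writeEps, writeReads, emit .rpar]

/-- The preceding bit has two roles: in names of states it separates `before` (zero) from `after`
(one), and in counters it is the dummy element, hence always one. A lone `.sep` is the empty bit
string, which names `base`. The basis has one element more than there are cells, whence the extra
stroke. -/
theorem Ready.emits_writeBody {i₀ : Fin n → Bool} (ht : Ready num F x t) (hL : t.lettersL = [])
    (hR : t.lettersR = List.replicate s ()) (h0 : ∀ q, x q 0 = false) (h1 : ∀ q, x q 1 = false)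
    (h2 : ∀ q, x q 2 = false) (h3 : ∀ q, x q 3 = false) (h4 : ∀ q, x q 4 = i₀ q) :
    Emits writeBody t (bodyWord num F i₀) := by
  have hset := fun c y => emits_writeSet y 0 (b := c) (ht.withSet 0 c).cellsR
    (ht.withSet 0 c).cells (by simp [IPCANTWriter.withSet])
  have hstates := emits_forSubsets_finRange (p := block [writeSet .zero 0, writeSet .one 0])
    ht.cellsR ht.cells h0 fun c => (hset c .zero).block_cons <| (hset c .one).block_cons .block_nil
  have hcounters := emits_forSubsets_finRange (p := writeSet .one 0)
    ht.cellsR ht.cells h0 fun c => hset c .one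
  have := (emits_emit .lpar t).block_cons <| (emits_emit .sep t).block_cons <|
    hstates.block_cons <| (emits_emit .rpar t).block_cons <|
    (emits_writeSet .zero 4 (b := i₀) ht.cellsR ht.cells h4).block_cons <|
    (emits_emit .one t).block_cons <| (emits_emitStrokes ht.cellsR).block_cons <|
    (emits_emit .sep t).block_cons <| (emits_emit .lpar t).block_cons <|
    hcounters.block_cons <| (emits_emit .rpar t).block_cons <|
    (emits_emit .lpar t).block_cons <| (ht.emits_writeEps h0).block_cons <|
    (ht.emits_writeReads hL hR h0 h1 h2 h3).block_cons <|
    (emits_emit .rpar t).block_cons .block_nil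
  simpa [writeBody, bodyWord, Token.tally, ht.cells, List.replicate_succ] using this

end Write

/-! ### Reading -/

/-- Read a number in tally notation, running `p` for each stroke and `q` at the end. -/
def readTally (p q : P) : P :=
  block [.load fun v => { v with flag := true },
    .loop (·.flag) (.pop .inp (fun v x => { v with tok := x })
      (.branch (fun v => decide (v.tok = .one)) p
        (block [q, .load fun v => { v with flag := false }]))
      (.load fun v => { v with flag := false }))]

/-- `st j` describes the stacks other than the input after `j` strokes. The flag controls the loop,
so `p` must preserve it, while `q` is free to change it. -/
theorem wp_readTally {p q : P} {Q : Reg → Tapes → Prop} {v : Reg} {n : ℕ} {r : List Token}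
    {st : ℕ → Tapes}
    (hp : ∀ j < n, ∀ r v (Q : Reg → Tapes → Prop), v.flag = true →
      (∀ v', v'.flag = true → Q v' { st (j + 1) with inp := r }) →
      wp p Q v { st j with inp := r })
    (hq : ∀ v, wp q (fun v' t' => Q { v' with flag := false } t') v { st n with inp := r }) :
    wp (readTally p q) Q v { st 0 with inp := Token.tally n ++ r } := by
  refine wp_block_cons <| wp_load <| wp_block_cons <| wp_mono ?_ fun v t => wp_block_nil
  suffices H : ∀ m j, j + m = n → ∀ v : Reg, v.flag = true →
      wp (.loop (·.flag) (.pop .inp (fun v x => { v with tok := x })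
      (.branch (fun v => decide (v.tok = .one)) p
        (block [q, .load fun v => { v with flag := false }]))
      (.load fun v => { v with flag := false }))) Q v
      { st j with inp := List.replicate m .one ++ .sep :: r } by
    have := H n 0 (by omega) { v with flag := true } rfl
    simpa [Token.tally] using this
  intro m
  induction m with
  | zero =>
    intro j hj v hv
    obtain rfl : j = n := by omega
    refine wp_loop_true hv <| wp_pop_cons rfl <| wp_branch_false rfl <| wp_block_cons <|
      wp_mono (hq _) fun v' t' h => ?_
    exact wp_block_cons <| wp_load <| wp_block_nil <| wp_loop_false rfl h
  | succ m ih =>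
    intro j hj v hv
    exact wp_loop_true hv <| wp_pop_cons rfl <| wp_branch_true rfl <|
      hp j (by omega) _ _ _ hv fun v' hv' => ih (j + 1) (by omega) v' hv'

/-- Add the current cell to set number 4. -/
def markInit : P :=
  .pop .cells (fun v x => { v with cell := x })
    (.push .cells fun v => Function.update v.cell 4 true) skip

/-- Read the register automaton, and write the number of letters. -/
def readAll : P :=
  block [readTally (block [emit .one, .push .lettersR fun _ => ()]) (emit .sep),
    readTally (.push .cells fun _ _ => false) skip,
    readTally advance markInit, restoreCells,
    .drain .inp (fun v x => { v with tok := x })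
      (block [.push .table (·.tok), .push .spare fun _ => ()])]

/-- The cells after reading the register automaton. -/
def initCells {n : ℕ} (q₀ q : Fin n) : Cell :=
  Function.update (fun _ => false) 4 (decide (q = q₀))

theorem map_initCells {n : ℕ} (q₀ : Fin n) :
    (List.finRange n).map (initCells q₀) =
      List.replicate q₀ (fun _ => false) ++
        Function.update (fun _ => false) 4 true :: List.replicate (n - (q₀ + 1)) (fun _ => false) := by
  refine List.ext_getElem (by simp; omega) fun k h₁ h₂ => ?_
  simp only [List.getElem_map, List.getElem_finRange, initCells]
  rcases lt_trichotomy k q₀ with h | h | h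
  · rw [List.getElem_append_left (by simpa using h)]
    simp [Fin.ext_iff, h.ne]
  · subst h
    simp
  · rw [List.getElem_append_right (by simpa using h.le)]
    obtain ⟨j, hj⟩ := Nat.exists_eq_add_of_lt h
    subst hj
    simp [Fin.ext_iff, Nat.add_assoc]

theorem wp_readAll {Q : Reg → Tapes → Prop} {v : Reg} {n s : ℕ} {q₀ : Fin n} {w : List Token}
    (h : ∀ v', Q v' {
      out := (Token.tally s).reverse
      cells := (List.finRange n).map (initCells q₀)
      lettersR := List.replicate s ()
      table := w.reverse
      spare := List.replicate w.length () }) :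
    wp readAll Q v { inp := Token.tally s ++ (Token.tally n ++ (Token.tally q₀ ++ w)) } := by
  refine wp_block_cons <| wp_readTally
    (st := fun j => { out := List.replicate j .one, lettersR := List.replicate j () }) ?_ ?_
  · intro j _ r v Q hv hQ
    exact wp_block_cons <| wp_push <| wp_block_cons <| wp_push <| wp_block_nil <| hQ v hv
  intro v₁
  refine wp_push <| wp_block_cons ?_
  refine wp_readTally (st := fun j => {
      out := .sep :: List.replicate s .one
      lettersR := List.replicate s ()
      cells := List.replicate j fun _ => false }) ?_ ?_
  · intro j _ r v Q hv hQ
    exact wp_push <| hQ v hv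
  intro v₂
  refine wp_skip <| wp_block_cons ?_
  refine wp_readTally (st := fun j => {
      out := .sep :: List.replicate s .one
      lettersR := List.replicate s ()
      cells := List.replicate (n - j) fun _ => false
      cellsR := List.replicate j fun _ => false }) ?_ ?_
  · intro j hj r v Q hv hQ
    have hn : n - j = n - (j + 1) + 1 := by omega
    refine wp_pop_cons (x := fun _ => false) (l := List.replicate (n - (j + 1)) fun _ => false) ?_ <|
      wp_push <| hQ _ hv
    simp only [Tapes.get, hn, List.replicate_succ]
  intro v₃
  -- After `q₀` strokes the cell of the initial state is on top; it exists because `q₀ < n`.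
  have hn : n - q₀ = n - (q₀ + 1) + 1 := by omega
  refine wp_pop_cons (x := fun _ => false)
    (l := List.replicate (n - (q₀ + 1)) fun _ => false) ?_ <| wp_push <| wp_block_cons <|
    wp_restoreCells fun x => wp_block_cons ?_
  · simp only [Tapes.get, hn, List.replicate_succ]
  suffices H : ∀ (w : List Token) (v : Reg) (t : Tapes) (Q : Reg → Tapes → Prop), t.inp = w →
      (∀ v', Q v' { t with
        inp := []
        table := w.reverse ++ t.table
        spare := List.replicate w.length () ++ t.spare }) →
      wp (.drain .inp (fun v x => { v with tok := x })
        (block [.push .table (·.tok), .push .spare fun _ => ()])) Q v t by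
    refine H _ _ _ _ rfl fun v' => wp_block_nil ?_
    have := h v'
    rw [map_initCells] at this
    simpa [Tapes.put, Tapes.get, Token.tally] using this
  intro w
  induction w with
  | nil =>
    intro v t Q hl h
    cases t
    dsimp only at hl
    subst hl
    exact wp_drain_nil rfl (h v)
  | cons x w ih =>
    intro v t Q hl h
    refine wp_drain_cons hl <| wp_block_cons <| wp_push <| wp_block_cons <| wp_push <|
      wp_block_nil <| ih _ _ _ rfl fun v' => ?_
    simpa [Tapes.put, Tapes.get, List.replicate_succ'] using h _

/-- The whole program. -/
def program : P := .seq readAll writeBody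

/-- The weights of the symbols, for bounding space. -/
def weights : Stack → ℕ
  | .inp => 2
  | .out => 0
  | _ => 1

/-- The check is a computation. The weight 2 of input symbols is what a symbol of the transition
table needs: it is copied to `table` and also yields a symbol on `spare`, which later pays for
values. -/
theorem credit_program : ∃ b, program.credit weights .out 0 = some b := ⟨_, rfl⟩

theorem exec_program {S : Type} {n s : ℕ} (num : S → Fin n)
    (F : Fin n → Fin s → Bool → PosBool S) (q₀ : Fin n) :
    ∃ v' S', Prog.Exec program default (Function.update (fun _ => []) Stack.inp
      (Token.tally s ++ (Token.tally n ++ (Token.tally q₀ ++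
        (tableList F).flatMap (·.encode fun q => (num q : ℕ)))))) v' S' ∧
      (S' Stack.out).reverse =
        Token.tally s ++ bodyWord num F fun q => decide (q = q₀) := by
  have key : wp program (fun _ t => t.out.reverse =
      Token.tally s ++ bodyWord num F fun q => decide (q = q₀)) default
      { inp := Token.tally s ++ (Token.tally n ++ (Token.tally q₀ ++
        (tableList F).flatMap (·.encode fun q => (num q : ℕ)))) } := by
    refine wp_seq <| wp_readAll fun v' => ?_
    refine wp_mono (Ready.emits_writeBody (num := num) (F := F) (x := initCells q₀)
      (i₀ := fun q => decide (q = q₀)) (t := {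
        cells := (List.finRange n).map (initCells q₀)
        lettersR := List.replicate s ()
        table := ((tableList F).flatMap (·.encode fun q => (num q : ℕ))).reverse
        spare := List.replicate
          ((tableList F).flatMap (·.encode fun q => (num q : ℕ))).length () })
      ⟨rfl, rfl, rfl, rfl, rfl, rfl, rfl⟩ rfl rfl ?_ ?_ ?_ ?_ ?_ _ v') ?_
    any_goals intro q; simp [initCells]
  obtain ⟨v', t', he, ht⟩ := key
  refine ⟨v', t'.get, ?_, ht⟩
  convert he using 1
  funext k
  cases k <;> rfl

end IPCANTWriter

/-! ### Enumerations -/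

/-- `EnumeratedBy s R w`: the string `w` is an enumeration of all members of `s`, without
parentheses. -/
def EnumeratedBy {α : Type} (s : Set α) (R : α → List Token → Prop) (w : List Token) : Prop :=
  ∃ L : List (α × List Token),
    (∀ a, a ∈ s ↔ ∃ p ∈ L, p.1 = a) ∧ (∀ p ∈ L, R p.1 p.2) ∧ w = (L.map Prod.snd).flatten

namespace EnumeratedBy

variable {α β : Type} {s t : Set α} {R : α → List Token → Prop} {w w' : List Token}

theorem isListing (h : EnumeratedBy s R w) : IsListing s R (.lpar :: (w ++ [.rpar])) := by
  obtain ⟨L, h₁, h₂, rfl⟩ := h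
  exact ⟨L, h₁, h₂, rfl⟩

theorem empty : EnumeratedBy ∅ R [] := ⟨[], by simp, by simp, rfl⟩

theorem singleton {a : α} (h : R a w) : EnumeratedBy {a} R w :=
  ⟨[(a, w)], by simp [eq_comm], by simpa using h, by simp⟩

theorem append (h : EnumeratedBy s R w) (h' : EnumeratedBy t R w') :
    EnumeratedBy (s ∪ t) R (w ++ w') := by
  obtain ⟨L, h₁, h₂, rfl⟩ := h
  obtain ⟨L', h₁', h₂', rfl⟩ := h'
  refine ⟨L ++ L', fun a => ?_, fun p hp => ?_, by simp⟩
  · simp only [Set.mem_union, h₁, h₁', List.mem_append, or_and_right, exists_or]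
  · exact (List.mem_append.1 hp).elim (h₂ p) (h₂' p)

theorem flatMap {l : List β} {s : β → Set α} {g : β → List Token}
    (h : ∀ b ∈ l, EnumeratedBy (s b) R (g b)) : EnumeratedBy (⋃ b ∈ l, s b) R (l.flatMap g) := by
  induction l with
  | nil => simpa using empty
  | cons b l ih =>
    have := (h b (by simp)).append (ih fun b' hb' => h b' (by simp [hb']))
    simpa [Set.iUnion_or, Set.iUnion_union_distrib] using this

theorem ite {c : Bool} (h : EnumeratedBy s R w) :
    EnumeratedBy {a | c = true ∧ a ∈ s} R (if c then w else []) := by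
  cases c with
  | false => simpa using empty
  | true => simpa using h

end EnumeratedBy

/-! ### The description of the counter automaton -/

open IPCANTWriter

namespace SafetyARA

section Describe

variable {S : Type} (A : SafetyARA S) (eQ : A.Q ≃ Fin (Fintype.card A.Q))

open scoped Classical in
/-- The bit vector of a set of states. -/
noncomputable def setBits (c : Finset A.Q) (i : Fin (Fintype.card A.Q)) : Bool :=
  decide (eQ.symm i ∈ c)

/-- The set of states with a given bit vector. -/
def ofBits (b : Fin (Fintype.card A.Q) → Bool) : Finset A.Q :=
  Finset.univ.filter fun q => b (eQ q) = true

theorem mem_ofBits {b : Fin (Fintype.card A.Q) → Bool} {q : A.Q} :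
    q ∈ A.ofBits eQ b ↔ b (eQ q) = true := by
  simp [ofBits]

theorem setBits_ofBits (b : Fin (Fintype.card A.Q) → Bool) :
    A.setBits eQ (A.ofBits eQ b) = b := by
  funext i
  simp [setBits, ofBits]

theorem ofBits_setBits (c : Finset A.Q) : A.ofBits eQ (A.setBits eQ c) = c := by
  ext q
  rw [mem_ofBits]
  simp [setBits]

theorem setBits_injective : Function.Injective (A.setBits eQ) :=
  Function.LeftInverse.injective (A.ofBits_setBits eQ)

theorem ofBits_surjective : Function.Surjective (A.ofBits eQ) :=
  Function.RightInverse.surjective (A.ofBits_setBits eQ)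

/-- The numbering of the basis, which starts with the dummy element. -/
def basisEquiv : Option A.Q ≃ Fin (Fintype.card (Option A.Q)) :=
  eQ.optionCongr.trans
    ((finSuccEquiv (Fintype.card A.Q)).symm.trans (finCongr Fintype.card_option.symm))

/-- The names of the states. -/
noncomputable def stateName : CounterState A.Q → List Bool
  | .base => []
  | .before c => false :: (List.finRange _).map (A.setBits eQ c)
  | .after e => true :: (List.finRange _).map (A.setBits eQ e)

/-- The leading bit, or its absence, tells the kind of the state, and the remaining bits determine
the set. -/
theorem stateName_injective : Function.Injective (A.stateName eQ) := by
  have h : ∀ c c' : Finset A.Q, (List.finRange _).map (A.setBits eQ c) =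
      (List.finRange _).map (A.setBits eQ c') → c = c' := by
    intro c c' h
    refine A.setBits_injective eQ (funext fun i => ?_)
    exact List.map_inj_left.1 h i (List.mem_finRange i)
  rintro (_ | c | c) (_ | c' | c') hcc' <;> simp only [stateName, List.cons.injEq] at hcc'
  · rfl
  · cases hcc'
  · cases hcc'
  · cases hcc'
  · rw [h _ _ hcc'.2]
  · cases hcc'.1
  · cases hcc'
  · cases hcc'.1
  · rw [h _ _ hcc'.2]

theorem bits_stateName_before (c : Finset A.Q) :
    Token.bits (A.stateName eQ (.before c)) = vec .zero (A.setBits eQ c) := by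
  simp [Token.bits, stateName, vec, bitTok, Function.comp_def]

theorem bits_stateName_after (e : Finset A.Q) :
    Token.bits (A.stateName eQ (.after e)) = vec .one (A.setBits eQ e) := by
  simp [Token.bits, stateName, vec, bitTok, Function.comp_def]

/-- The dummy element has number 0 in the basis and belongs to every counter, so it accounts for the
leading one. -/
theorem encodeSubset_counterEquiv (c : Finset A.Q) :
    A.toIPCANT.encodeSubset (A.basisEquiv eQ) (A.counterEquiv c).1 =
      vec .one (A.setBits eQ c) := by
  classical
  -- The size of the basis equals `|Q| + 1` only propositionally, so splitting off the first bit has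
  -- to pass through a cast.
  have hrange : ∀ {m n : ℕ} (h : m = n + 1) (f : Fin (n + 1) → Bool),
      (List.finRange m).map (fun i => f (finCongr h i)) =
        f 0 :: (List.finRange n).map fun i => f i.succ := by
    rintro _ n rfl f
    simp [List.finRange_succ, Function.comp_def]
  let f : Fin (Fintype.card A.Q + 1) → Bool := fun j =>
    decide ((finSuccEquiv _ j).map eQ.symm ∈ (A.counterEquiv c).1)
  have : (List.finRange (Fintype.card (Option A.Q))).map
      (fun i => decide ((A.basisEquiv eQ).symm i ∈ (A.counterEquiv c).1)) =
        true :: (List.finRange _).map (A.setBits eQ c) := by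
    refine Eq.trans ?_ ((hrange (Fintype.card_option (α := A.Q)) f).trans ?_)
    · exact List.map_congr_left fun i _ => rfl
    simp [f, counterEquiv, setBits]
    exact fun a ha => absurd ha.symm (Fin.succ_ne_zero a)
  unfold SafetyIPCANT.encodeSubset Token.bits
  convert congrArg (fun l : List Bool =>
    l.map (fun b => if b then Token.one else Token.zero) ++ [Token.sep]) this using 1
  · congr!
  · simp [vec, bitTok, Function.comp_def]

theorem allSat_iff {F : Fin (Fintype.card A.Q) → PosBool A.Q}
    {c c' d : Fin (Fintype.card A.Q) → Bool} :
    allSat eQ F c c' d = true ↔ ∀ q ∈ A.ofBits eQ d,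
      (F (eQ q)).Sat (A.ofBits eQ c : Set A.Q) (A.ofBits eQ c' : Set A.Q) := by
  have hset : ∀ b : Fin (Fintype.card A.Q) → Bool,
      {q : A.Q | b (eQ q) = true} = (A.ofBits eQ b : Set A.Q) := by
    intro b
    ext q
    simp [mem_ofBits]
  simp only [allSat, List.all_eq_true, List.mem_finRange, true_imp_iff, Bool.or_eq_true,
    Bool.not_eq_true', PosBool.eval_iff, hset, mem_ofBits]
  constructor
  · intro h q hq
    exact (h (eQ q)).resolve_left (by simp [hq])
  · intro h i
    cases hi : d i with
    | false => exact .inl rfl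
    | true =>
      have := h (eQ.symm i) (by simpa using hi)
      rw [Equiv.apply_symm_apply] at this
      exact .inr this

theorem describedBy_states :
    EnumeratedBy (Set.univ : Set A.toIPCANT.Q) (fun q u => u = Token.bits (A.stateName eQ q))
      (.sep :: (bitFuns (Fintype.card A.Q)).flatMap fun c => vec .zero c ++ vec .one c) := by
  have h₁ : EnumeratedBy {(CounterState.base : CounterState A.Q)}
      (fun q u => u = Token.bits (A.stateName eQ q)) [.sep] := .singleton rfl
  have h₂ := h₁.append <| EnumeratedBy.flatMap (l := bitFuns (Fintype.card A.Q))
    (s := fun b => {.before (A.ofBits eQ b)} ∪ {.after (A.ofBits eQ b)})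
    (g := fun c => vec .zero c ++ vec .one c) fun b _ => by
      refine .append (.singleton ?_) (.singleton ?_)
      · rw [bits_stateName_before, setBits_ofBits]
      · rw [bits_stateName_after, setBits_ofBits]
  convert h₂ using 1
  swap
  · rfl
  refine (Set.eq_univ_of_forall ?_).symm
  rintro (_ | c | c)
  · exact .inl rfl
  · obtain ⟨b, rfl⟩ := A.ofBits_surjective eQ c
    exact .inr (Set.mem_iUnion₂.2 ⟨b, mem_bitFuns b, .inl rfl⟩)
  · obtain ⟨b, rfl⟩ := A.ofBits_surjective eQ c
    exact .inr (Set.mem_iUnion₂.2 ⟨b, mem_bitFuns b, .inr rfl⟩)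

theorem describedBy_counters :
    EnumeratedBy (A.toIPCANT.C : Set (Finset A.toIPCANT.X))
      (fun c u => u = A.toIPCANT.encodeSubset (A.basisEquiv eQ) c)
      ((bitFuns (Fintype.card A.Q)).flatMap (vec .one)) := by
  have := EnumeratedBy.flatMap (l := bitFuns (Fintype.card A.Q))
    (R := fun c u => u = A.toIPCANT.encodeSubset (A.basisEquiv eQ) c)
    (s := fun b => {(A.counterEquiv (A.ofBits eQ b)).1}) (g := vec .one) fun b _ => by
      refine .singleton ?_
      rw [encodeSubset_counterEquiv, setBits_ofBits]
  convert this using 1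
  ext c
  simp only [Set.mem_iUnion, Set.mem_singleton_iff, mem_bitFuns, exists_prop, true_and,
    Finset.mem_coe]
  constructor
  · intro hc
    obtain ⟨d, hd⟩ := A.counterEquiv.surjective ⟨c, hc⟩
    obtain ⟨b, rfl⟩ := A.ofBits_surjective eQ d
    exact ⟨b, by rw [hd]⟩
  · rintro ⟨b, rfl⟩
    exact (A.counterEquiv _).2

variable [Fintype S] (eS : S ≃ Fin (Fintype.card S))

/-- The transition table, in terms of the numbers of states and letters. -/
def table (i : Fin (Fintype.card A.Q)) (a : Fin (Fintype.card S)) (b : Bool) : PosBool A.Q :=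
  A.δ (eQ.symm i) (eS.symm a) b

theorem encode_eq : A.encode eS eQ =
    Token.tally (Fintype.card S) ++ (Token.tally (Fintype.card A.Q) ++
      (Token.tally (eQ A.init) ++
        (tableList (A.table eQ eS)).flatMap (·.encode fun q => (eQ q : ℕ)))) := by
  simp [encode, tableList, table, List.flatMap_assoc]

/-- Bit vectors reach every set of states, so the conditional double enumeration meets exactly the
pairs related by the transfer. -/
theorem describedBy_transfer (a : Fin (Fintype.card S)) (e : Fin (Fintype.card A.Q) → Bool) :
    A.toIPCANT.InstrDescribedBy (A.basisEquiv eQ)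
      (.transf (A.transfer (eS.symm a) (A.ofBits eQ e)))
      (transferWord eQ (A.table eQ eS) a e) := by
  refine ⟨_, rfl, EnumeratedBy.isListing ?_⟩
  have := EnumeratedBy.flatMap (l := bitFuns (Fintype.card A.Q))
    (R := fun (p : A.counters × A.counters) z =>
      z = A.toIPCANT.encodeSubset (A.basisEquiv eQ) p.1.1 ++
        A.toIPCANT.encodeSubset (A.basisEquiv eQ) p.2.1) fun d _ =>
    EnumeratedBy.flatMap (l := bitFuns (Fintype.card A.Q)) fun d' _ =>
    EnumeratedBy.ite (c := allSat eQ (fun q => A.table eQ eS q a false) d' e d)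
      (w := vec .one d ++ vec .one d')
      (EnumeratedBy.singleton
        (a := (A.counterEquiv (A.ofBits eQ d), A.counterEquiv (A.ofBits eQ d'))) (by
          rw [encodeSubset_counterEquiv, encodeSubset_counterEquiv, setBits_ofBits,
            setBits_ofBits]))
  convert this using 1
  ext ⟨c, c'⟩
  obtain ⟨d, rfl⟩ := A.counterEquiv.surjective c
  obtain ⟨d', rfl⟩ := A.counterEquiv.surjective c'
  obtain ⟨b, rfl⟩ := A.ofBits_surjective eQ d
  obtain ⟨b', rfl⟩ := A.ofBits_surjective eQ d'
  simp only [Set.mem_iUnion, mem_bitFuns, exists_prop, true_and, Set.mem_ofPred_eq,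
    Set.mem_singleton_iff, Prod.mk.injEq, EmbeddingLike.apply_eq_iff_eq, allSat_iff, table,
    Equiv.symm_apply_apply]
  refine A.mem_transfer.trans ?_
  simp only [Equiv.symm_apply_apply, Moves]
  constructor
  · intro h
    exact ⟨b, b', h, rfl, rfl⟩
  · rintro ⟨d, d', h, h₁, h₂⟩
    rwa [h₁, h₂]

theorem describedBy_trans :
    EnumeratedBy A.toIPCANT.δ
      (A.toIPCANT.TransDescribedBy eS (A.basisEquiv eQ) (A.stateName eQ))
      ((bitFuns (Fintype.card A.Q)).flatMap epsWord ++
        (bitFuns (Fintype.card A.Q)).flatMap fun e => (bitFuns (Fintype.card A.Q)).flatMap fun c =>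
          (List.finRange (Fintype.card S)).flatMap fun a =>
            if allSat eQ (fun q => A.table eQ eS q a true) e e c then
              readWord eQ (A.table eQ eS) a c e else []) := by
  have h₁ := EnumeratedBy.flatMap (l := bitFuns (Fintype.card A.Q))
    (R := A.toIPCANT.TransDescribedBy eS (A.basisEquiv eQ) (A.stateName eQ)) (g := epsWord)
    (s := fun b =>
      {(.after (A.ofBits eQ b), none, .inc (A.counterEquiv (A.ofBits eQ b)), .base)} ∪
      {(.base, none, .dec (A.counterEquiv (A.ofBits eQ b)), .before (A.ofBits eQ b))}) fun b _ => by
    refine .append (.singleton ⟨_, rfl, ?_⟩) (.singleton ⟨_, rfl, ?_⟩)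
    · simp only [encodeSubset_counterEquiv, setBits_ofBits, bits_stateName_after,
        SafetyIPCANT.encodeLabel]
      simp [Token.bits, stateName]
    · simp only [encodeSubset_counterEquiv, setBits_ofBits, bits_stateName_before,
        SafetyIPCANT.encodeLabel]
      simp [Token.bits, stateName]
  have h₂ := EnumeratedBy.flatMap (l := bitFuns (Fintype.card A.Q))
    (R := A.toIPCANT.TransDescribedBy eS (A.basisEquiv eQ) (A.stateName eQ)) fun e _ =>
    EnumeratedBy.flatMap (l := bitFuns (Fintype.card A.Q)) fun c _ =>
    EnumeratedBy.flatMap (l := List.finRange (Fintype.card S)) fun a _ =>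
    EnumeratedBy.ite (c := allSat eQ (fun q => A.table eQ eS q a true) e e c)
      (w := readWord eQ (A.table eQ eS) a c e)
      (EnumeratedBy.singleton
        (a := (CounterState.before (A.ofBits eQ c), some (eS.symm a),
          CounterInstr.transf (A.transfer (eS.symm a) (A.ofBits eQ e)),
          CounterState.after (A.ofBits eQ e)))
        ⟨_, A.describedBy_transfer eQ eS a e, by
          simp only [bits_stateName_before, bits_stateName_after, setBits_ofBits,
            SafetyIPCANT.encodeLabel, Equiv.apply_symm_apply, readWord]⟩)
  convert h₁.append h₂ using 1
  ext t
  simp only [Set.mem_union, Set.mem_iUnion, mem_bitFuns, exists_prop, true_and,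
    Set.mem_ofPred_eq, Set.mem_singleton_iff, allSat_iff, table, Equiv.symm_apply_apply,
    List.mem_finRange]
  constructor
  · rintro (e | c | ⟨a, c, e, h⟩)
    · obtain ⟨b, rfl⟩ := A.ofBits_surjective eQ e
      exact .inl ⟨b, .inl rfl⟩
    · obtain ⟨b, rfl⟩ := A.ofBits_surjective eQ c
      exact .inl ⟨b, .inr rfl⟩
    · obtain ⟨b, rfl⟩ := A.ofBits_surjective eQ c
      obtain ⟨b', rfl⟩ := A.ofBits_surjective eQ e
      refine .inr ⟨b', b, eS a, ?_, ?_⟩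
      · rwa [Equiv.symm_apply_apply]
      · rw [Equiv.symm_apply_apply]
  · rintro (⟨b, rfl | rfl⟩ | ⟨b', b, a, h, rfl⟩)
    · exact .inc _
    · exact .dec _
    · exact .read _ _ _ h

theorem toIPCANT_describedBy :
    A.toIPCANT.DescribedBy eS (Token.tally (Fintype.card S) ++
      bodyWord eQ (A.table eQ eS) fun q => decide (q = eQ A.init)) := by
  refine ⟨A.basisEquiv eQ, A.stateName eQ, _, _, _, A.stateName_injective eQ,
    (A.describedBy_states eQ).isListing, (A.describedBy_counters eQ).isListing,
    (A.describedBy_trans eQ eS).isListing, ?_⟩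
  have hinit : A.setBits eQ {A.init} = fun q => decide (q = eQ A.init) := by
    funext q
    simp [setBits, Equiv.symm_apply_eq]
  have hcard : Fintype.card A.toIPCANT.X = Fintype.card A.Q + 1 := Fintype.card_option
  rw [bits_stateName_before, hinit, hcard, bodyWord]
  simp only [List.append_assoc]

end Describe

end SafetyARA

theorem mainTheorem4 :
    ∃ (T : Transducer Token Token) (p : Polynomial ℕ) (k : ℕ),
      ∀ (S : Type) [Fintype S] (A : SafetyARA S)
        (eS : S ≃ Fin (Fintype.card S)) (eQ : A.Q ≃ Fin (Fintype.card A.Q)),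
        ∃ (C : SafetyIPCANT S) (w : List Token),
          T.OutputsInSpace (A.encode eS eQ) w (p.eval (A.encode eS eQ).length) ∧
          C.DescribedBy eS w ∧
          Fintype.card C.X ≤ k * Fintype.card A.Q ∧
          C.language = DataWord.str '' A.language ∧
          (C.language.Nonempty ↔ A.language.Nonempty) := by
  -- The polynomial is the initial weight, 2 per input symbol with no initial credit. The constant 2
  -- suffices because there is an initial state, whence `|Q| + 1 ≤ 2 * |Q|`.
  refine ⟨program.transducer weights .inp .out (by decide) (Equiv.refl Token) (Equiv.refl Token)
    credit_program.choose_spec, 2 * Polynomial.X, 2, fun S _ A eS eQ => ⟨A.toIPCANT, _, ?_,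
      A.toIPCANT_describedBy eQ eS, ?_, A.toIPCANT_language, ?_⟩⟩
  · obtain ⟨v', S', hex, hout⟩ := exec_program eQ (A.table eQ eS) (eQ A.init)
    rw [← A.encode_eq eQ eS] at hex
    have := Prog.transducer_outputsInSpace (w := weights) (inp := .inp) (out := .out)
      (hne := by decide) (eI := Equiv.refl Token)
      (eO := Equiv.refl Token) (hp := credit_program.choose_spec) (x := A.encode eS eQ)
      (v' := v') (S' := S') (fun k hk => by cases k <;> simp_all [weights])
      (by simpa using hex)
      (y := Token.tally (Fintype.card S) ++
        bodyWord eQ (A.table eQ eS) fun q => decide (q = eQ A.init)) (by simpa using hout)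
    simpa [weights] using this
  · have hX : Fintype.card A.toIPCANT.X = Fintype.card A.Q + 1 := Fintype.card_option
    have : 0 < Fintype.card A.Q := Fintype.card_pos_iff.2 ⟨A.init⟩
    omega
  · rw [A.toIPCANT_language, Set.image_nonempty]
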